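/- Let $p$ be a prime number, put $\delta=0$ if $p\neq 2$ and $\delta=1$ if $p=2$, and fix embeddings $\overline{\mathbb Q}\hookrightarrow\overline{\mathbb Q_p}$ and $\overline{\mathbb Q}\hookrightarrow\mathbb C$, so that Dirichlet characters may be regarded as taking values in $\overline{\mathbb Q_p}$ or in $\mathbb C$. Let $\omega$ be the Teichmüller character, i.e. the Dirichlet character modulo $p$ (modulo $4$ if $p=2$) with values in $\mathbb Z_p$ such that $\omega(a)\equiv a$ modulo $p$ (modulo $4$ if $p=2$) for all integers $a$ prime to $p$. For an even Dirichlet character $\chi$, let $L_p(s,\chi)$ $(s\in\mathbb Z_p)$ be the Kubota–Leopoldt $p$-adic $L$-function, i.e. the unique continuous function on $\mathbb Z_p$ (on $\mathbb Z_p\setminus\{1\}$ if $\chi=1$) with $$L_p(1-n,\chi)=\bigl(1-\chi\omega^{-n}(p)\,p^{n-1}\bigr)L(1-n,\chi\omega^{-n})\qquad(n\ge 1),$$ where $\chi\omega^{-n}$ denotes the primitive character. For $n\ge 0$ let $\mathbb Q_n$ be the $n$-th layer of the cyclotomic $\mathbb Z_p$-extension of $\mathbb Q$, and let $\mathrm{Gal}(\mathbb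 Q_n/\mathbb Q)^\wedge$ be the group of its characters, viewed as the even Dirichlet characters $\psi$ modulo $p^{n+1+\delta}$ with $\psi^{p^n}=1$. (1) Let $\chi\neq 1$ be an even Dirichlet character whose conductor is not divisible by $p^2$ if $p\ne 2$, and not divisible by $8$ if $p=2$. Let $\mathbb Q_p(\chi)=\mathbb Q_p(\mathrm{im}\,\chi)$ and let $d_\chi$ be the residue degree of $\mathbb Q_p(\chi)/\mathbb Q_p$. Then for every $s\in\mathbb Z_p$ the $p$-adic limit $$\mathcal L(\chi):=\lim_{n\to\infty}\ \prod_{\psi\in\mathrm{Gal}(\mathbb Q_{nd_\chi}/\mathbb Q)^\wedge}2^{-\delta}L_p(s,\chi\psi)$$ exists, lies in $\mathbb Z_p[\mathrm{im}\,\chi]$, and does not depend on $s$. Furthermore, for every $s\in\mathbb Z_p$, $$\prod_{\sigma\in\mathrm{Gal}(\mathbb Q_p(\chi)/\mathbb Q_p)}\mathcal L({}^\sigma\chi)=\lim_{n\to\infty}\ \prod_{\psi\in\mathrm{Gal}(\mathbb Q_n/\mathbb Q)^\wedge}\ \prod_{\sigma\in\mathrm{Gal}(\mathbb Q_p(\chi)/\mathbb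 Q_p)}2^{-\delta}L_p(s,({}^\sigma\chi)\psi)\ \in\ \mathbb Z_p ,$$ where ${}^\sigma\chi(a)=\sigma(\chi(a))$. (2) There exists $c_p\in\mathbb Z_p^\times$ such that for every $s\in\mathbb Z_p\setminus\{1\}$ $$\lim_{n\to\infty}\ p^{\,n+1+\delta}\prod_{\psi\in\mathrm{Gal}(\mathbb Q_n/\mathbb Q)^\wedge}2^{-\delta}L_p(s,\psi)=\frac{c_p}{s-1}.$$ -/

import Mathlib

open Filter Topology

noncomputable section

namespace PadicLimit

/-- `δ = 1` if `p = 2` and `δ = 0` otherwise. -/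
def delta (p : ℕ) : ℕ := if p = 2 then 1 else 0

/-- `q = p` if `p ≠ 2` and `q = 4` if `p = 2`. -/
def conductorQ (p : ℕ) : ℕ := p ^ (1 + delta p)

instance (p : ℕ) [Fact p.Prime] : NeZero (conductorQ p) :=
  ⟨pow_ne_zero _ (Fact.out : p.Prime).ne_zero⟩

instance {m n : ℕ} [NeZero m] [NeZero n] : NeZero (Nat.lcm m n) :=
  ⟨Nat.lcm_ne_zero (NeZero.ne m) (NeZero.ne n)⟩

instance {R : Type*} [CommMonoidWithZero R] {n : ℕ} [NeZero n] (χ : DirichletCharacter R n) :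
    NeZero χ.conductor := ⟨χ.conductor_ne_zero⟩

theorem exists_teichmuller (p : ℕ) [Fact p.Prime] :
    ∃ ω : DirichletCharacter ℤ_[p] (conductorQ p),
      ∀ a : ℕ, ¬ p ∣ a → (conductorQ p : ℤ_[p]) ∣ ω (a : ZMod (conductorQ p)) - (a : ℤ_[p]) := by
  by_cases hp : p = 2
  · subst hp
    have h4 : conductorQ 2 = 4 := by simp [conductorQ, delta]
    rw [h4]
    refine ⟨ZMod.χ₄.ringHomComp (Int.castRingHom ℤ_[2]), fun a ha => ?_⟩
    have key : (4 : ℤ) ∣ ZMod.χ₄ (a : ZMod 4) - (a : ℤ) := by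
      have h : a % 4 = 1 ∨ a % 4 = 3 := by omega
      rcases h with h | h
      · rw [ZMod.χ₄_nat_one_mod_four h]; omega
      · rw [ZMod.χ₄_nat_three_mod_four h]; omega
    have := map_dvd (Int.castRingHom ℤ_[2]) key
    simpa using this
  · have hq : conductorQ p = p := by simp [conductorQ, delta, hp]
    rw [hq]
    let τ : ZMod p →* ℤ_[p] :=
      ((WittVector.equiv p : WittVector p (ZMod p) →* ℤ_[p])).comp (WittVector.teichmuller p)
    refine ⟨{ τ with map_nonunit' := ?_ }, fun a _ => ?_⟩
    · intro a ha
      have h0 : a = 0 := by simpa [isUnit_iff_ne_zero] using ha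
      subst h0
      change WittVector.equiv p (WittVector.teichmuller p 0) = 0
      rw [WittVector.teichmuller_zero, map_zero]
    · change (p : ℤ_[p]) ∣ WittVector.equiv p (WittVector.teichmuller p (a : ZMod p)) - (a : ℤ_[p])
      let f : ℤ_[p] →+* ZMod p :=
        (WittVector.constantCoeff).comp (WittVector.equiv p).symm.toRingHom
      have hf : f (WittVector.equiv p (WittVector.teichmuller p (a : ZMod p)) - (a : ℤ_[p])) = 0 := by
        rw [map_sub f, map_natCast f]
        simp [f, WittVector.teichmuller_coeff_zero]
      rw [← Ideal.mem_span_singleton, ← PadicInt.maximalIdeal_eq_span_p]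
      rw [IsLocalRing.mem_maximalIdeal, mem_nonunits_iff]
      intro hu
      exact (hu.map f).ne_zero hf

/-- The Teichmüller character `ω` of conductor `q`: the unique character modulo `q` with values in
`ℤ_p` such that `ω a ≡ a mod q` for all `a` prime to `p`. -/
def teichmullerChar (p : ℕ) [Fact p.Prime] : DirichletCharacter ℤ_[p] (conductorQ p) :=
  (exists_teichmuller p).choose

variable {p : ℕ} [Fact p.Prime]

/-- The Teichmüller character with values regarded in the algebraic closure of `ℚ_p`. -/
def teichmullerCharAlg (p : ℕ) [Fact p.Prime] :
    DirichletCharacter (PadicAlgCl p) (conductorQ p) :=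
  (teichmullerChar p).ringHomComp (algebraMap ℤ_[p] (PadicAlgCl p))

/-- For a primitive character `χ` with values in `ℚ̄_p` and an integer `m`, the element `v` of `ℚ̄_p`
is the algebraic number `L(m, χ)`, under the embeddings `ιinf : ℚ̄ → ℂ` and `ιp : ℚ̄ → ℚ̄_p`:
`χ` comes from a character `η` with values in `ℚ̄`, and `v` comes from an element of `ℚ̄`
whose image in `ℂ` is the value at `m` of the complex Dirichlet `L`-function of `η`. -/
def IsLValue (ιinf : AlgebraicClosure ℚ →+* ℂ) (ιp : AlgebraicClosure ℚ →+* PadicAlgCl p)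
    {M : ℕ} [NeZero M] (χ : DirichletCharacter (PadicAlgCl p) M) (m : ℤ) (v : PadicAlgCl p) :
    Prop :=
  ∃ (η : DirichletCharacter (AlgebraicClosure ℚ) M) (z : AlgebraicClosure ℚ),
    η.ringHomComp ιp = χ ∧
    ιinf z = DirichletCharacter.LFunction (η.ringHomComp ιinf) (m : ℂ) ∧
    ιp z = v

/-- The primitive Dirichlet character `χ ω⁻ⁿ`. -/
def twist {N : ℕ} (χ : DirichletCharacter (PadicAlgCl p) N) (n : ℕ) :
    DirichletCharacter (PadicAlgCl p)
      (DirichletCharacter.mul χ ((teichmullerCharAlg p)⁻¹ ^ n)).conductor :=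
  DirichletCharacter.primitive_mul χ ((teichmullerCharAlg p)⁻¹ ^ n)

/-- `L` is the Kubota–Leopoldt `p`-adic `L`-function `s ↦ L_p(s, χ)` on `ℤ_p`: it is continuous
(away from the pole `s = 1` if `χ = 1`) and
`L_p(1 - n, χ) = (1 - χω⁻ⁿ(p) p^(n-1)) L(1 - n, χω⁻ⁿ)` for all integers `n ≥ 1`.
Since the integers `1 - n` are dense in `ℤ_p`, there is only one such function; the irrelevant value
at the pole is set to `0`. -/
structure IsPadicLFunction (ιinf : AlgebraicClosure ℚ →+* ℂ)
    (ιp : AlgebraicClosure ℚ →+* PadicAlgCl p) {N : ℕ} [NeZero N]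
    (χ : DirichletCharacter (PadicAlgCl p) N) (L : ℤ_[p] → PadicAlgCl p) : Prop where
  continuousOn : ContinuousOn L {s | χ = 1 → s ≠ 1}
  interpolation : ∀ n : ℕ, 1 ≤ n → ∃ v : PadicAlgCl p,
    IsLValue ιinf ιp (twist χ n) (1 - (n : ℤ)) v ∧
    L (1 - (n : ℤ_[p])) = (1 - twist χ n (p : ZMod _) * (p : PadicAlgCl p) ^ (n - 1)) * v
  pole : χ = 1 → L 1 = 0

theorem IsPadicLFunction.unique {ιinf : AlgebraicClosure ℚ →+* ℂ}
    {ιp : AlgebraicClosure ℚ →+* PadicAlgCl p} {N : ℕ} [NeZero N]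
    {χ : DirichletCharacter (PadicAlgCl p) N} {L L' : ℤ_[p] → PadicAlgCl p}
    (h : IsPadicLFunction ιinf ιp χ L) (h' : IsPadicLFunction ιinf ιp χ L') : L = L' := by
  have hval : ∀ m : ℕ, L (-(m : ℤ_[p])) = L' (-(m : ℤ_[p])) := by
    intro m
    obtain ⟨v, ⟨η, z, h1, h2, h3⟩, h4⟩ := h.interpolation (m + 1) (by omega)
    obtain ⟨v', ⟨η', z', h1', h2', h3'⟩, h4'⟩ := h'.interpolation (m + 1) (by omega)
    have hη : η = η' := by
      ext a
      apply ιp.injective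
      have := congrArg (fun ξ : DirichletCharacter (PadicAlgCl p) _ => ξ a) (h1.trans h1'.symm)
      simpa using this
    subst hη
    have hz : z = z' := ιinf.injective (h2.trans h2'.symm)
    subst hz
    have hv : v = v' := h3.symm.trans h3'
    subst hv
    have e : (1 - ((m + 1 : ℕ) : ℤ_[p])) = -(m : ℤ_[p]) := by push_cast; ring
    rw [e] at h4 h4'
    exact h4.trans h4'.symm
  have hd : DenseRange (fun m : ℕ => -(m : ℤ_[p])) :=
    (Homeomorph.neg ℤ_[p]).surjective.denseRange.comp PadicInt.denseRange_natCast
      (Homeomorph.neg ℤ_[p]).continuous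
  have hsub : Set.range (fun m : ℕ => -(m : ℤ_[p])) ⊆ {s | χ = 1 → s ≠ 1} := by
    rintro _ ⟨m, rfl⟩ _ e
    have : ((m + 1 : ℕ) : ℤ_[p]) = 0 := by
      push_cast
      linear_combination -e
    exact Nat.succ_ne_zero m (by exact_mod_cast this)
  funext s
  by_cases hs : χ = 1 → s ≠ 1
  · have : (𝓝[Set.range (fun m : ℕ => -(m : ℤ_[p]))] s).NeBot :=
      mem_closure_iff_nhdsWithin_neBot.1 (hd s)
    refine tendsto_nhds_unique_of_eventuallyEq ((h.continuousOn s hs).mono hsub)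
      ((h'.continuousOn s hs).mono hsub) ?_
    filter_upwards [self_mem_nhdsWithin] with x hx
    obtain ⟨m, rfl⟩ := hx
    exact hval m
  · obtain ⟨h1, rfl⟩ : χ = 1 ∧ s = 1 := by tauto
    rw [h.pole h1, h'.pole h1]

open Classical in
/-- The Kubota–Leopoldt `p`-adic `L`-function `L_p(s, χ)` of an even character `χ`. -/
def padicL (ιinf : AlgebraicClosure ℚ →+* ℂ) (ιp : AlgebraicClosure ℚ →+* PadicAlgCl p)
    {N : ℕ} [NeZero N] (χ : DirichletCharacter (PadicAlgCl p) N) (s : ℤ_[p]) : PadicAlgCl p :=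
  if h : ∃ L, IsPadicLFunction ιinf ιp χ L then h.choose s else 0

/-- The group of characters of `Gal(ℚ_n / ℚ)`, where `ℚ_n` is the `n`-th layer of the cyclotomic
`ℤ_p`-extension of `ℚ`: the field `ℚ_n` is the real subfield, cyclic of degree `p^n` over `ℚ`,
of the field of `p^(n+1+δ)`-th roots of unity, and its characters are the even Dirichlet characters
modulo `p^(n+1+δ)` of order dividing `p^n`. -/
def layerChars (p : ℕ) [Fact p.Prime] (n : ℕ) :
    Finset (DirichletCharacter (PadicAlgCl p) (p ^ (n + 1 + delta p))) :=
  (Set.toFinite {ψ : DirichletCharacter (PadicAlgCl p) (p ^ (n + 1 + delta p)) |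
    ψ.Even ∧ ψ ^ p ^ n = 1}).toFinset

instance (p n : ℕ) [Fact p.Prime] : NeZero (p ^ n) := ⟨pow_ne_zero _ (Fact.out : p.Prime).ne_zero⟩

/-- The factor `2^(-δ) L_p(s, χψ)`. -/
def factor (ιinf : AlgebraicClosure ℚ →+* ℂ) (ιp : AlgebraicClosure ℚ →+* PadicAlgCl p)
    {N M : ℕ} [NeZero N] [NeZero M] (χ : DirichletCharacter (PadicAlgCl p) N)
    (ψ : DirichletCharacter (PadicAlgCl p) M) (s : ℤ_[p]) : PadicAlgCl p :=
  ((2 : PadicAlgCl p) ^ delta p)⁻¹ * padicL ιinf ιp (DirichletCharacter.mul χ ψ) s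

/-- The product of `2^(-δ) L_p(s, χψ)` over all characters `ψ` of `Gal(ℚ_n / ℚ)`. -/
def layerProduct (ιinf : AlgebraicClosure ℚ →+* ℂ) (ιp : AlgebraicClosure ℚ →+* PadicAlgCl p)
    {N : ℕ} [NeZero N] (χ : DirichletCharacter (PadicAlgCl p) N) (n : ℕ) (s : ℤ_[p]) :
    PadicAlgCl p :=
  ∏ ψ ∈ layerChars p n, factor ιinf ιp χ ψ s

section CharacterField

variable {N : ℕ} [NeZero N] (χ : DirichletCharacter (PadicAlgCl p) N)

/-- The field `ℚ_p(χ) = ℚ_p(im χ)`. -/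
def charField : IntermediateField ℚ_[p] (PadicAlgCl p) :=
  IntermediateField.adjoin ℚ_[p] (Set.range χ)

instance : FiniteDimensional ℚ_[p] (charField χ) :=
  IntermediateField.finiteDimensional_adjoin
    (fun _ _ => (Algebra.IsAlgebraic.isAlgebraic _).isIntegral)

/-- The ring `ℤ_p[im χ]`. -/
def charRing : Subalgebra ℤ_[p] (PadicAlgCl p) := Algebra.adjoin ℤ_[p] (Set.range χ)

/-- The residue degree `d_χ` of `ℚ_p(χ) / ℚ_p`. -/
def residueDegree : ℕ :=
  (IsLocalRing.maximalIdeal ℤ_[p]).inertiaDegIn (integralClosure ℤ_[p] (charField χ))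

/-- A value of `χ` as an element of `ℚ_p(χ)`. -/
def charVal (a : ZMod N) : charField χ :=
  ⟨χ a, IntermediateField.subset_adjoin _ _ ⟨a, rfl⟩⟩

/-- The conjugate character `σχ : a ↦ σ (χ a)`, for `σ` in the Galois group of `ℚ_p(χ) / ℚ_p`. -/
def conj (σ : charField χ ≃ₐ[ℚ_[p]] charField χ) : DirichletCharacter (PadicAlgCl p) N where
  toFun a := (σ (charVal χ a) : PadicAlgCl p)
  map_one' := by
    have h : charVal χ 1 = 1 := Subtype.ext (map_one χ)
    rw [h, map_one]; rfl
  map_mul' a b := by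
    have h : charVal χ (a * b) = charVal χ a * charVal χ b := Subtype.ext (map_mul χ a b)
    rw [h, map_mul]; rfl
  map_nonunit' a ha := by
    have h : charVal χ a = 0 := Subtype.ext (χ.map_nonunit ha)
    rw [h, map_zero]; rfl

end CharacterField

end PadicLimit

end

/-! Interpolation by integral polynomials. After replacing χ by a character modulo d q with d prime
to p, put Q_m = d q p^m. Every integer a prime to p satisfies ⟨a⟩ = (1+q)^i + Q_m r with i = i_m(a)
< p^m and r in ℤ_p. The polynomial `stickPoly`, the sum of χ(a) r X^i over the classes a (for p = 2
only those ≡ 1 mod 4, which is the origin of 2^(-δ)), has integral coefficients. Sums of χψω⁻ⁿ(a) aⁿ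
divided by Q_m tend to generalized Bernoulli numbers, that is, to L-values at 1 - n. Expanding ⟨a⟩ⁿ
to second order in Q_m shows that, with ζ = ψ(1+q), the values of `stickPoly` at ζ(1+q)^(n-1) tend
to -2^(-δ) times the interpolation value, up to a geometric sum that vanishes unless χ is trivial.
Integral polynomials are 1-Lipschitz on the unit ball, so convergence spreads from the dense set of
the 1 - n to all s in ℤ_p. Uniqueness of the interpolation then identifies the limit with the p-adic
L-function, whose existence is obtained on the way (`FirstKind.tendsto_stickPoly`).

Convergence of the products. Evaluation at 1 + q identifies the characters of the n-th layer with
the p^n-th roots of unity (`prod_layerChars`). Let N be the norm operator, (N f)(X^p) = ∏ f(ζX) over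
ζ^p = 1. The product of f(ζx) over ζ^(p^n) = 1 is (N^n f)(x^(p^n)), and for x = (1+q)^(-s) the point
x^(p^n) tends to 1, which removes s. Modulo the maximal ideal N raises coefficients to the p-th
power. If f - g has coefficients of norm at most c, then N f - N g has coefficients of norm at most
max(|p|c, c²). So if x^(p^d) ≡ x on the coefficient ring, d being the residue degree, N^(k+d) f and
N^k f differ by at most c^(k+1) (`Polynomial.CoeffBound.iterate_normOp_sub`). These bounds do not
depend on m, hence pass to the limit, and compactness of ℤ_p[im χ] keeps the limit in it.

The product of the Galois conjugates of the polynomial has coefficients in ℤ_p, where d = 1 works,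
so its limit exists along all n; comparison along a common subsequence gives the product of the
individual limits. For χ = 1 the pole is removed by the factor (1+q)X - 1. The resulting polynomials
take unit values at the relevant points, and the removed factors multiply to 1 - (1+q)^(p^n(1-s)),
which is p^(n+1+δ)(s-1) times a factor tending to a unit. -/

namespace HurwitzZeta

/-! ### The Hurwitz zeta function at 0, and Dirichlet L-values at nonpositive integers. -/

open Complex

/-- The second order Taylor remainder of `y ↦ (n + y)^(-s)` between `1` and `x`. -/
noncomputable def taylorTerm (x : ℝ) (s : ℂ) (n : ℕ) : ℂ :=
  1 / (n + x : ℂ) ^ s - 1 / (n + 1 : ℂ) ^ s - s * (1 - x) * (1 / (n + 1 : ℂ) ^ (s + 1))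

theorem hasDerivAt_ofReal_cpow_neg {n : ℕ} {y : ℝ} (hy : 0 < y) (s : ℂ) :
    HasDerivAt (fun y : ℝ => ((n + y : ℝ) : ℂ) ^ (-s)) (-s * ((n + y : ℝ) : ℂ) ^ (-s - 1)) y := by
  have h0 : ((n + y : ℝ) : ℂ) ∈ slitPlane := by
    rw [ofReal_mem_slitPlane]; positivity
  have h1 : HasDerivAt (fun y : ℝ => ((n + y : ℝ) : ℂ)) 1 y := by
    simpa using ((hasDerivAt_id y).const_add (n : ℝ)).ofReal_comp
  have h2 : HasDerivAt (fun z : ℂ => z ^ (-s)) (-s * ((n + y : ℝ) : ℂ) ^ (-s - 1))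
      ((n + y : ℝ) : ℂ) := by
    have := (hasDerivAt_id ((n + y : ℝ) : ℂ)).cpow_const (c := -s) h0
    rwa [mul_one] at this
  have h3 := HasDerivAt.scomp y h2 h1
  rw [one_smul] at h3
  exact h3

theorem norm_ofReal_cpow_le {x y : ℝ} {n : ℕ} (hx : 0 < x) (hxy : x ≤ y) (w : ℂ) {c : ℝ}
    (hc : 0 ≤ c) (hw : w.re = -c) : ‖((n + y : ℝ) : ℂ) ^ w‖ ≤ (n + x) ^ (-c) := by
  have hn : (0 : ℝ) ≤ n := n.cast_nonneg
  rw [norm_cpow_eq_rpow_re_of_pos (by linarith), hw]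
  apply Real.rpow_le_rpow_of_nonpos <;> first | positivity | linarith

/-- The mean value inequality is applied twice on [x, 1]: to the derivative φ', then to y ↦ φ(y) -
φ'(1) y. The factor ‖s‖ is what makes the sum vanish as s → 0. -/
theorem norm_taylorTerm_le {x : ℝ} (hx : 0 < x) (hx1 : x ≤ 1) {s : ℂ} (hs : 0 < s.re) (n : ℕ) :
    ‖taylorTerm x s n‖ ≤ ‖s‖ * ‖s + 1‖ * (n + x) ^ (-(s.re + 2)) := by
  set φ : ℝ → ℂ := fun y => ((n + y : ℝ) : ℂ) ^ (-s)
  set φ' : ℝ → ℂ := fun y => -s * ((n + y : ℝ) : ℂ) ^ (-s - 1)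
  set B : ℝ := ‖s‖ * ‖s + 1‖ * (n + x) ^ (-(s.re + 2))
  have hB : 0 ≤ B := by positivity
  have hφ' : ∀ y ∈ Set.Icc x 1, ‖φ' y - φ' 1‖ ≤ B := by
    intro y hy
    have h := Convex.norm_image_sub_le_of_norm_hasDerivWithin_le (f := φ')
      (f' := fun y => -s * (-(s + 1) * ((n + y : ℝ) : ℂ) ^ (-(s + 1) - 1)))
      (s := Set.Icc x 1) (C := B) (x := 1) (y := y) (fun z hz => ?_) (fun z hz => ?_)
      (convex_Icc x 1) ⟨hx1, le_rfl⟩ hy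
    · refine h.trans (mul_le_of_le_one_right hB ?_)
      rw [Real.norm_eq_abs, abs_le]; constructor <;> linarith [hy.1, hy.2]
    · have := (hasDerivAt_ofReal_cpow_neg (n := n) (hx.trans_le hz.1) (s + 1)).const_mul (-s)
      have e : -(s + 1) = -s - 1 := by ring
      rw [e] at this ⊢
      exact this.hasDerivWithinAt
    · rw [norm_mul, norm_mul, norm_neg, norm_neg, ← mul_assoc]
      refine mul_le_mul_of_nonneg_left ?_ (by positivity)
      exact norm_ofReal_cpow_le hx hz.1 _ (by linarith) (by simp; ring)
  have h := Convex.norm_image_sub_le_of_norm_hasDerivWithin_le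
      (f := fun y : ℝ => φ y - φ' 1 * y)
      (f' := fun y => φ' y - φ' 1)
      (s := Set.Icc x 1) (C := B) (x := 1) (y := x) (fun z hz => ?_) hφ'
      (convex_Icc x 1) ⟨hx1, le_rfl⟩ ⟨le_rfl, hx1⟩
  · refine le_trans (le_of_eq ?_) (h.trans (mul_le_of_le_one_right hB ?_))
    · congr 1
      simp only [taylorTerm, φ, φ', cpow_neg, one_div]
      have e : -s - 1 = -(s + 1) := by ring
      rw [e, cpow_neg]
      push_cast
      ring
    · rw [Real.norm_eq_abs, abs_le]; constructor <;> linarith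
  · have h1 := (hasDerivAt_ofReal_cpow_neg (n := n) (hx.trans_le hz.1) s)
    have h2 : HasDerivAt (fun y : ℝ => φ' 1 * (y : ℂ)) (φ' 1) z := by
      simpa using (hasDerivAt_id z).ofReal_comp.const_mul (φ' 1)
    exact (h1.sub h2).hasDerivWithinAt

/-- Trading the exponent Re s for a constant x^(-R) leaves the summable exponent -2, so the bound is
locally uniform in s on Re s > 0. -/
theorem norm_taylorTerm_le' {x R : ℝ} (hx : 0 < x) (hx1 : x ≤ 1) {s : ℂ} (hs : 0 < s.re)
    (hR : s.re ≤ R) (n : ℕ) :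
    ‖taylorTerm x s n‖ ≤ ‖s‖ * ‖s + 1‖ * (x ^ (-R) * (n + x) ^ (-2 : ℝ)) := by
  refine (norm_taylorTerm_le hx hx1 hs n).trans (mul_le_mul_of_nonneg_left ?_ (by positivity))
  rw [neg_add, Real.rpow_add (by positivity)]
  refine mul_le_mul_of_nonneg_right ?_ (by positivity)
  calc ((n : ℝ) + x) ^ (-s.re) ≤ x ^ (-s.re) :=
        Real.rpow_le_rpow_of_nonpos hx (by linarith [n.cast_nonneg (α := ℝ)]) (by linarith)
    _ ≤ x ^ (-R) := Real.rpow_le_rpow_of_exponent_ge hx hx1 (by linarith)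

theorem summable_add_rpow_neg_two {x : ℝ} (hx : 0 < x) :
    Summable fun n : ℕ => ((n : ℝ) + x) ^ (-2 : ℝ) := by
  have h : Summable fun n : ℕ => (1 : ℝ) / |(n : ℝ) + x| ^ (2 : ℝ) :=
    (Real.summable_one_div_nat_add_rpow x 2).2 (by norm_num)
  refine h.congr fun n => ?_
  rw [abs_of_pos (by positivity), Real.rpow_neg (by positivity), one_div]

theorem differentiableAt_tsum_taylorTerm {x : ℝ} (hx : 0 < x) (hx1 : x ≤ 1) {s : ℂ}
    (hs : 0 < s.re) : DifferentiableAt ℂ (fun s => ∑' n, taylorTerm x s n) s := by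
  set R := ‖s‖ + 1
  set U : Set ℂ := {z | 0 < z.re} ∩ Metric.ball 0 R
  have hU : IsOpen U := (isOpen_lt continuous_const continuous_re).inter Metric.isOpen_ball
  have hsU : s ∈ U := ⟨hs, by simp [R]⟩
  refine (DifferentiableOn.differentiableAt (s := U) ?_ (hU.mem_nhds hsU))
  refine differentiableOn_tsum_of_summable_norm
    (u := fun n : ℕ => R * (R + 1) * (x ^ (-R) * ((n : ℝ) + x) ^ (-2 : ℝ)))
    (((summable_add_rpow_neg_two hx).mul_left _).mul_left _) (fun n => ?_) hU (fun n z hz => ?_)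
  · intro z hz
    have h1 : (n + x : ℂ) ≠ 0 := by
      exact_mod_cast (by positivity : (n : ℝ) + x ≠ 0)
    have h2 : (n + 1 : ℂ) ≠ 0 := by exact_mod_cast n.succ_ne_zero
    unfold taylorTerm
    simp only [one_div, ← cpow_neg]
    refine DifferentiableAt.differentiableWithinAt ?_
    refine ((differentiableAt_id.neg.const_cpow (.inl h1)).sub
      (differentiableAt_id.neg.const_cpow (.inl h2))).sub
      ((differentiableAt_id.mul_const _).mul
        ((differentiableAt_id.add_const _).neg.const_cpow (.inl h2)))
  · have hz2 : ‖z‖ < R := by simpa using hz.2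
    refine (norm_taylorTerm_le' hx hx1 hz.1 ((re_le_norm z).trans hz2.le) n).trans ?_
    refine mul_le_mul_of_nonneg_right ?_ (by positivity)
    have : ‖z + 1‖ ≤ R + 1 := (norm_add_le _ _).trans (by simpa using hz2.le)
    gcongr

theorem tendsto_tsum_taylorTerm {x : ℝ} (hx : 0 < x) (hx1 : x ≤ 1) :
    Tendsto (fun t : ℝ => ∑' n, taylorTerm x t n) (𝓝[>] 0) (𝓝 0) := by
  set C : ℝ := ∑' n : ℕ, x ^ (-1 : ℝ) * ((n : ℝ) + x) ^ (-2 : ℝ)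
  have hlim : Tendsto (fun t : ℝ => t * (t + 1) * C) (𝓝[>] 0) (𝓝 0) := by
    have : Tendsto (fun t : ℝ => t * (t + 1) * C) (𝓝 0) (𝓝 (0 * (0 + 1) * C)) :=
      Continuous.tendsto (by fun_prop) 0
    simp only [zero_mul] at this
    exact this.mono_left nhdsWithin_le_nhds
  refine squeeze_zero_norm' ?_ hlim
  have h1 : ∀ᶠ t : ℝ in 𝓝[>] 0, t ∈ Set.Ioc (0 : ℝ) 1 := Ioc_mem_nhdsGT one_pos
  filter_upwards [h1] with t ht
  have hb : ∀ n, ‖taylorTerm x t n‖ ≤ t * (t + 1) * (x ^ (-1 : ℝ) * ((n : ℝ) + x) ^ (-2 : ℝ)) := by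
    intro n
    have := norm_taylorTerm_le' (R := 1) hx hx1 (s := t) (by simpa using ht.1) (by simpa using ht.2) n
    have e1 : ‖(t : ℂ)‖ = t := by simp [abs_of_pos ht.1]
    have e2 : ‖(t : ℂ) + 1‖ = t + 1 := by
      rw [show (t : ℂ) + 1 = ((t + 1 : ℝ) : ℂ) by push_cast; rfl, norm_real, Real.norm_eq_abs,
        abs_of_pos (by linarith [ht.1])]
    rwa [e1, e2] at this
  have hs := ((summable_add_rpow_neg_two hx).mul_left (x ^ (-1 : ℝ))).mul_left (t * (t + 1))
  exact (tsum_of_norm_bounded hs.hasSum hb).trans (le_of_eq (by rw [tsum_mul_left]))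

theorem hurwitzZeta_sub_eq_tsum_of_one_lt_re {x : ℝ} (hx : 0 < x) (hx1 : x ≤ 1) {s : ℂ}
    (hs : 1 < s.re) :
    hurwitzZeta x s - riemannZeta s - s * (1 - x) * riemannZeta (s + 1) =
      ∑' n, taylorTerm x s n := by
  have h1 := hasSum_hurwitzZeta_of_one_lt_re (a := x) ⟨hx.le, hx1⟩ hs
  have e : ((1 : ℝ) : UnitAddCircle) = 0 := AddCircle.coe_period 1
  have h2 := hasSum_hurwitzZeta_of_one_lt_re (a := 1) ⟨zero_le_one, le_rfl⟩ hs
  have h3 := hasSum_hurwitzZeta_of_one_lt_re (a := 1) ⟨zero_le_one, le_rfl⟩ (s := s + 1)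
    (by simp; linarith)
  rw [e, hurwitzZeta_zero] at h2 h3
  have := ((h1.sub h2).sub (h3.mul_left (s * (1 - x)))).tsum_eq
  rw [← this]
  simp [taylorTerm]

/-- Both sides are holomorphic on Re s > 0, the poles at 1 of the two Hurwitz functions cancelling,
and they agree near s = 2. The identity theorem extends the equality to a region having 0 on its
boundary. -/
theorem hurwitzZeta_sub_eq_tsum {x : ℝ} (hx : 0 < x) (hx1 : x ≤ 1) {s : ℂ}
    (hs : 0 < s.re) :
    hurwitzZeta x s - hurwitzZeta 0 s - s * (1 - x) * riemannZeta (s + 1) =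
      ∑' n, taylorTerm x s n := by
  have hU : IsOpen {z : ℂ | 0 < z.re} := isOpen_lt continuous_const continuous_re
  have hne : ∀ z ∈ {z : ℂ | 0 < z.re}, z + 1 ≠ 1 := by
    intro z hz h
    have : z = 0 := by simpa using h
    simp [this] at hz
  have hf : DifferentiableOn ℂ (fun s => (hurwitzZeta x s - hurwitzZeta 0 s) -
      s * (1 - x) * riemannZeta (s + 1)) {z : ℂ | 0 < z.re} := by
    intro z hz
    refine DifferentiableAt.differentiableWithinAt ?_
    refine DifferentiableAt.sub ?_ ((differentiableAt_id.mul_const _).mul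
      ((differentiableAt_riemannZeta (hne z hz)).comp z (differentiableAt_id.add_const 1)))
    exact (differentiable_hurwitzZeta_sub_hurwitzZeta (x : UnitAddCircle) 0) z
  have hg : DifferentiableOn ℂ (fun s => ∑' n, taylorTerm x s n) {z : ℂ | 0 < z.re} :=
    fun z hz => (differentiableAt_tsum_taylorTerm hx hx1 hz).differentiableWithinAt
  have h2 : (2 : ℂ) ∈ {z : ℂ | 0 < z.re} := by simp
  refine (hf.analyticOnNhd hU).eqOn_of_preconnected_of_eventuallyEq (hg.analyticOnNhd hU)
    (convex_halfSpace_re_gt 0).isPreconnected h2 ?_ hs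
  filter_upwards [(isOpen_lt continuous_const continuous_re).mem_nhds
    (show (2 : ℂ) ∈ {z : ℂ | 1 < z.re} by simp)] with z hz
  rw [hurwitzZeta_zero]
  exact hurwitzZeta_sub_eq_tsum_of_one_lt_re hx hx1 hz

/-- The value at `0` of the Hurwitz zeta function. -/
theorem hurwitzZeta_apply_zero {x : ℝ} (hx : 0 < x) (hx1 : x ≤ 1) :
    hurwitzZeta x 0 = 1 / 2 - x := by
  have ht : Tendsto (fun t : ℝ => (t : ℂ)) (𝓝[>] 0) (𝓝 0) := by
    have := (continuous_ofReal.tendsto 0)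
    simp only [ofReal_zero] at this
    exact this.mono_left nhdsWithin_le_nhds
  have h1 : Tendsto (fun t : ℝ => hurwitzZeta x t - hurwitzZeta 0 t) (𝓝[>] 0)
      (𝓝 (hurwitzZeta x 0 - hurwitzZeta 0 0)) :=
    ((differentiable_hurwitzZeta_sub_hurwitzZeta (x : UnitAddCircle) 0).continuous.tendsto 0).comp ht
  have h2 : Tendsto (fun t : ℝ => (t : ℂ) * riemannZeta (t + 1)) (𝓝[>] 0) (𝓝 1) := by
    have h3 : Tendsto (fun t : ℝ => (t : ℂ) + 1) (𝓝[>] 0) (𝓝[≠] 1) := by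
      refine tendsto_nhdsWithin_iff.2 ⟨by simpa using ht.add_const 1, ?_⟩
      filter_upwards [self_mem_nhdsWithin] with t h0
      have : t ≠ 0 := ne_of_gt h0
      simpa using this
    refine (riemannZeta_residue_one.comp h3).congr fun t => ?_
    simp
  -- Since tζ(t+1) → 1, the limit t → 0+ of the continued identity reads ζ(0,x) - ζ(0) - (1 - x) =
  -- 0.
  have h4 : Tendsto (fun t : ℝ => ∑' n, taylorTerm x t n) (𝓝[>] 0)
      (𝓝 (hurwitzZeta x 0 - hurwitzZeta 0 0 - (1 - x) * 1)) := by
    refine (h1.sub (h2.const_mul ((1 : ℂ) - x))).congr' ?_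
    filter_upwards [self_mem_nhdsWithin] with t h0
    rw [← hurwitzZeta_sub_eq_tsum hx hx1 (s := t) (by simpa using h0)]
    ring
  have h5 := tendsto_nhds_unique h4 (tendsto_tsum_taylorTerm hx hx1)
  rw [hurwitzZeta_zero, riemannZeta_zero] at h5
  linear_combination h5

end HurwitzZeta

/-- Values of Dirichlet `L`-functions at nonpositive integers. -/
theorem DirichletCharacter.LFunction_one_sub_natCast {N : ℕ} [NeZero N]
    (η : DirichletCharacter ℂ N) {n : ℕ} (hn : 1 ≤ n) (h : N ≠ 1 ∨ n ≠ 1) :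
    η.LFunction (1 - n) = -((N : ℂ) ^ (n - 1) / n) *
      ∑ j : ZMod N, η j * (((Polynomial.bernoulli n).eval ((j.val : ℚ) / N) : ℚ) : ℂ) := by
  obtain ⟨k, rfl⟩ := Nat.exists_eq_add_of_le' hn
  have hN : (N : ℝ) ≠ 0 := by exact_mod_cast NeZero.ne N
  have e1 : (1 : ℂ) - ((k + 1 : ℕ) : ℂ) = -(k : ℂ) := by push_cast; ring
  have key : ∀ j : ZMod N, η j * HurwitzZeta.hurwitzZeta (ZMod.toAddCircle j) (-(k : ℂ)) =
      η j * (-1 / (k + 1) *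
        (((Polynomial.bernoulli (k + 1)).eval ((j.val : ℚ) / N) : ℚ) : ℂ)) := by
    intro j
    rw [ZMod.toAddCircle_apply]
    have hx : ((j.val : ℝ) / N) ∈ Set.Icc (0 : ℝ) 1 :=
      ⟨by positivity, div_le_one_of_le₀ (by exact_mod_cast (ZMod.val_lt j).le) (by positivity)⟩
    have e2 : (((Polynomial.bernoulli (k + 1)).map (algebraMap ℚ ℂ)).eval
        (((j.val : ℝ) / N : ℝ) : ℂ)) =
        (((Polynomial.bernoulli (k + 1)).eval ((j.val : ℚ) / N) : ℚ) : ℂ) := by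
      have : (((j.val : ℝ) / N : ℝ) : ℂ) = algebraMap ℚ ℂ ((j.val : ℚ) / N) := by
        push_cast; simp
      rw [this, Polynomial.eval_map_algebraMap, Polynomial.aeval_algebraMap_apply]
      simp
    -- For k = 0 the formula for ζ(0,x) requires x > 0. The class j = 0 has to be discarded, which
    -- is possible because N ≠ 1 then forces η(0) = 0.
    rcases Nat.eq_zero_or_pos k with rfl | hk
    · rcases eq_or_ne j 0 with rfl | hj
      · have : Nontrivial (ZMod N) := ZMod.nontrivial_iff.2 (by simpa using h)
        rw [MulChar.map_zero, zero_mul, zero_mul]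
      · have hpos : 0 < (j.val : ℝ) / N := by
          have : 0 < j.val := Nat.pos_of_ne_zero (by simpa [ZMod.val_eq_zero] using hj)
          have : 0 < N := Nat.pos_of_ne_zero (NeZero.ne N)
          positivity
        congr 1
        have := HurwitzZeta.hurwitzZeta_apply_zero hpos hx.2
        simp only [Nat.cast_zero, neg_zero, zero_add]
        rw [this, Polynomial.bernoulli_one]
        simp [-ZMod.natCast_val]
    · rw [HurwitzZeta.hurwitzZeta_neg_nat hk.ne' hx, e2]
  rw [DirichletCharacter.LFunction, ZMod.LFunction, e1, Finset.sum_congr rfl fun j _ => key j]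
  simp only [neg_neg, Complex.cpow_natCast, Finset.mul_sum, Nat.add_sub_cancel]
  refine Finset.sum_congr rfl fun j _ => ?_
  push_cast
  ring

/-! ### The group 1 + q ℤ_p: p-adic powers, logarithms, and the decomposition a = ω(a)⟨a⟩. -/

noncomputable section

namespace PadicLimit

variable {p : ℕ} [hp : Fact p.Prime]

theorem norm_conductorQ (p : ℕ) [Fact p.Prime] :
    ‖(conductorQ p : ℤ_[p])‖ = ((conductorQ p : ℕ) : ℝ)⁻¹ := by
  simp [conductorQ, PadicInt.norm_p]

theorem three_le_conductorQ (p : ℕ) [hp : Fact p.Prime] : 3 ≤ conductorQ p := by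
  have := hp.out.two_le
  by_cases h : p = 2
  · simp [conductorQ, delta, h]
  · simp only [conductorQ, delta, h, if_false]
    rw [add_zero, pow_one]; omega

theorem dvd_conductorQ (p : ℕ) : p ∣ conductorQ p := dvd_pow_self _ (by omega)

theorem norm_conductorQ_lt_one (p : ℕ) [Fact p.Prime] : ‖(conductorQ p : ℤ_[p])‖ < 1 := by
  rw [norm_conductorQ]
  have : (3 : ℝ) ≤ conductorQ p := by exact_mod_cast three_le_conductorQ p
  exact inv_lt_one_of_one_lt₀ (by linarith)

theorem tendsto_conductorQ_pow (p : ℕ) [Fact p.Prime] :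
    Tendsto (fun n => (conductorQ p : ℤ_[p]) ^ n) atTop (𝓝 0) :=
  tendsto_pow_atTop_nhds_zero_of_norm_lt_one (norm_conductorQ_lt_one p)

/-- The character `s ↦ (1 + q)^s` of `ℤ_p`. -/
def qPow (p : ℕ) [Fact p.Prime] : AddChar ℤ_[p] ℤ_[p] :=
  PadicInt.addChar_of_value_at_one (conductorQ p : ℤ_[p]) (tendsto_conductorQ_pow p)

theorem continuous_qPow (p : ℕ) [Fact p.Prime] : Continuous (qPow p) :=
  PadicInt.continuous_addChar_of_value_at_one _

theorem qPow_natCast (n : ℕ) : qPow p (n : ℤ_[p]) = (1 + (conductorQ p : ℤ_[p])) ^ n := by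
  have : qPow p (1 : ℤ_[p]) = 1 + (conductorQ p : ℤ_[p]) :=
    PadicInt.addChar_of_value_at_one_def (tendsto_conductorQ_pow p)
  rw [← this, ← AddChar.map_nsmul_eq_pow, nsmul_one]

theorem qPow_nsmul (n : ℕ) (s : ℤ_[p]) : qPow p (n * s) = qPow p s ^ n := by
  rw [← AddChar.map_nsmul_eq_pow, nsmul_eq_mul]

theorem inv_natCast_le_norm {n : ℕ} (hn : n ≠ 0) : (n : ℝ)⁻¹ ≤ ‖(n : ℤ_[p])‖ := by
  have e : ‖(n : ℤ_[p])‖ = ((p : ℝ) ^ padicValNat p n)⁻¹ := by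
    rw [PadicInt.norm_def, PadicInt.coe_natCast,
      Padic.norm_eq_zpow_neg_valuation (by exact_mod_cast hn), Padic.valuation_natCast, zpow_neg,
      zpow_natCast]
  rw [e]
  have h : p ^ padicValNat p n ≤ n := Nat.le_of_dvd (Nat.pos_of_ne_zero hn) pow_padicValNat_dvd
  have h0 : 0 < p ^ padicValNat p n := pow_pos hp.out.pos _
  have h' : ((p : ℝ) ^ padicValNat p n) ≤ n := by exact_mod_cast h
  exact inv_anti₀ (by exact_mod_cast h0) h'

theorem succ_le_conductorQ_pow (p : ℕ) [Fact p.Prime] (j : ℕ) : j + 1 ≤ conductorQ p ^ j := by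
  have h3 := three_le_conductorQ p
  induction j with
  | zero => simp
  | succ j ih =>
    rw [pow_succ]
    nlinarith

theorem succ_lt_conductorQ_pow (p : ℕ) [Fact p.Prime] {j : ℕ} (hj : 1 ≤ j) :
    j + 1 < conductorQ p ^ j := by
  obtain ⟨k, rfl⟩ := Nat.exists_eq_add_of_le' hj
  have h3 := three_le_conductorQ p
  have := succ_le_conductorQ_pow p k
  rw [pow_succ]
  nlinarith

theorem padicInt_dvd_iff_norm_le {x y : ℤ_[p]} : x ∣ y ↔ ‖y‖ ≤ ‖x‖ := by
  constructor
  · rintro ⟨z, rfl⟩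
    rw [norm_mul]
    exact mul_le_of_le_one_right (norm_nonneg _) (PadicInt.norm_le_one _)
  · intro h
    rcases eq_or_ne x 0 with rfl | hx
    · rw [norm_zero, norm_le_zero_iff] at h
      rw [h]
    · have h1 : ‖(y : ℚ_[p]) / x‖ ≤ 1 := by
        rw [norm_div]
        exact div_le_one_of_le₀ h (norm_nonneg _)
      obtain ⟨z, hz⟩ : ∃ z : ℤ_[p], (z : ℚ_[p]) = y / x := ⟨⟨_, h1⟩, rfl⟩
      refine ⟨z, PadicInt.ext ?_⟩
      rw [PadicInt.coe_mul, hz, mul_div_cancel₀]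
      exact PadicInt.coe_ne_zero.2 hx

/-- Because |q^j| = q^(-j) ≤ 1/(j+1) ≤ |j+1|, the quotient q^j/(j+1) is a p-adic integer. -/
theorem exists_succ_mul_eq (p : ℕ) [Fact p.Prime] (j : ℕ) :
    ∃ c : ℤ_[p], ((j + 1 : ℕ) : ℤ_[p]) * c = (conductorQ p : ℤ_[p]) ^ j := by
  have h : ‖(conductorQ p : ℤ_[p]) ^ j‖ ≤ ‖((j + 1 : ℕ) : ℤ_[p])‖ := by
    refine le_trans ?_ (inv_natCast_le_norm j.succ_ne_zero)
    rw [norm_pow, norm_conductorQ, inv_pow]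
    exact inv_anti₀ (by positivity) (by exact_mod_cast succ_le_conductorQ_pow p j)
  obtain ⟨c, hc⟩ := padicInt_dvd_iff_norm_le.2 h
  exact ⟨c, hc.symm⟩

/-- The Mahler coefficients `q^j / (j + 1)` of `((1 + q)^(s + 1) - 1) / ((s + 1) q)`. -/
def logCoeff (p : ℕ) [Fact p.Prime] (j : ℕ) : ℤ_[p] := (exists_succ_mul_eq p j).choose

theorem succ_mul_logCoeff (j : ℕ) :
    ((j + 1 : ℕ) : ℤ_[p]) * logCoeff p j = (conductorQ p : ℤ_[p]) ^ j :=
  (exists_succ_mul_eq p j).choose_spec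

theorem norm_logCoeff_le (j : ℕ) :
    ‖logCoeff p j‖ ≤ (j + 1 : ℝ) * ((conductorQ p : ℝ)⁻¹) ^ j := by
  have h := congrArg norm (succ_mul_logCoeff (p := p) j)
  rw [norm_mul, norm_pow, norm_conductorQ] at h
  have h1 := inv_natCast_le_norm (p := p) j.succ_ne_zero
  have hj : (0 : ℝ) < (j.succ : ℝ) := by positivity
  rw [← h]
  have h2 : 1 ≤ (j + 1 : ℝ) * ‖((j + 1 : ℕ) : ℤ_[p])‖ := by
    rw [inv_le_iff_one_le_mul₀ hj] at h1
    rw [mul_comm]; exact_mod_cast h1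
  rw [← mul_assoc]
  exact le_mul_of_one_le_left (norm_nonneg _) h2

theorem logCoeff_zero : logCoeff p 0 = 1 := by
  simpa using succ_mul_logCoeff (p := p) 0

/-- The strict inequality j + 1 < q^j uses q ≥ 3; it would fail at j = 1 for q = 2, which is why q =
4 when p = 2. -/
theorem norm_logCoeff_lt_one {j : ℕ} (hj : 1 ≤ j) : ‖logCoeff p j‖ < 1 := by
  refine (norm_logCoeff_le j).trans_lt ?_
  have h3 := three_le_conductorQ p
  have h : (0 : ℝ) < (conductorQ p : ℝ) ^ j := by
    have : 0 < conductorQ p ^ j := pow_pos (by omega) _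
    exact_mod_cast this
  rw [inv_pow, ← div_eq_mul_inv, div_lt_one h]
  exact_mod_cast succ_lt_conductorQ_pow p hj

theorem tendsto_logCoeff (p : ℕ) [Fact p.Prime] : Tendsto (logCoeff p) atTop (𝓝 0) := by
  have h3 := three_le_conductorQ p
  have hr : (conductorQ p : ℝ)⁻¹ < 1 := inv_lt_one_of_one_lt₀ (by exact_mod_cast (by omega))
  have hr0 : 0 ≤ (conductorQ p : ℝ)⁻¹ := by positivity
  have h1 := tendsto_self_mul_const_pow_of_lt_one hr0 hr
  have h2 := tendsto_pow_atTop_nhds_zero_of_lt_one hr0 hr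
  have h := h1.add h2
  simp only [add_zero] at h
  refine squeeze_zero_norm (fun j => ?_) h
  refine (norm_logCoeff_le j).trans (le_of_eq (by ring))

/-- The function `s ↦ ((1 + q)^s - 1) / (s q)` on `ℤ_p`. -/
def qPowSlope (p : ℕ) [Fact p.Prime] (s : ℤ_[p]) : ℤ_[p] :=
  PadicInt.mahlerSeries (logCoeff p) (s - 1)

theorem continuous_qPowSlope (p : ℕ) [Fact p.Prime] : Continuous (qPowSlope p) :=
  (map_continuous (PadicInt.mahlerSeries (logCoeff p))).comp (by fun_prop)

theorem qPowSlope_natCast_add_one (k : ℕ) :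
    qPowSlope p ((k : ℤ_[p]) + 1) = ∑ j ∈ Finset.range (k + 1), (k.choose j : ℤ_[p]) * logCoeff p j := by
  rw [qPowSlope, add_sub_cancel_right,
    PadicInt.mahlerSeries_apply_nat (tendsto_logCoeff p) le_rfl]
  simp [nsmul_eq_mul]

/-- At positive integers this is the binomial theorem combined with (k+1)·C(k,j) = (j+1)·C(k+1,j+1).
Both sides are continuous, and the natural numbers are dense. -/
theorem qPow_sub_one (s : ℤ_[p]) : qPow p s - 1 = s * (conductorQ p * qPowSlope p s) := by
  have key : (fun s : ℤ_[p] => qPow p (s + 1) - 1) =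
      fun s => (s + 1) * (conductorQ p * qPowSlope p (s + 1)) := by
    refine PadicInt.denseRange_natCast.equalizer (by have := continuous_qPow p; fun_prop)
      (by have := continuous_qPowSlope p; fun_prop) (funext fun k => ?_)
    simp only [Function.comp_apply]
    rw [qPowSlope_natCast_add_one]
    have e : ((k : ℤ_[p]) + 1) = ((k + 1 : ℕ) : ℤ_[p]) := by push_cast; rfl
    rw [e, qPow_natCast, add_comm, add_pow, Finset.sum_range_succ', Finset.mul_sum, Finset.mul_sum]
    simp only [one_pow, mul_one, pow_zero, Nat.choose_zero_right, Nat.cast_one, add_sub_cancel_right]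
    refine Finset.sum_congr rfl fun j _ => ?_
    have h1 : ((k + 1 : ℕ) : ℤ_[p]) * (k.choose j : ℤ_[p]) =
        ((k + 1).choose (j + 1) : ℤ_[p]) * ((j + 1 : ℕ) : ℤ_[p]) := by
      exact_mod_cast Nat.add_one_mul_choose_eq k j
    linear_combination (-((conductorQ p : ℤ_[p]) * logCoeff p j)) * h1 -
      ((k + 1).choose (j + 1) : ℤ_[p]) * (conductorQ p : ℤ_[p]) * succ_mul_logCoeff (p := p) j
  have := congrFun key (s - 1)
  simpa using this

/-- Only the term j = 0 of the Mahler series survives modulo the maximal ideal. An open ball is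
closed in the ultrametric setting, so the check at natural numbers suffices. -/
theorem norm_qPowSlope_sub_one_lt (s : ℤ_[p]) : ‖qPowSlope p s - 1‖ < 1 := by
  have hcl : IsClosed {s : ℤ_[p] | ‖qPowSlope p (s + 1) - 1‖ < 1} := by
    have e : {s : ℤ_[p] | ‖qPowSlope p (s + 1) - 1‖ < 1} =
        (fun s => qPowSlope p (s + 1) - 1) ⁻¹' Metric.ball 0 1 := by ext; simp
    rw [e]
    exact (IsUltrametricDist.isClosed_ball 0 1).preimage
      (by have := continuous_qPowSlope p; fun_prop)
  have hd := PadicInt.denseRange_natCast (p := p)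
  have : ∀ s : ℤ_[p], ‖qPowSlope p (s + 1) - 1‖ < 1 := by
    refine fun s => hd.induction_on s hcl fun k => ?_
    rw [qPowSlope_natCast_add_one, Finset.sum_range_succ']
    simp only [Nat.choose_zero_right, Nat.cast_one, logCoeff_zero, mul_one, add_sub_cancel_right]
    refine Finset.sum_induction _ (fun x : ℤ_[p] => ‖x‖ < 1)
      (fun _ _ => PadicInt.norm_lt_one_add) (by simp) fun j _ => ?_
    rw [norm_mul]
    exact (mul_le_of_le_one_left (norm_nonneg _) (PadicInt.norm_le_one _)).trans_lt
      (norm_logCoeff_lt_one (by omega))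
  simpa using this (s - 1)

theorem norm_qPowSlope (s : ℤ_[p]) : ‖qPowSlope p s‖ = 1 := by
  have h := norm_qPowSlope_sub_one_lt s
  have := IsUltrametricDist.norm_add_eq_max_of_norm_ne_norm (x := qPowSlope p s - 1) (y := 1)
    (by rw [norm_one]; exact h.ne)
  simpa [h.le] using this

theorem norm_qPow (s : ℤ_[p]) : ‖qPow p s‖ = 1 := by
  have h : qPow p s * qPow p (-s) = 1 := by
    rw [← AddChar.map_add_eq_mul, add_neg_cancel, AddChar.map_zero_eq_one]
  exact PadicInt.isUnit_iff.1 (IsUnit.of_mul_eq_one _ h)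

/-- The slope function has unit values, so s ↦ (1+q)^s is an isometry up to the scale |q|. All
comparisons between ⟨a⟩ and its logarithm rest on this. -/
theorem norm_qPow_sub (s t : ℤ_[p]) :
    ‖qPow p s - qPow p t‖ = ‖(conductorQ p : ℤ_[p])‖ * ‖s - t‖ := by
  have h : qPow p s - qPow p t = qPow p t * (qPow p (s - t) - 1) := by
    rw [mul_sub, ← AddChar.map_add_eq_mul, add_sub_cancel, mul_one]
  rw [h, norm_mul, norm_qPow, qPow_sub_one, norm_mul, norm_mul, norm_qPowSlope]
  ring

theorem norm_conductorQ_ne_zero (p : ℕ) [Fact p.Prime] : ‖(conductorQ p : ℤ_[p])‖ ≠ 0 := by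
  rw [norm_ne_zero_iff]
  exact_mod_cast NeZero.ne (conductorQ p)

theorem qPow_injective (p : ℕ) [Fact p.Prime] : Function.Injective (qPow p) := by
  intro s t h
  have := norm_qPow_sub s t
  rw [h, sub_self, norm_zero, zero_eq_mul] at this
  rcases this with h | h
  · exact absurd h (norm_conductorQ_ne_zero p)
  · exact sub_eq_zero.1 (norm_eq_zero.1 h)

theorem toZModPow_eq_iff {n : ℕ} (x y : ℤ_[p]) :
    PadicInt.toZModPow n x = PadicInt.toZModPow n y ↔ ‖x - y‖ ≤ (p : ℝ) ^ (-n : ℤ) := by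
  rw [PadicInt.norm_le_pow_iff_mem_span_pow, ← PadicInt.ker_toZModPow, RingHom.mem_ker, map_sub,
    sub_eq_zero]

/-- An isometry of `ℤ_p` into itself is surjective. -/
theorem surjective_of_norm_sub_eq {g : ℤ_[p] → ℤ_[p]} (hg : ∀ s t, ‖g s - g t‖ = ‖s - t‖) :
    Function.Surjective g := by
  intro y
  have hcont : Continuous g := by
    have : Isometry g := Isometry.of_dist_eq fun s t => by rw [dist_eq_norm, dist_eq_norm, hg]
    exact this.continuous
  have hcl : IsClosed (Set.range g) := (isCompact_range hcont).isClosed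
  suffices h : y ∈ closure (Set.range g) by rwa [hcl.closure_eq] at h
  rw [Metric.mem_closure_iff]
  intro ε hε
  obtain ⟨n, hn⟩ := PadicInt.exists_pow_neg_lt p hε
  have : NeZero (p ^ n) := ⟨pow_ne_zero _ hp.out.ne_zero⟩
  -- An isometry is injective modulo p^n, hence surjective on the finite set ℤ/p^n. The image is
  -- therefore dense, and it is closed by compactness.
  have hsurj : Function.Surjective
      fun x : ZMod (p ^ n) => PadicInt.toZModPow n (g (x.val : ℤ_[p])) := by
    refine Finite.surjective_of_injective fun x x' hx => ?_
    have h1 := (toZModPow_eq_iff _ _).1 hx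
    rw [hg] at h1
    have h2 := (toZModPow_eq_iff _ _).2 h1
    simpa using h2
  obtain ⟨x, hx⟩ := hsurj (PadicInt.toZModPow n y)
  refine ⟨_, ⟨(x.val : ℤ_[p]), rfl⟩, ?_⟩
  rw [dist_comm, dist_eq_norm]
  exact ((toZModPow_eq_iff _ _).1 hx).trans_lt hn

/-- Every element of `1 + q ℤ_p` is of the form `(1 + q)^s`. -/
theorem exists_qPow_eq {x : ℤ_[p]} (hx : (conductorQ p : ℤ_[p]) ∣ x - 1) : ∃ s, qPow p s = x := by
  obtain ⟨y, hy⟩ := hx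
  have hq : (conductorQ p : ℤ_[p]) ≠ 0 := by exact_mod_cast NeZero.ne (conductorQ p)
  -- The map s ↦ ((1+q)^s - 1)/q is an isometry of ℤ_p, so it reaches y = (x - 1)/q.
  obtain ⟨s, hs⟩ := surjective_of_norm_sub_eq (p := p) (g := fun s => s * qPowSlope p s) (by
    intro s t
    have h := norm_qPow_sub s t
    have e : qPow p s - qPow p t =
        conductorQ p * (s * qPowSlope p s - t * qPowSlope p t) := by
      linear_combination qPow_sub_one s - qPow_sub_one t
    rw [e, norm_mul] at h
    exact mul_left_cancel₀ (norm_conductorQ_ne_zero p) h) y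
  refine ⟨s, ?_⟩
  have := qPow_sub_one s
  simp only at hs
  rw [← sub_left_inj (a := 1), this, hy, ← hs]
  ring

/-- The value at a natural number of the Teichmüller character. -/
def teich (p : ℕ) [Fact p.Prime] (a : ℕ) : ℤ_[p] := teichmullerChar p (a : ZMod (conductorQ p))

theorem dvd_teich_sub {a : ℕ} (ha : ¬ p ∣ a) : (conductorQ p : ℤ_[p]) ∣ teich p a - a :=
  (exists_teichmuller p).choose_spec a ha

theorem coprime_conductorQ {a : ℕ} (ha : ¬ p ∣ a) : a.Coprime (conductorQ p) :=
  Nat.Coprime.pow_right _ ((Nat.Prime.coprime_iff_not_dvd hp.out).2 ha).symm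

theorem isUnit_natCast_conductorQ {a : ℕ} (ha : ¬ p ∣ a) : IsUnit (a : ZMod (conductorQ p)) :=
  (ZMod.isUnit_iff_coprime _ _).2 (coprime_conductorQ ha)

theorem isUnit_teich {a : ℕ} (ha : ¬ p ∣ a) : IsUnit (teich p a) :=
  (isUnit_natCast_conductorQ ha).map (teichmullerChar p)

/-- The component `⟨a⟩ = a / ω(a)` in `1 + q ℤ_p` of an integer `a`. -/
def angle (p : ℕ) [Fact p.Prime] (a : ℕ) : ℤ_[p] :=
  (teichmullerChar p)⁻¹ (a : ZMod (conductorQ p)) * a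

theorem teich_mul_angle {a : ℕ} (ha : ¬ p ∣ a) : teich p a * angle p a = a := by
  have h : teichmullerChar p (a : ZMod (conductorQ p)) *
      (teichmullerChar p)⁻¹ (a : ZMod (conductorQ p)) = 1 := by
    rw [← MulChar.mul_apply, mul_inv_cancel, MulChar.one_apply (isUnit_natCast_conductorQ ha)]
  rw [teich, angle, ← mul_assoc, h, one_mul]

theorem angle_mul (a b : ℕ) : angle p (a * b) = angle p a * angle p b := by
  simp only [angle, Nat.cast_mul, map_mul]; ring

theorem dvd_angle_sub_one {a : ℕ} (ha : ¬ p ∣ a) : (conductorQ p : ℤ_[p]) ∣ angle p a - 1 := by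
  have h := dvd_teich_sub ha
  have e : teich p a - a = teich p a * (1 - angle p a) := by
    rw [mul_sub, teich_mul_angle ha, mul_one]
  rw [e] at h
  have := ((isUnit_teich ha).dvd_mul_left).1 h
  rwa [← neg_sub, dvd_neg] at this

theorem exists_qPow_eq_angle (p : ℕ) [Fact p.Prime] (a : ℕ) :
    ∃ s : ℤ_[p], ¬ p ∣ a → qPow p s = angle p a := by
  by_cases ha : p ∣ a
  · exact ⟨0, fun h => absurd ha h⟩
  · exact (exists_qPow_eq (dvd_angle_sub_one ha)).imp fun s hs _ => hs

/-- The logarithm of `⟨a⟩` to the base `1 + q`, for `a` prime to `p`. -/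
def angleLog (p : ℕ) [Fact p.Prime] (a : ℕ) : ℤ_[p] := (exists_qPow_eq_angle p a).choose

theorem qPow_angleLog {a : ℕ} (ha : ¬ p ∣ a) : qPow p (angleLog p a) = angle p a :=
  (exists_qPow_eq_angle p a).choose_spec ha

theorem angleLog_mul {a b : ℕ} (ha : ¬ p ∣ a) (hb : ¬ p ∣ b) :
    angleLog p (a * b) = angleLog p a + angleLog p b := by
  have hab : ¬ p ∣ a * b := fun h => (hp.out.dvd_mul.1 h).elim ha hb
  apply qPow_injective p
  rw [AddChar.map_add_eq_mul, qPow_angleLog ha, qPow_angleLog hb, qPow_angleLog hab, angle_mul]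

/-- A root of unity in `1 + q ℤ_p` is trivial. -/
theorem eq_one_of_pow_eq_one {x : ℤ_[p]} (hx : (conductorQ p : ℤ_[p]) ∣ x - 1) {r : ℕ}
    (hr : r ≠ 0) (h : x ^ r = 1) : x = 1 := by
  obtain ⟨s, rfl⟩ := exists_qPow_eq hx
  rw [← qPow_nsmul, ← AddChar.map_zero_eq_one (qPow p)] at h
  have h2 := qPow_injective p h
  have : s = 0 := by
    rcases mul_eq_zero.1 h2 with h3 | h3
    · exact absurd (by exact_mod_cast h3) hr
    · exact h3
  rw [this, AddChar.map_zero_eq_one]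

theorem teich_pow_totient {a : ℕ} (ha : ¬ p ∣ a) : teich p a ^ (conductorQ p).totient = 1 := by
  have h := congrArg Units.val (ZMod.pow_totient (isUnit_natCast_conductorQ (p := p) ha).unit)
  rw [Units.val_pow_eq_pow_val, IsUnit.unit_spec, Units.val_one] at h
  rw [teich, ← map_pow, h, map_one]

theorem teich_congr {a b : ℕ} (h : a ≡ b [MOD conductorQ p]) : teich p a = teich p b := by
  rw [teich, teich, (ZMod.natCast_eq_natCast_iff _ _ _).2 h]

theorem teich_eq_one {a : ℕ} (h : a ≡ 1 [MOD conductorQ p]) : teich p a = 1 := by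
  rw [teich_congr h, teich]; simp

theorem not_dvd_of_modEq_one {a : ℕ} (h : a ≡ 1 [MOD conductorQ p]) : ¬ p ∣ a := by
  intro h'
  have h2 : a ≡ 1 [MOD p] := h.of_dvd (dvd_conductorQ p)
  have := (h2.dvd_iff dvd_rfl).1 h'
  exact hp.out.one_lt.ne' (Nat.dvd_one.1 this)

theorem angleLog_one_add_conductorQ (p : ℕ) [Fact p.Prime] :
    angleLog p (1 + conductorQ p) = 1 := by
  have h : 1 + conductorQ p ≡ 1 [MOD conductorQ p] := by simp [Nat.ModEq]
  have hnd := not_dvd_of_modEq_one h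
  apply qPow_injective p
  rw [qPow_angleLog hnd]
  have h1 := teich_mul_angle hnd
  rw [teich_eq_one h, one_mul] at h1
  rw [h1]
  have := qPow_natCast (p := p) 1
  simpa using this.symm

theorem not_dvd_one_add_conductorQ (p : ℕ) [Fact p.Prime] : ¬ p ∣ 1 + conductorQ p :=
  not_dvd_of_modEq_one (by simp [Nat.ModEq])

theorem norm_angleLog_sub {a b : ℕ} (ha : ¬ p ∣ a) (hb : ¬ p ∣ b) :
    ‖(conductorQ p : ℤ_[p])‖ * ‖angleLog p a - angleLog p b‖ = ‖angle p a - angle p b‖ := by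
  rw [← norm_qPow_sub, qPow_angleLog ha, qPow_angleLog hb]

theorem natCast_dvd_sub_of_modEq {N a b : ℕ} (h : a ≡ b [MOD N]) :
    (N : ℤ_[p]) ∣ (a : ℤ_[p]) - b := by
  have := map_dvd (Int.castRingHom ℤ_[p]) (Nat.modEq_iff_dvd.1 h)
  rw [← neg_sub, dvd_neg]
  simpa using this

/-- Congruent integers have the same Teichmüller component, a unit, so the congruence passes to ⟨a⟩;
taking logarithms costs exactly the factor q. -/
theorem dvd_angleLog_sub {a b m : ℕ} (ha : ¬ p ∣ a) (h : a ≡ b [MOD conductorQ p * p ^ m]) :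
    (p : ℤ_[p]) ^ m ∣ angleLog p a - angleLog p b := by
  have hb : ¬ p ∣ b := fun h' => ha
    (((h.of_dvd ((dvd_conductorQ p).mul_right _)).dvd_iff dvd_rfl).2 h')
  have h1 := natCast_dvd_sub_of_modEq (p := p) h
  have ht : teich p a = teich p b := teich_congr (h.of_dvd (dvd_mul_right _ _))
  have e : (a : ℤ_[p]) - b = teich p a * (angle p a - angle p b) := by
    rw [mul_sub, teich_mul_angle ha, ht, teich_mul_angle hb]
  rw [e] at h1
  have h2 := ((isUnit_teich ha).dvd_mul_left).1 h1
  rw [padicInt_dvd_iff_norm_le] at h2 ⊢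
  rw [← norm_angleLog_sub ha hb, Nat.cast_mul, norm_mul, Nat.cast_pow] at h2
  exact le_of_mul_le_mul_left h2 (lt_of_le_of_ne (norm_nonneg _) (norm_conductorQ_ne_zero p).symm)

end PadicLimit

end

/-! ### Ultrametric coefficient bounds and the norm operator on polynomials. -/

noncomputable section

open Polynomial

section CoeffBound

set_option linter.unusedSectionVars false

variable {K : Type*} [NormedField K] [IsUltrametricDist K]

/-- All coefficients of `f` have norm at most `c`. -/
def Polynomial.CoeffBound (c : ℝ) (f : K[X]) : Prop := ∀ i, ‖f.coeff i‖ ≤ c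

namespace Polynomial.CoeffBound

theorem mono {c c' : ℝ} {f : K[X]} (h : CoeffBound c f) (hc : c ≤ c') : CoeffBound c' f :=
  fun i => (h i).trans hc

theorem add {c : ℝ} {f g : K[X]} (hf : CoeffBound c f) (hg : CoeffBound c g) :
    CoeffBound c (f + g) := fun i => by
  rw [coeff_add]
  exact (IsUltrametricDist.norm_add_le_max _ _).trans (max_le (hf i) (hg i))

theorem neg {c : ℝ} {f : K[X]} (hf : CoeffBound c f) : CoeffBound c (-f) := fun i => by
  rw [coeff_neg, norm_neg]; exact hf i

theorem sum {ι : Type*} {c : ℝ} (hc : 0 ≤ c) {s : Finset ι} {f : ι → K[X]}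
    (hf : ∀ j ∈ s, CoeffBound c (f j)) : CoeffBound c (∑ j ∈ s, f j) := fun i => by
  rw [finsetSum_coeff]
  exact IsUltrametricDist.norm_sum_le_of_forall_le_of_nonneg hc fun j hj => hf j hj i

theorem mul {c c' : ℝ} (hc : 0 ≤ c) (hc' : 0 ≤ c') {f g : K[X]} (hf : CoeffBound c f)
    (hg : CoeffBound c' g) : CoeffBound (c * c') (f * g) := fun i => by
  rw [coeff_mul]
  refine IsUltrametricDist.norm_sum_le_of_forall_le_of_nonneg (mul_nonneg hc hc') fun j _ => ?_
  rw [norm_mul]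
  exact mul_le_mul (hf _) (hg _) (norm_nonneg _) hc

theorem one : CoeffBound 1 (1 : K[X]) := fun i => by
  rw [coeff_one]; split_ifs <;> simp

theorem prod {ι : Type*} {s : Finset ι} {f : ι → K[X]}
    (hf : ∀ j ∈ s, CoeffBound 1 (f j)) : CoeffBound 1 (∏ j ∈ s, f j) := by
  refine Finset.prod_induction f (CoeffBound 1) (fun a b ha hb => ?_) one hf
  simpa using ha.mul zero_le_one zero_le_one hb

theorem comp_C_mul_X {c : ℝ} {f : K[X]} (hf : CoeffBound c f) {ζ : K} (hζ : ‖ζ‖ = 1) :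
    CoeffBound c (f.comp (C ζ * X)) := fun i => by
  rw [comp_C_mul_X_coeff, norm_mul, norm_pow, hζ, one_pow, mul_one]; exact hf i

theorem prod_sub_prod {ι : Type*} [DecidableEq ι] {c : ℝ} (hc : 0 ≤ c) {s : Finset ι}
    {f g : ι → K[X]} (hf : ∀ j ∈ s, CoeffBound 1 (f j)) (hg : ∀ j ∈ s, CoeffBound 1 (g j))
    (hfg : ∀ j ∈ s, CoeffBound c (f j - g j)) :
    CoeffBound c (∏ j ∈ s, f j - ∏ j ∈ s, g j) := by
  induction s using Finset.induction_on with
  | empty => intro i; simpa using hc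
  | insert a s ha ih =>
    simp only [Finset.mem_insert, forall_eq_or_imp] at hf hg hfg
    have ih := ih hf.2 hg.2 hfg.2
    rw [Finset.prod_insert ha, Finset.prod_insert ha]
    have e : f a * ∏ j ∈ s, f j - g a * ∏ j ∈ s, g j =
      (f a - g a) * ∏ j ∈ s, f j + g a * (∏ j ∈ s, f j - ∏ j ∈ s, g j) := by ring
    rw [e]
    refine CoeffBound.add ?_ ?_
    · simpa using hfg.1.mul hc zero_le_one (prod hf.2)
    · simpa using hg.1.mul zero_le_one hc ih

/-- Second order expansion of a product. -/
theorem prod_add_sub {ι : Type*} [DecidableEq ι] {c : ℝ} (hc : 0 ≤ c) (hc1 : c ≤ 1) {s : Finset ι}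
    {e g : ι → K[X]} (he : ∀ j ∈ s, CoeffBound c (e j)) (hg : ∀ j ∈ s, CoeffBound 1 (g j)) :
    CoeffBound (c ^ 2) (∏ j ∈ s, (g j + e j) - ∏ j ∈ s, g j -
      ∑ j ∈ s, e j * ∏ k ∈ s.erase j, g k) := by
  induction s using Finset.induction_on with
  | empty => intro i; simp; positivity
  | insert a s ha ih =>
    simp only [Finset.mem_insert, forall_eq_or_imp] at he hg
    have ih := ih he.2 hg.2
    have hsum : ∑ j ∈ s, e j * ∏ k ∈ (insert a s).erase j, g k =
        g a * ∑ j ∈ s, e j * ∏ k ∈ s.erase j, g k := by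
      rw [Finset.mul_sum]
      refine Finset.sum_congr rfl fun j hj => ?_
      have hja : a ≠ j := fun h => ha (h ▸ hj)
      rw [Finset.erase_insert_of_ne hja, Finset.prod_insert (fun h => ha (Finset.mem_of_mem_erase h))]
      ring
    rw [Finset.prod_insert ha, Finset.prod_insert ha, Finset.sum_insert ha, Finset.erase_insert ha,
      hsum]
    have e1 : (g a + e a) * ∏ j ∈ s, (g j + e j) - g a * ∏ j ∈ s, g j -
        (e a * ∏ k ∈ s, g k + g a * ∑ j ∈ s, e j * ∏ k ∈ s.erase j, g k) =
        g a * (∏ j ∈ s, (g j + e j) - ∏ j ∈ s, g j - ∑ j ∈ s, e j * ∏ k ∈ s.erase j, g k) +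
        e a * (∏ j ∈ s, (g j + e j) - ∏ j ∈ s, g j) := by ring
    rw [e1]
    refine CoeffBound.add ?_ ?_
    · simpa using hg.1.mul zero_le_one (by positivity) ih
    · rw [sq]
      refine he.1.mul hc hc (prod_sub_prod hc (fun j hj => ?_) hg.2 fun j hj => ?_)
      · exact (hg.2 j hj).add ((he.2 j hj).mono hc1)
      · simpa using he.2 j hj

theorem norm_eval_le {c : ℝ} (hc : 0 ≤ c) {f : K[X]} (hf : CoeffBound c f) {x : K} (hx : ‖x‖ ≤ 1) :
    ‖f.eval x‖ ≤ c := by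
  rw [eval_eq_sum_range]
  refine IsUltrametricDist.norm_sum_le_of_forall_le_of_nonneg hc fun j _ => ?_
  rw [norm_mul, norm_pow]
  exact (mul_le_of_le_one_right (norm_nonneg _) (pow_le_one₀ (norm_nonneg _) hx)).trans (hf j)

theorem _root_.norm_pow_sub_pow_le {x y : K} (hx : ‖x‖ ≤ 1) (hy : ‖y‖ ≤ 1) (n : ℕ) :
    ‖x ^ n - y ^ n‖ ≤ ‖x - y‖ := by
  rw [← Commute.geom_sum₂_mul (Commute.all x y), norm_mul]
  refine mul_le_of_le_one_left (norm_nonneg _) ?_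
  refine IsUltrametricDist.norm_sum_le_of_forall_le_of_nonneg zero_le_one fun j _ => ?_
  rw [norm_mul, norm_pow, norm_pow]
  exact mul_le_one₀ (pow_le_one₀ (norm_nonneg _) hx) (by positivity)
    (pow_le_one₀ (norm_nonneg _) hy)

theorem norm_eval_sub_le {f : K[X]} (hf : CoeffBound 1 f) {x y : K} (hx : ‖x‖ ≤ 1) (hy : ‖y‖ ≤ 1) :
    ‖f.eval x - f.eval y‖ ≤ ‖x - y‖ := by
  rw [eval_eq_sum_range, eval_eq_sum_range, ← Finset.sum_sub_distrib]
  refine IsUltrametricDist.norm_sum_le_of_forall_le_of_nonneg (norm_nonneg _) fun j _ => ?_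
  rw [← mul_sub, norm_mul]
  exact (mul_le_mul (hf j) (norm_pow_sub_pow_le hx hy j) (norm_nonneg _) zero_le_one).trans
    (one_mul _).le

/-- The subring of polynomials with coefficients of norm at most `1`. -/
def integral (K : Type*) [NormedField K] [IsUltrametricDist K] : Subring K[X] where
  carrier := {f | CoeffBound 1 f}
  mul_mem' ha hb := by simpa using CoeffBound.mul zero_le_one zero_le_one ha hb
  one_mem' := one
  add_mem' ha hb := CoeffBound.add ha hb
  zero_mem' := fun i => by simp
  neg_mem' ha := CoeffBound.neg ha

theorem add_pow_sub {p : ℕ} [hp : Fact p.Prime] {f g : K[X]} (hf : CoeffBound 1 f)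
    (hg : CoeffBound 1 g) : CoeffBound ‖(p : K)‖ ((f + g) ^ p - (f ^ p + g ^ p)) := by
  obtain ⟨r, hr⟩ := exists_add_pow_prime_eq hp.out (⟨f, hf⟩ : integral K) (⟨g, hg⟩ : integral K)
  have h := congrArg (Subring.subtype (integral K)) hr
  simp only [map_pow, map_add, map_mul, map_natCast, Subring.subtype_apply] at h
  rw [h, add_sub_cancel_left, mul_assoc, mul_assoc]
  have h2 : CoeffBound 1 (f * (g * r) : K[X]) := (integral K).mul_mem hf ((integral K).mul_mem hg r.2)
  intro i
  have e : (p : K[X]) = C (p : K) := by simp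
  rw [e, coeff_C_mul, norm_mul]
  exact mul_le_of_le_one_right (norm_nonneg _) (h2 i)

theorem sum_pow_sub {ι : Type*} [DecidableEq ι] {p : ℕ} [hp : Fact p.Prime] {s : Finset ι}
    {f : ι → K[X]} (hf : ∀ j ∈ s, CoeffBound 1 (f j)) :
    CoeffBound ‖(p : K)‖ ((∑ j ∈ s, f j) ^ p - ∑ j ∈ s, f j ^ p) := by
  induction s using Finset.induction_on with
  | empty => intro i; simp [hp.out.ne_zero]
  | insert a s ha ih =>
    simp only [Finset.mem_insert, forall_eq_or_imp] at hf
    rw [Finset.sum_insert ha, Finset.sum_insert ha]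
    have h := (add_pow_sub (p := p) hf.1 (sum zero_le_one hf.2)).add (ih hf.2)
    refine (congrArg (CoeffBound ‖(p : K)‖) ?_).mp h
    ring

end Polynomial.CoeffBound

theorem norm_eq_one_of_pow_eq_one' {x : K} {n : ℕ} (hn : n ≠ 0) (h : x ^ n = 1) : ‖x‖ = 1 := by
  have := congrArg norm h
  rw [norm_pow, norm_one] at this
  exact (pow_eq_one_iff_of_nonneg (norm_nonneg _) hn).1 this

/-- From ((ζ - 1) + 1)^p = 1 and additivity of p-th powers modulo p, (ζ - 1)^p is divisible by p. -/
theorem norm_sub_one_pow_le {p : ℕ} [hp : Fact p.Prime] {ζ : K} (h : ζ ^ p = 1) :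
    ‖ζ - 1‖ ^ p ≤ ‖(p : K)‖ := by
  have h1 : ‖ζ‖ = 1 := norm_eq_one_of_pow_eq_one' hp.out.ne_zero h
  have hb : ‖ζ - 1‖ ≤ 1 := by
    rw [sub_eq_add_neg]
    exact (IsUltrametricDist.norm_add_le_max _ _).trans (by rw [norm_neg, h1, norm_one, max_self])
  have hC : ∀ x : K, ‖x‖ ≤ 1 → CoeffBound 1 (C x) := fun x hx i => by
    rw [coeff_C]; split_ifs <;> simp [hx]
  have := CoeffBound.add_pow_sub (p := p) (hC (ζ - 1) hb) (hC 1 (by simp)) 0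
  rw [← C_add, sub_add_cancel, ← C_pow, h, ← C_pow, ← C_pow, ← C_add, ← C_sub, coeff_C_zero] at this
  rw [← norm_pow]
  simpa using this

/-! ### The norm operator -/

namespace Polynomial

/-- The product of the polynomials `f(ζ X)` over the `p`-th roots of unity `ζ`. -/
def rootProd (p : ℕ) (f : K[X]) : K[X] := ∏ ζ ∈ nthRootsFinset p (1 : K), f.comp (C ζ * X)

/-- The polynomial `g` with `g(X^p) = ∏ f(ζ X)`, the product being over the `p`-th roots of
unity. -/
def normOp (p : ℕ) (f : K[X]) : K[X] := contract p (rootProd p f)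

variable {p : ℕ} [hp : Fact p.Prime]

theorem mem_nthRootsFinset_one {n : ℕ} (hn : n ≠ 0) {ζ : K} :
    ζ ∈ nthRootsFinset n (1 : K) ↔ ζ ^ n = 1 := mem_nthRootsFinset (Nat.pos_of_ne_zero hn) 1

theorem prod_nthRootsFinset_mul {M : Type*} [CommMonoid M] {n : ℕ} (hn : n ≠ 0) {ω : K}
    (hω : ω ^ n = 1) (F : K → M) :
    ∏ ζ ∈ nthRootsFinset n (1 : K), F (ω * ζ) = ∏ ζ ∈ nthRootsFinset n (1 : K), F ζ := by
  have h0 : ω ≠ 0 := by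
    rintro rfl; rw [zero_pow hn] at hω; exact zero_ne_one hω
  refine Finset.prod_bij' (fun ζ _ => ω * ζ) (fun ζ _ => ω⁻¹ * ζ) ?_ ?_ ?_ ?_ ?_
  · intro ζ hζ
    rw [mem_nthRootsFinset_one hn] at hζ ⊢
    rw [mul_pow, hω, hζ, one_mul]
  · intro ζ hζ
    rw [mem_nthRootsFinset_one hn] at hζ ⊢
    rw [mul_pow, inv_pow, hω, hζ, inv_one, one_mul]
  · intro ζ _; rw [inv_mul_cancel_left₀ h0]
  · intro ζ _; rw [mul_inv_cancel_left₀ h0]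
  · intro ζ _; rfl

theorem comp_C_mul_X_comp (f : K[X]) (ω ζ : K) :
    (f.comp (C ζ * X)).comp (C ω * X) = f.comp (C (ω * ζ) * X) := by
  rw [comp_assoc]
  congr 1
  simp only [mul_comp, C_comp, X_comp, C_mul]
  ring

theorem rootProd_comp (f : K[X]) {ω : K} (hω : ω ^ p = 1) :
    (rootProd p f).comp (C ω * X) = rootProd p f := by
  rw [rootProd, prod_comp]
  simp only [comp_C_mul_X_comp]
  exact prod_nthRootsFinset_mul hp.out.ne_zero hω (fun ζ => f.comp (C ζ * X))

/-- The product over roots of unity is invariant under X ↦ ωX for a primitive p-th root of unity ω,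
so only exponents divisible by p occur and contracting loses nothing. -/
theorem expand_normOp [IsAlgClosed K] [CharZero K] (f : K[X]) :
    expand K p (normOp p f) = rootProd p f := by
  have : NeZero (p : K) := ⟨by exact_mod_cast hp.out.ne_zero⟩
  obtain ⟨ω, hω⟩ := HasEnoughRootsOfUnity.exists_primitiveRoot K p
  ext n
  rw [coeff_expand hp.out.pos]
  split_ifs with h
  · rw [normOp, coeff_contract hp.out.ne_zero, Nat.div_mul_cancel h]
  · have h1 := congrArg (fun g => g.coeff n) (rootProd_comp f hω.pow_eq_one)
    simp only [comp_C_mul_X_coeff] at h1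
    by_contra h2
    have h3 : ω ^ n = 1 := mul_left_cancel₀ (Ne.symm h2) (by rw [h1, mul_one])
    exact h (hω.dvd_of_pow_eq_one n h3)

theorem eval_normOp [IsAlgClosed K] [CharZero K] (f : K[X]) (x : K) :
    (normOp p f).eval (x ^ p) = ∏ ζ ∈ nthRootsFinset p (1 : K), f.eval (ζ * x) := by
  rw [← expand_eval, expand_normOp, rootProd, eval_prod]
  simp [eval_comp]

/-- The p-power map sends the roots of unity of order dividing p^(k+1) to those of order dividing
p^k; its fibre over z^p is the coset z·μ_p, which is one application of the operator. -/
theorem eval_iterate_normOp [IsAlgClosed K] [CharZero K] (k : ℕ) (f : K[X]) (x : K) :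
    ((normOp p)^[k] f).eval (x ^ p ^ k) = ∏ ζ ∈ nthRootsFinset (p ^ k) (1 : K), f.eval (ζ * x) := by
  classical
  have hp0 := hp.out.ne_zero
  induction k generalizing f x with
  | zero =>
    have h1 : nthRootsFinset 1 (1 : K) = {1} := by
      ext ζ
      rw [mem_nthRootsFinset_one one_ne_zero, pow_one, Finset.mem_singleton]
    rw [pow_zero, pow_one, h1, Finset.prod_singleton, one_mul]
    rfl
  | succ k ih =>
    rw [Function.iterate_succ_apply, pow_succ', pow_mul, ih]
    have hmaps : ∀ ζ ∈ nthRootsFinset (p * p ^ k) (1 : K), ζ ^ p ∈ nthRootsFinset (p ^ k) (1 : K) := by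
      intro ζ hζ
      rw [mem_nthRootsFinset_one (mul_ne_zero hp0 (pow_ne_zero _ hp0))] at hζ
      rw [mem_nthRootsFinset_one (pow_ne_zero _ hp0), ← pow_mul, hζ]
    rw [← Finset.prod_fiberwise_of_maps_to hmaps]
    refine Finset.prod_congr rfl fun ξ hξ => ?_
    rw [mem_nthRootsFinset_one (pow_ne_zero _ hp0)] at hξ
    obtain ⟨z, hz⟩ := IsAlgClosed.exists_pow_nat_eq ξ hp.out.pos
    have hz0 : z ≠ 0 := by
      rintro rfl
      rw [zero_pow hp0] at hz
      rw [← hz, zero_pow (pow_ne_zero _ hp0)] at hξ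
      exact zero_ne_one hξ
    rw [← hz, ← mul_pow, eval_normOp]
    refine Finset.prod_bij' (fun ζ _ => ζ * z) (fun ζ _ => ζ * z⁻¹) ?_ ?_ ?_ ?_ ?_
    · intro ζ hζ
      rw [mem_nthRootsFinset_one hp0] at hζ
      rw [Finset.mem_filter, mem_nthRootsFinset_one (mul_ne_zero hp0 (pow_ne_zero _ hp0)), pow_mul,
        mul_pow, hζ, one_mul, hz]
      exact ⟨hξ, rfl⟩
    · intro ζ hζ
      rw [Finset.mem_filter] at hζ
      rw [mem_nthRootsFinset_one hp0, mul_pow, hζ.2, ← mul_pow, mul_inv_cancel₀ hz0, one_pow]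
    · intro ζ _; rw [mul_assoc, mul_inv_cancel₀ hz0, mul_one]
    · intro ζ _; rw [mul_assoc, inv_mul_cancel₀ hz0, mul_one]
    · intro ζ _; rw [mul_assoc]

theorem norm_eq_one_of_mem_nthRootsFinset {ζ : K} (hζ : ζ ∈ nthRootsFinset p (1 : K)) :
    ‖ζ‖ = 1 :=
  norm_eq_one_of_pow_eq_one' hp.out.ne_zero ((mem_nthRootsFinset_one hp.out.ne_zero).1 hζ)

theorem CoeffBound.contract {c : ℝ} {f : K[X]} (hf : CoeffBound c f) :
    CoeffBound c (Polynomial.contract p f) := fun i => by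
  rw [coeff_contract hp.out.ne_zero]; exact hf _

theorem CoeffBound.normOp {f : K[X]} (hf : CoeffBound 1 f) : CoeffBound 1 (normOp p f) :=
  CoeffBound.contract (CoeffBound.prod fun _ hζ =>
    hf.comp_C_mul_X (norm_eq_one_of_mem_nthRootsFinset hζ))

theorem CoeffBound.iterate_normOp {f : K[X]} (hf : CoeffBound 1 f) (k : ℕ) :
    CoeffBound 1 ((Polynomial.normOp p)^[k] f) := by
  induction k with
  | zero => exact hf
  | succ k ih => rw [Function.iterate_succ_apply']; exact ih.normOp

/-- The norm operator is contracting. -/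
theorem CoeffBound.normOp_sub [IsAlgClosed K] [CharZero K] {c : ℝ} (hc : 0 ≤ c) (hc1 : c ≤ 1)
    {f g : K[X]} (hg : CoeffBound 1 g) (hfg : CoeffBound c (f - g)) :
    CoeffBound (max (‖(p : K)‖ * c) (c ^ 2)) (Polynomial.normOp p f - Polynomial.normOp p g) := by
  classical
  have : NeZero (p : K) := ⟨by exact_mod_cast hp.out.ne_zero⟩
  obtain ⟨ω, hω⟩ := HasEnoughRootsOfUnity.exists_primitiveRoot K p
  have hp0 := hp.out.ne_zero
  set μ := nthRootsFinset p (1 : K)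
  have h1 : (1 : K) ∈ μ := (mem_nthRootsFinset_one hp0).2 (one_pow _)
  -- The first order term of ∏ g(ζX) + (f - g)(ζX) is the sum over ζ of h(ζX): each summand is the
  -- one at ζ = 1 rotated by ζ.
  set h : K[X] := (f - g) * ∏ k ∈ μ.erase 1, g.comp (C k * X)
  have hh : CoeffBound c h := by
    simpa using hfg.mul hc zero_le_one (CoeffBound.prod fun ζ hζ =>
      hg.comp_C_mul_X (norm_eq_one_of_mem_nthRootsFinset (Finset.mem_of_mem_erase hζ)))
  have hterm : ∀ ζ ∈ μ, (f - g).comp (C ζ * X) * ∏ k ∈ μ.erase ζ, g.comp (C k * X) =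
      h.comp (C ζ * X) := by
    intro ζ hζ
    have hζ1 := (mem_nthRootsFinset_one hp0).1 hζ
    have hζ0 : ζ ≠ 0 := by
      rintro rfl; rw [zero_pow hp0] at hζ1; exact zero_ne_one hζ1
    simp only [h, mul_comp, prod_comp, comp_C_mul_X_comp]
    congr 1
    refine (Finset.prod_bij' (fun k _ => ζ * k) (fun k _ => ζ⁻¹ * k) ?_ ?_ ?_ ?_ ?_).symm
    · intro k hk
      rw [Finset.mem_erase, mem_nthRootsFinset_one hp0] at hk ⊢
      exact ⟨fun e => hk.1 (mul_left_cancel₀ hζ0 (by rw [e, mul_one])), by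
        rw [mul_pow, hζ1, hk.2, one_mul]⟩
    · intro k hk
      rw [Finset.mem_erase, mem_nthRootsFinset_one hp0] at hk ⊢
      exact ⟨fun e => hk.1 (by rw [← mul_inv_cancel_left₀ hζ0 k, e, mul_one]), by
        rw [mul_pow, inv_pow, hζ1, hk.2, inv_one, one_mul]⟩
    · intro k _; rw [inv_mul_cancel_left₀ hζ0]
    · intro k _; rw [mul_inv_cancel_left₀ hζ0]
    · intro k _; rfl
  have hexp := CoeffBound.prod_add_sub hc hc1 (s := μ) (e := fun ζ => (f - g).comp (C ζ * X))
    (g := fun ζ => g.comp (C ζ * X))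
    (fun ζ hζ => hfg.comp_C_mul_X (norm_eq_one_of_mem_nthRootsFinset hζ))
    (fun ζ hζ => hg.comp_C_mul_X (norm_eq_one_of_mem_nthRootsFinset hζ))
  have hsum : ∀ ζ : K, g.comp (C ζ * X) + (f - g).comp (C ζ * X) = f.comp (C ζ * X) := by
    intro ζ; rw [sub_comp, add_sub_cancel]
  simp only [hsum] at hexp
  rw [Finset.sum_congr rfl hterm] at hexp
  intro n
  have h2 := hexp (n * p)
  rw [coeff_sub] at h2
  -- At exponents divisible by p all p rotations contribute equally. This supplies the factor p in
  -- the first order term; the higher terms are bounded by c².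
  have h3 : (∑ ζ ∈ μ, h.comp (C ζ * X)).coeff (n * p) = p * h.coeff (n * p) := by
    rw [finsetSum_coeff, Finset.sum_congr rfl (g := fun _ => h.coeff (n * p))]
    · rw [Finset.sum_const, hω.card_nthRootsFinset, nsmul_eq_mul]
    · intro ζ hζ
      rw [comp_C_mul_X_coeff, mul_comm n p, pow_mul, (mem_nthRootsFinset_one hp0).1 hζ, one_pow,
        mul_one]
  have h4 : ‖(∑ ζ ∈ μ, h.comp (C ζ * X)).coeff (n * p)‖ ≤ ‖(p : K)‖ * c := by
    rw [h3, norm_mul]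
    exact mul_le_mul_of_nonneg_left (hh _) (norm_nonneg _)
  rw [coeff_sub, Polynomial.normOp, Polynomial.normOp, coeff_contract hp0, coeff_contract hp0,
    ← coeff_sub, ← sub_add_cancel ((rootProd p f - rootProd p g).coeff (n * p))
      ((∑ ζ ∈ μ, h.comp (C ζ * X)).coeff (n * p)), add_comm]
  exact (IsUltrametricDist.norm_add_le_max _ _).trans (max_le_max h4 h2)

/-- The polynomial obtained from `f` by raising the coefficients to the power `m`. -/
def coeffPow (m : ℕ) (f : K[X]) : K[X] := ∑ i ∈ f.support, monomial i (f.coeff i ^ m)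

theorem coeff_coeffPow {m : ℕ} (hm : m ≠ 0) (f : K[X]) (i : ℕ) :
    (coeffPow m f).coeff i = f.coeff i ^ m := by
  rw [coeffPow, finsetSum_coeff]
  simp only [coeff_monomial]
  rw [Finset.sum_ite_eq']
  split_ifs with h
  · rfl
  · rw [notMem_support_iff.1 h, zero_pow hm]

theorem CoeffBound.coeffPow {f : K[X]} (hf : CoeffBound 1 f) {m : ℕ} (hm : m ≠ 0) :
    CoeffBound 1 (coeffPow m f) := fun i => by
  rw [coeff_coeffPow hm, norm_pow]; exact pow_le_one₀ (norm_nonneg _) (hf i)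

/-- The norm operator reduces to the Frobenius on coefficients. -/
theorem CoeffBound.normOp_sub_coeffPow [IsAlgClosed K] [CharZero K] {c : ℝ} (hpc : ‖(p : K)‖ ≤ c)
    (hζ : ∀ ζ : K, ζ ^ p = 1 → ‖ζ - 1‖ ≤ c) {f : K[X]} (hf : CoeffBound 1 f) :
    CoeffBound c (Polynomial.normOp p f - Polynomial.coeffPow p f) := by
  classical
  have : NeZero (p : K) := ⟨by exact_mod_cast hp.out.ne_zero⟩
  obtain ⟨ω, hω⟩ := HasEnoughRootsOfUnity.exists_primitiveRoot K p
  have hp0 := hp.out.ne_zero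
  have hc : 0 ≤ c := (norm_nonneg _).trans hpc
  -- Up to c, f(ζX) agrees with f(X), so the product agrees with f^p. Then f^p agrees with the sum
  -- of the p-th powers of the monomials of f, and contraction leaves the p-th powers of the
  -- coefficients.
  have h1 : CoeffBound c (rootProd p f - f ^ p) := by
    have h2 := CoeffBound.prod_sub_prod hc (s := nthRootsFinset p (1 : K))
      (f := fun ζ => f.comp (C ζ * X)) (g := fun _ => f)
      (fun ζ hζ => hf.comp_C_mul_X (norm_eq_one_of_mem_nthRootsFinset hζ)) (fun _ _ => hf)
      (fun ζ hζ' i => by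
        rw [coeff_sub, comp_C_mul_X_coeff, ← mul_sub_one, norm_mul]
        have h5 := (mem_nthRootsFinset_one hp0).1 hζ'
        have h6 : ‖ζ ^ i - 1 ^ i‖ ≤ ‖ζ - 1‖ :=
          norm_pow_sub_pow_le (norm_eq_one_of_mem_nthRootsFinset hζ').le norm_one.le i
        rw [one_pow] at h6
        exact (mul_le_mul (hf i) (h6.trans (hζ ζ h5)) (norm_nonneg _) zero_le_one).trans
          (one_mul c).le)
    rwa [Finset.prod_const, hω.card_nthRootsFinset] at h2
  have h3 : CoeffBound c (f ^ p - ∑ i ∈ f.support, (monomial i (f.coeff i)) ^ p) := by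
    have h4 := CoeffBound.sum_pow_sub (p := p) (s := f.support)
      (f := fun i => monomial i (f.coeff i)) (fun i _ j => by
        rw [coeff_monomial]; split_ifs with h
        · exact hf i
        · simp)
    rw [← as_sum_support] at h4
    exact h4.mono hpc
  have h5 := h1.add h3
  rw [sub_add_sub_cancel] at h5
  intro n
  have h6 := h5 (n * p)
  rw [coeff_sub] at h6 ⊢
  rw [Polynomial.normOp, coeff_contract hp0, coeff_coeffPow hp0]
  convert h6 using 3
  rw [finsetSum_coeff]
  simp only [monomial_pow, coeff_monomial]
  have : ∀ i, (i * p = n * p) ↔ i = n := fun i => Nat.mul_left_inj hp0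
  simp only [this]
  rw [Finset.sum_ite_eq']
  split_ifs with h
  · rfl
  · rw [notMem_support_iff.1 h, zero_pow hp0]

/-- Induction: the operator preserves congruence up to c, since max(|p|c, c²) ≤ c, and one further
application acts as Frobenius up to c. -/
theorem CoeffBound.iterate_normOp_sub_coeffPow [IsAlgClosed K] [CharZero K] {c : ℝ}
    (hpc : ‖(p : K)‖ ≤ c) (hc1 : c ≤ 1) (hζ : ∀ ζ : K, ζ ^ p = 1 → ‖ζ - 1‖ ≤ c) {f : K[X]}
    (hf : CoeffBound 1 f) (k : ℕ) :
    CoeffBound c ((Polynomial.normOp p)^[k] f - Polynomial.coeffPow (p ^ k) f) := by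
  have hp0 := hp.out.ne_zero
  have hc : 0 ≤ c := (norm_nonneg _).trans hpc
  induction k with
  | zero =>
    intro i
    simp only [Function.iterate_zero, id, pow_zero]
    rw [coeff_sub, coeff_coeffPow one_ne_zero, pow_one, sub_self, norm_zero]
    exact hc
  | succ k ih =>
    rw [Function.iterate_succ_apply']
    have hb : CoeffBound 1 (Polynomial.coeffPow (p ^ k) f) := hf.coeffPow (pow_ne_zero _ hp0)
    have h1 := (CoeffBound.normOp_sub (p := p) hc hc1 hb ih).mono
      (max_le (mul_le_of_le_one_left hc (hpc.trans hc1)) (by nlinarith))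
    have h2 := CoeffBound.normOp_sub_coeffPow hpc hζ hb
    have h3 := h1.add h2
    rw [sub_add_sub_cancel] at h3
    convert h3 using 2
    ext i
    rw [coeff_coeffPow (pow_ne_zero _ hp0), coeff_coeffPow hp0, coeff_coeffPow (pow_ne_zero _ hp0),
      ← pow_mul, pow_succ]

/-- The case k = 0 is the Frobenius congruence over d steps, where the hypothesis on coefficients
enters. Each further application of the operator gains a factor c because both |p| and c^(k+1) are
at most c. -/
theorem CoeffBound.iterate_normOp_sub [IsAlgClosed K] [CharZero K] {c : ℝ} (hpc : ‖(p : K)‖ ≤ c)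
    (hc1 : c ≤ 1) (hζ : ∀ ζ : K, ζ ^ p = 1 → ‖ζ - 1‖ ≤ c) {f : K[X]} (hf : CoeffBound 1 f) {d : ℕ}
    (hd : ∀ i, ‖f.coeff i ^ p ^ d - f.coeff i‖ ≤ c) (k : ℕ) :
    CoeffBound (c ^ (k + 1))
      ((Polynomial.normOp p)^[k + d] f - (Polynomial.normOp p)^[k] f) := by
  have hc : 0 ≤ c := (norm_nonneg _).trans hpc
  induction k with
  | zero =>
    have h1 := CoeffBound.iterate_normOp_sub_coeffPow hpc hc1 hζ hf d
    have h2 : CoeffBound c (Polynomial.coeffPow (p ^ d) f - f) := fun i => by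
      rw [coeff_sub, coeff_coeffPow (pow_ne_zero _ hp.out.ne_zero)]; exact hd i
    simpa using h1.add h2
  | succ k ih =>
    rw [add_right_comm k 1 d, Function.iterate_succ_apply', Function.iterate_succ_apply']
    refine (CoeffBound.normOp_sub (p := p) (by positivity) (pow_le_one₀ hc hc1)
      (hf.iterate_normOp k) ih).mono (max_le ?_ ?_)
    · rw [pow_succ' c (k + 1)]
      exact mul_le_mul_of_nonneg_right hpc (by positivity)
    · rw [sq, pow_succ' c (k + 1)]
      refine mul_le_mul_of_nonneg_right ?_ (by positivity)
      exact pow_le_of_le_one hc hc1 (by omega)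

end Polynomial

end CoeffBound

end

/-! ### Convergence of products over the p-power roots of unity. -/

noncomputable section

open Polynomial

/-- The product is the resultant of X^n - 1 and f, a polynomial expression in the coefficients of f.
The ring R need not contain the roots of unity. -/
theorem Polynomial.prod_eval_nthRootsFinset_mem {K : Type*} [Field K] [IsAlgClosed K] [CharZero K]
    {n : ℕ} (hn : n ≠ 0) (R : Subring K) {f : K[X]} (hf : ∀ i, f.coeff i ∈ R) :
    ∏ ζ ∈ nthRootsFinset n (1 : K), f.eval ζ ∈ R := by
  classical
  have : NeZero (n : K) := ⟨by exact_mod_cast hn⟩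
  obtain ⟨g, hg⟩ : ∃ g : R[X], g.map R.subtype = f := by
    refine (mem_lifts f).1 ((lifts_iff_coeff_lifts f).2 fun i => ⟨⟨_, hf i⟩, rfl⟩)
  obtain ⟨ω, hω⟩ := HasEnoughRootsOfUnity.exists_primitiveRoot K n
  have h := resultant_eq_prod_eval (X ^ n - 1 : K[X]) f f.natDegree le_rfl
    (IsAlgClosed.splits _)
  have hm : (X ^ n - 1 : K[X]).Monic := by simpa using monic_X_pow_sub_C (1 : K) hn
  have hr : (X ^ n - 1 : K[X]).roots = (nthRootsFinset n (1 : K)).val := by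
    rw [nthRootsFinset_def, Multiset.toFinset_val, Multiset.dedup_eq_self.2 hω.nthRoots_one_nodup,
      nthRoots, C_1]
  rw [hm.leadingCoeff, one_pow, one_mul, hr] at h
  have e : (X ^ n - 1 : K[X]) = (X ^ n - 1 : R[X]).map R.subtype := by simp
  have h2 := resultant_map_map (X ^ n - 1 : R[X]) g (X ^ n - 1 : K[X]).natDegree f.natDegree R.subtype
  rw [hg, ← e] at h2
  change (Multiset.map (fun x => eval x f) (nthRootsFinset n (1 : K)).val).prod ∈ R
  rw [← h, h2]
  exact Subtype.mem _

namespace PadicLimit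

variable {p : ℕ} [hp : Fact p.Prime]

theorem norm_algebraMap_padicInt (x : ℤ_[p]) : ‖algebraMap ℤ_[p] (PadicAlgCl p) x‖ = ‖x‖ := by
  rw [IsScalarTower.algebraMap_apply ℤ_[p] ℚ_[p] (PadicAlgCl p)]
  exact PadicAlgCl.norm_extends p _

theorem norm_natCast_padicAlgCl (n : ℕ) : ‖(n : PadicAlgCl p)‖ = ‖(n : ℤ_[p])‖ := by
  rw [← norm_algebraMap_padicInt, map_natCast]

theorem continuous_algebraMap_padicInt (p : ℕ) [Fact p.Prime] :
    Continuous (algebraMap ℤ_[p] (PadicAlgCl p)) := by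
  refine (Isometry.of_dist_eq fun x y => ?_ : Isometry (algebraMap ℤ_[p] (PadicAlgCl p))).continuous
  rw [dist_eq_norm, dist_eq_norm, ← map_sub, norm_algebraMap_padicInt]

theorem norm_p_padicAlgCl (p : ℕ) [Fact p.Prime] : ‖(p : PadicAlgCl p)‖ = (p : ℝ)⁻¹ := by
  rw [norm_natCast_padicAlgCl, PadicInt.norm_p]

/-- `(1 + q)^s` as an element of the algebraic closure of `ℚ_p`. -/
def qPowAlg (p : ℕ) [Fact p.Prime] (s : ℤ_[p]) : PadicAlgCl p :=
  algebraMap ℤ_[p] (PadicAlgCl p) (qPow p s)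

theorem norm_qPowAlg (s : ℤ_[p]) : ‖qPowAlg p s‖ = 1 := by
  rw [qPowAlg, norm_algebraMap_padicInt, norm_qPow]

theorem qPowAlg_zero : qPowAlg p 0 = 1 := by
  rw [qPowAlg, AddChar.map_zero_eq_one, map_one]

theorem qPowAlg_nsmul (n : ℕ) (s : ℤ_[p]) : qPowAlg p (n * s) = qPowAlg p s ^ n := by
  rw [qPowAlg, qPow_nsmul, map_pow, qPowAlg]

theorem qPowAlg_add (s t : ℤ_[p]) : qPowAlg p (s + t) = qPowAlg p s * qPowAlg p t := by
  rw [qPowAlg, AddChar.map_add_eq_mul, map_mul]; rfl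

theorem norm_qPowAlg_sub_le (s t : ℤ_[p]) : ‖qPowAlg p s - qPowAlg p t‖ ≤ ‖s - t‖ := by
  rw [qPowAlg, qPowAlg, ← map_sub, norm_algebraMap_padicInt, norm_qPow_sub]
  exact mul_le_of_le_one_left (norm_nonneg _) (norm_conductorQ_lt_one p).le

/-- Convergence of the products of an Iwasawa function over the `p`-power roots of unity. -/
theorem exists_tendsto_prod_nthRootsFinset (R : Subring (PadicAlgCl p))
    (hR : IsCompact (R : Set (PadicAlgCl p))) (hR1 : ∀ x ∈ R, ‖x‖ ≤ 1) {d : ℕ} (hd0 : d ≠ 0)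
    (hd : ∀ x ∈ R, ‖x ^ p ^ d - x‖ < 1) {f : ℕ → (PadicAlgCl p)[X]}
    (hf : ∀ m i, (f m).coeff i ∈ R) {F : PadicAlgCl p → ℤ_[p] → PadicAlgCl p}
    (hF : ∀ n ζ s, ζ ^ p ^ n = 1 →
      Tendsto (fun m => (f m).eval (ζ * qPowAlg p s)) atTop (𝓝 (F ζ s))) :
    ∃ ℓ ∈ R, ∀ s, Tendsto (fun n => ∏ ζ ∈ nthRootsFinset (p ^ (n * d)) (1 : PadicAlgCl p), F ζ s)
      atTop (𝓝 ℓ) := by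
  have hp0 := hp.out.ne_zero
  have hp1 : ‖(p : PadicAlgCl p)‖ < 1 := by
    rw [norm_p_padicAlgCl]
    exact inv_lt_one_of_one_lt₀ (by exact_mod_cast hp.out.one_lt)
  -- A single contraction constant c < 1 is needed. Compactness of R makes the supremum of ‖x^(p^d)
  -- - x‖ a maximum, and ‖ζ - 1‖ ≤ |p|^(1/p) for ζ^p = 1.
  obtain ⟨c, hc1, hpc, hζc, hdc⟩ : ∃ c : ℝ, c < 1 ∧ ‖(p : PadicAlgCl p)‖ ≤ c ∧
      (∀ ζ : PadicAlgCl p, ζ ^ p = 1 → ‖ζ - 1‖ ≤ c) ∧ ∀ x ∈ R, ‖x ^ p ^ d - x‖ ≤ c := by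
    obtain ⟨x, hx, hmax⟩ := hR.exists_isMaxOn ⟨0, R.zero_mem⟩
      (f := fun x => ‖x ^ p ^ d - x‖) (by fun_prop)
    have hpr : (0 : ℝ) < (p : ℝ)⁻¹ := inv_pos.2 (by exact_mod_cast hp.out.pos)
    refine ⟨max ‖x ^ p ^ d - x‖ (max ‖(p : PadicAlgCl p)‖ (‖(p : PadicAlgCl p)‖ ^ (p : ℝ)⁻¹)),
      max_lt (hd x hx) (max_lt hp1 (Real.rpow_lt_one (norm_nonneg _) hp1 hpr)),
      (le_max_left _ _).trans (le_max_right _ _), fun ζ hζ => ?_,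
      fun y hy => (hmax hy).trans (le_max_left _ _)⟩
    refine le_trans ?_ ((le_max_right _ _).trans (le_max_right _ _))
    have := Real.rpow_le_rpow (by positivity) (norm_sub_one_pow_le hζ) hpr.le
    rwa [← Real.rpow_natCast, ← Real.rpow_mul (norm_nonneg _),
      mul_inv_cancel₀ (by exact_mod_cast hp0), Real.rpow_one] at this
  have hc0 : 0 ≤ c := (norm_nonneg _).trans hpc
  have hb : ∀ m, CoeffBound 1 (f m) := fun m i => hR1 _ (hf m i)
  set P : ℕ → ℕ → ℤ_[p] → PadicAlgCl p := fun n m s =>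
    ∏ ζ ∈ nthRootsFinset (p ^ (n * d)) (1 : PadicAlgCl p), (f m).eval (ζ * qPowAlg p s)
  set A : ℕ → ℤ_[p] → PadicAlgCl p := fun n s =>
    ∏ ζ ∈ nthRootsFinset (p ^ (n * d)) (1 : PadicAlgCl p), F ζ s
  have hPA : ∀ n s, Tendsto (fun m => P n m s) atTop (𝓝 (A n s)) := fun n s =>
    tendsto_finsetProd _ fun ζ hζ => hF (n * d) ζ s
      ((mem_nthRootsFinset_one (pow_ne_zero _ hp0)).1 hζ)
  have hPe : ∀ n m s, P n m s = ((normOp p)^[n * d] (f m)).eval (qPowAlg p s ^ p ^ (n * d)) :=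
    fun n m s => (eval_iterate_normOp _ _ _).symm
  have hpow : ∀ n s, ‖qPowAlg p s ^ p ^ (n * d) - 1‖ ≤ c ^ n := by
    intro n s
    have h1 := norm_qPowAlg_sub_le (p := p) (((p ^ (n * d) : ℕ) : ℤ_[p]) * s) 0
    rw [qPowAlg_nsmul, qPowAlg_zero, sub_zero, norm_mul] at h1
    refine h1.trans ((mul_le_of_le_one_right (norm_nonneg _) (PadicInt.norm_le_one s)).trans ?_)
    rw [← norm_natCast_padicAlgCl, Nat.cast_pow, norm_pow]
    exact (pow_le_pow_left₀ (norm_nonneg _) hpc _).trans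
      (pow_le_pow_of_le_one hc0 hc1.le (Nat.le_mul_of_pos_right n (Nat.pos_of_ne_zero hd0)))
  have hnorm : ∀ n s, ‖qPowAlg p s ^ p ^ (n * d)‖ ≤ 1 := fun n s => by
    rw [norm_pow, norm_qPowAlg, one_pow]
  -- The iterate is 1-Lipschitz and is evaluated at (1+q)^(s p^(nd)), which lies within c^n of 1.
  -- Hence the dependence on s disappears in the limit.
  have h1 : ∀ n m s, ‖P n m s - P n m 0‖ ≤ c ^ n := by
    intro n m s
    rw [hPe, hPe, qPowAlg_zero, one_pow]
    exact (((hb m).iterate_normOp _).norm_eval_sub_le (hnorm n s) norm_one.le).trans (hpow n s)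
  have h2 : ∀ n m, ‖P n m 0 - P (n + 1) m 0‖ ≤ c ^ n := by
    intro n m
    rw [hPe, hPe, qPowAlg_zero, one_pow, one_pow, norm_sub_rev, ← eval_sub, add_mul, one_mul]
    refine ((CoeffBound.iterate_normOp_sub hpc hc1.le hζc (hb m)
      (fun i => hdc _ (hf m i)) (n * d)).norm_eval_le (by positivity) norm_one.le).trans ?_
    exact pow_le_pow_of_le_one hc0 hc1.le
      ((Nat.le_mul_of_pos_right n (Nat.pos_of_ne_zero hd0)).trans (Nat.le_succ _))
  -- The estimates are uniform in m, so they survive the passage from the polynomials f_m to the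
  -- limit function F.
  have h1' : ∀ n s, ‖A n s - A n 0‖ ≤ c ^ n := fun n s =>
    le_of_tendsto ((hPA n s).sub (hPA n 0)).norm (Eventually.of_forall fun m => h1 n m s)
  have h2' : ∀ n, ‖A n 0 - A (n + 1) 0‖ ≤ c ^ n := fun n =>
    le_of_tendsto ((hPA n 0).sub (hPA (n + 1) 0)).norm (Eventually.of_forall fun m => h2 n m)
  have hAR : ∀ n, A n 0 ∈ R := fun n =>
    hR.isClosed.mem_of_tendsto (hPA n 0) (Eventually.of_forall fun m => by
      simp only [P, qPowAlg_zero, mul_one]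
      exact prod_eval_nthRootsFinset_mem (pow_ne_zero _ hp0) R (hf m))
  have hcau : CauchySeq fun n => A n 0 :=
    cauchySeq_of_le_geometric c 1 hc1 fun n => by rw [dist_eq_norm, one_mul]; exact h2' n
  obtain ⟨ℓ, hℓ, hlim⟩ := cauchySeq_tendsto_of_isComplete hR.isComplete hAR hcau
  refine ⟨ℓ, hℓ, fun s => ?_⟩
  have h3 : Tendsto (fun n => A n s - A n 0) atTop (𝓝 0) :=
    squeeze_zero_norm (h1' · s) (tendsto_pow_atTop_nhds_zero_of_lt_one hc0 hc1)
  simpa using h3.add hlim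

end PadicLimit

end

/-! ### Generalized Bernoulli numbers as p-adic limits of power sums. -/

noncomputable section

theorem Finset.sum_range_mul_eq {M : Type*} [AddCommMonoid M] (P k : ℕ) (f : ℕ → M) :
    ∑ a ∈ Finset.range (P * k), f a = ∑ j ∈ Finset.range k, ∑ b ∈ Finset.range P, f (b + P * j) := by
  induction k with
  | zero => simp
  | succ k ih =>
    rw [Nat.mul_succ, Finset.sum_range_add, Finset.sum_range_succ, ih]
    congr 1
    exact Finset.sum_congr rfl fun b _ => by rw [add_comm]

theorem Polynomial.sum_range_add_pow_eq_bernoulli_sub (x : ℚ) (n k : ℕ) :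
    (n + 1) * ∑ j ∈ Finset.range k, ((j : ℚ) + x) ^ n =
      (Polynomial.bernoulli (n + 1)).eval (x + k) - (Polynomial.bernoulli (n + 1)).eval x := by
  induction k with
  | zero => simp
  | succ k ih =>
    rw [Finset.sum_range_succ, mul_add, ih]
    have h := Polynomial.bernoulli_eval_one_add (n + 1) (x + k)
    have e : (1 + (x + k) : ℚ) = x + ((k + 1 : ℕ) : ℚ) := by push_cast; ring
    rw [e, Nat.add_sub_cancel] at h
    rw [h]
    push_cast
    ring

namespace PadicLimit

variable {p : ℕ} [hp : Fact p.Prime]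

/-- By the telescoped difference equation, the expression is 1/(n+1) times the difference quotient
of B_{n+1} at x with increment k_m → 0, and the derivative of B_{n+1} is (n+1)B_n. -/
theorem tendsto_sum_range_add_pow_div (x : ℚ) (n : ℕ) {k : ℕ → ℕ} (hk0 : ∀ᶠ m in atTop, k m ≠ 0)
    (hk : Tendsto (fun m => (k m : PadicAlgCl p)) atTop (𝓝 0)) :
    Tendsto (fun m => (∑ j ∈ Finset.range (k m), ((j : PadicAlgCl p) + x) ^ n) / k m) atTop
      (𝓝 (((Polynomial.bernoulli n).eval x : ℚ) : PadicAlgCl p)) := by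
  set Q := (Polynomial.bernoulli (n + 1)).map (algebraMap ℚ (PadicAlgCl p))
  have hQ : ∀ y : ℚ, Q.eval (y : PadicAlgCl p) =
      (((Polynomial.bernoulli (n + 1)).eval y : ℚ) : PadicAlgCl p) := by
    intro y
    have := Polynomial.eval_map_apply (p := Polynomial.bernoulli (n + 1))
      (f := algebraMap ℚ (PadicAlgCl p)) y
    rw [eq_ratCast, eq_ratCast] at this
    exact this
  have hd := Q.hasDerivAt (x : PadicAlgCl p)
  rw [hasDerivAt_iff_tendsto_slope_zero] at hd
  have hk' : Tendsto (fun m => (k m : PadicAlgCl p)) atTop (𝓝[≠] 0) := by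
    refine tendsto_nhdsWithin_iff.2 ⟨hk, ?_⟩
    filter_upwards [hk0] with m hm
    exact Nat.cast_ne_zero.2 hm
  have h1 := (hd.comp hk').const_mul ((n + 1 : PadicAlgCl p)⁻¹)
  have hn : (n + 1 : PadicAlgCl p) ≠ 0 := by exact_mod_cast n.succ_ne_zero
  have e1 : (n + 1 : PadicAlgCl p)⁻¹ * Q.derivative.eval (x : PadicAlgCl p) =
      (((Polynomial.bernoulli n).eval x : ℚ) : PadicAlgCl p) := by
    rw [Polynomial.derivative_map, Polynomial.derivative_bernoulli_add_one]
    have h3 : ((n : Polynomial ℚ) + 1) = Polynomial.C ((n : ℚ) + 1) := by simp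
    rw [h3, Polynomial.map_mul, Polynomial.map_C, Polynomial.eval_mul, Polynomial.eval_C]
    have := Polynomial.eval_map_apply (p := Polynomial.bernoulli n)
      (f := algebraMap ℚ (PadicAlgCl p)) x
    simp only [eq_ratCast] at this ⊢
    rw [this]
    push_cast
    rw [inv_mul_cancel_left₀ hn]
  rw [e1] at h1
  refine h1.congr fun m => ?_
  simp only [Function.comp_apply, smul_eq_mul]
  have h2 := congrArg (fun r : ℚ => (r : PadicAlgCl p))
    (Polynomial.sum_range_add_pow_eq_bernoulli_sub x n (k m))
  simp only [Rat.cast_sub, ← hQ] at h2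
  push_cast at h2
  rw [← h2]
  field_simp

/-- The generalized Bernoulli number of a function of period `P`. -/
def genBernoulli (P n : ℕ) (Φ : ℕ → PadicAlgCl p) : PadicAlgCl p :=
  (P : PadicAlgCl p) ^ n / P * ∑ b ∈ Finset.range P,
    Φ b * (((Polynomial.bernoulli n).eval ((b : ℚ) / P) : ℚ) : PadicAlgCl p)

theorem periodic_add_mul {α : Type*} {P : ℕ} {Φ : ℕ → α} (hΦ : ∀ b, Φ (b + P) = Φ b) (b j : ℕ) :
    Φ (b + P * j) = Φ b := by
  induction j with
  | zero => simp
  | succ j ih => rw [Nat.mul_succ, ← add_assoc, hΦ, ih]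

theorem periodic_of_modEq {α : Type*} {P : ℕ} {Φ : ℕ → α} (hΦ : ∀ b, Φ (b + P) = Φ b) {a b : ℕ}
    (h : a ≡ b [MOD P]) : Φ a = Φ b := by
  have key : ∀ c : ℕ, Φ c = Φ (c % P) := fun c => by
    conv_lhs => rw [← Nat.mod_add_div c P]
    exact periodic_add_mul hΦ _ _
  rw [key a, key b, h]

/-- Writing a = b + P j with b < P reduces to the unweighted power sums at x = b/P. -/
theorem tendsto_sum_mul_pow_div {P : ℕ} (n : ℕ) (hP : P ≠ 0) {Φ : ℕ → PadicAlgCl p}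
    (hΦ : ∀ b, Φ (b + P) = Φ b) {k : ℕ → ℕ} (hk0 : ∀ᶠ m in atTop, k m ≠ 0)
    (hk : Tendsto (fun m => (k m : PadicAlgCl p)) atTop (𝓝 0)) :
    Tendsto (fun m => (∑ a ∈ Finset.range (P * k m), Φ a * (a : PadicAlgCl p) ^ n) /
      ((P * k m : ℕ) : PadicAlgCl p)) atTop (𝓝 (genBernoulli P n Φ)) := by
  have hP' : (P : PadicAlgCl p) ≠ 0 := Nat.cast_ne_zero.2 hP
  have h1 := (tendsto_finsetSum (Finset.range P) fun b _ =>
    (tendsto_sum_range_add_pow_div (p := p) ((b : ℚ) / P) n hk0 hk).const_mul (Φ b)).const_mul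
      ((P : PadicAlgCl p) ^ n / P)
  refine h1.congr' ?_
  filter_upwards [hk0] with m hm
  have hm' : (k m : PadicAlgCl p) ≠ 0 := Nat.cast_ne_zero.2 hm
  rw [Finset.sum_range_mul_eq, Finset.sum_comm, Finset.mul_sum, Finset.sum_div]
  refine Finset.sum_congr rfl fun b _ => ?_
  have hsum : ∑ j ∈ Finset.range (k m), Φ (b + P * j) * ((b + P * j : ℕ) : PadicAlgCl p) ^ n =
      (Φ b * (P : PadicAlgCl p) ^ n) *
        ∑ j ∈ Finset.range (k m), ((j : PadicAlgCl p) + ((b : ℚ) / P : ℚ)) ^ n := by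
    rw [Finset.mul_sum]
    refine Finset.sum_congr rfl fun j _ => ?_
    rw [periodic_add_mul hΦ, mul_assoc, ← mul_pow]
    congr 2
    push_cast
    field_simp
    ring
  rw [hsum]
  rw [Nat.cast_mul]
  field_simp

theorem sum_range_eq_sum_zmod {M : Type*} [AddCommMonoid M] (Q : ℕ) [NeZero Q] (G : ℕ → M) :
    ∑ a ∈ Finset.range Q, G a = ∑ x : ZMod Q, G x.val := by
  refine Finset.sum_bij' (fun a _ => (a : ZMod Q)) (fun x _ => x.val) (fun _ _ => Finset.mem_univ _)
    (fun x _ => Finset.mem_range.2 (ZMod.val_lt x)) ?_ (fun x _ => by simp) ?_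
  · intro a ha; exact ZMod.val_natCast_of_lt (Finset.mem_range.1 ha)
  · intro a ha; simp only [ZMod.val_natCast_of_lt (Finset.mem_range.1 ha)]

/-- The sum of a periodic function over a full period is invariant under multiplication by a number
prime to the period. -/
theorem sum_range_mul_of_periodic {M : Type*} [AddCommMonoid M] {Q b : ℕ} (hQ : Q ≠ 0)
    (hb : b.Coprime Q) {F : ℕ → M} (hF : ∀ a, F (a + Q) = F a) :
    ∑ a ∈ Finset.range Q, F (b * a) = ∑ a ∈ Finset.range Q, F a := by
  have : NeZero Q := ⟨hQ⟩
  rw [sum_range_eq_sum_zmod, sum_range_eq_sum_zmod]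
  have h := Equiv.sum_comp (Units.mulLeft (ZMod.unitOfCoprime b hb)) fun x : ZMod Q => F x.val
  rw [← h]
  refine Finset.sum_congr rfl fun x _ => ?_
  refine periodic_of_modEq hF ?_
  rw [← ZMod.natCast_eq_natCast_iff]
  simp

end PadicLimit

end

/-! ### Primitive characters of products, algebraicity of L-values, values of layer characters. -/

noncomputable section

namespace DirichletCharacter

set_option linter.unusedSectionVars false

variable {R : Type*} [CommRing R] [Nontrivial R] {N : ℕ}

theorem apply_natCast_eq_zero_iff (χ : DirichletCharacter R N) (a : ℕ) :
    χ (a : ZMod N) = 0 ↔ ¬ a.Coprime N := by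
  rw [← ZMod.isUnit_iff_coprime, ← not_iff_not, not_not]
  exact MulChar.apply_ne_zero_iff

theorem changeLevel_natCast {M : ℕ} (h : N ∣ M) (χ : DirichletCharacter R N) {a : ℕ}
    (ha : a.Coprime M) : changeLevel h χ (a : ZMod M) = χ (a : ZMod N) := by
  have := changeLevel_eq_cast_of_dvd' χ h (a := (a : ℤ)) (Nat.isCoprime_iff_coprime.2 ha)
  simpa using this

theorem primitiveCharacter_natCast (χ : DirichletCharacter R N) {a : ℕ} (ha : a.Coprime N) :
    χ.primitiveCharacter (a : ZMod _) = χ (a : ZMod N) := by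
  have := χ.primitiveCharacter_apply_of_isCoprime (a := (a : ℤ)) (Nat.isCoprime_iff_coprime.2 ha)
  simpa using this

theorem primitiveCharacter_changeLevel_natCast {M : ℕ} [NeZero M] (h : N ∣ M)
    (χ : DirichletCharacter R N) (a : ℕ) :
    (changeLevel h χ).primitiveCharacter (a : ZMod _) = χ.primitiveCharacter (a : ZMod _) := by
  have := primitiveCharacter_changeLevel_apply h χ (a : ℤ)
  simpa using this

variable {P M : ℕ}

theorem mul_changeLevel_eq (χ : DirichletCharacter R N) (ρ : DirichletCharacter R P)
    (hN : N ∣ M) (hP : P ∣ M) :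
    changeLevel (Nat.lcm_dvd ((conductor_dvd_level χ).trans hN) hP)
      (mul χ.primitiveCharacter ρ) = changeLevel hN χ * changeLevel hP ρ := by
  have h1 := changeLevel_trans χ.primitiveCharacter χ.conductor_dvd_level hN
  rw [changeLevel_primitiveCharacter] at h1
  rw [mul, map_mul, ← changeLevel_trans, ← changeLevel_trans, ← h1]

theorem conductor_mul_changeLevel_dvd [NeZero M] (χ : DirichletCharacter R N)
    (ρ : DirichletCharacter R P) (hN : N ∣ M) (hP : P ∣ M) :
    (changeLevel hN χ * changeLevel hP ρ).conductor ∣ Nat.lcm χ.conductor P := by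
  rw [← mul_changeLevel_eq, conductor_changeLevel]
  exact conductor_dvd_level _

/-- The primitive character attached to the product of `χ` by a character `ρ` of prime power
modulus. -/
theorem primitiveCharacter_mul_changeLevel [NeZero M] {p e : ℕ} [hp : Fact p.Prime]
    (χ : DirichletCharacter R N) (ρ : DirichletCharacter R P) (hN : N ∣ M) (hP : P ∣ M)
    (hPp : P = p ^ e) {a : ℕ} (ha : ¬ p ∣ a) :
    (changeLevel hN χ * changeLevel hP ρ).primitiveCharacter (a : ZMod _) =
      χ.primitiveCharacter (a : ZMod _) * ρ (a : ZMod P) := by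
  have haP : a.Coprime P := by
    rw [hPp]; exact Nat.Coprime.pow_right _ ((Nat.Prime.coprime_iff_not_dvd hp.out).2 ha).symm
  by_cases hf : a.Coprime χ.conductor
  · have haL : a.Coprime (Nat.lcm χ.conductor P) :=
      Nat.Coprime.of_dvd_right (Nat.lcm_dvd_mul _ _) (hf.mul_right haP)
    rw [← mul_changeLevel_eq, primitiveCharacter_changeLevel_natCast,
      primitiveCharacter_natCast _ haL, mul, MulChar.mul_apply, changeLevel_natCast _ _ haL,
      changeLevel_natCast _ _ haL]
  -- The product cannot become nonzero at a: χ is recovered as Θρ⁻¹, so the conductor of χ divides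
  -- lcm(cond Θ, P), and a is prime to P.
  · rw [(apply_natCast_eq_zero_iff _ _).2 hf, zero_mul, apply_natCast_eq_zero_iff]
    set Θ := changeLevel hN χ * changeLevel hP ρ
    have h1 : changeLevel hN χ = changeLevel (dvd_refl M) Θ * changeLevel hP ρ⁻¹ := by
      rw [changeLevel_self, map_inv, mul_inv_cancel_right]
    have h2 : χ.conductor ∣ Nat.lcm Θ.conductor P := by
      rw [← conductor_changeLevel χ hN, h1]
      exact conductor_mul_changeLevel_dvd _ _ _ _
    intro h3
    exact hf (Nat.Coprime.of_dvd_right (h2.trans (Nat.lcm_dvd_mul _ _)) (h3.mul_right haP))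

end DirichletCharacter

namespace PadicLimit

open DirichletCharacter

variable {p : ℕ} [hp : Fact p.Prime]

theorem conductorQ_mul_pow (p n : ℕ) : conductorQ p * p ^ n = p ^ (n + 1 + delta p) := by
  rw [conductorQ, ← pow_add]; congr 1; ring

/-! ### Values at negative integers -/

/-- Nonzero values are roots of unity of order dividing φ(M), and all of these come from the
algebraically closed field A. -/
theorem exists_ringHomComp_eq {A B : Type*} [Field A] [Field B] [IsAlgClosed A] [CharZero A]
    (ι : A →+* B) {M : ℕ} [NeZero M] (η : DirichletCharacter B M) :
    ∃ η' : DirichletCharacter A M, η'.ringHomComp ι = η := by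
  have hφ : M.totient ≠ 0 := (Nat.totient_pos.2 (Nat.pos_of_ne_zero (NeZero.ne M))).ne'
  have : NeZero (M.totient : A) := ⟨by exact_mod_cast hφ⟩
  have : NeZero M.totient := ⟨hφ⟩
  obtain ⟨ω, hω⟩ := HasEnoughRootsOfUnity.exists_primitiveRoot A M.totient
  have hω' := hω.map_of_injective ι.injective
  have key : ∀ a, ∃ z, ι z = η a := by
    intro a
    by_cases ha : IsUnit a
    · have h1 : η a ^ M.totient = 1 := by
        have h := congrArg Units.val (ZMod.pow_totient ha.unit)
        rw [Units.val_pow_eq_pow_val, IsUnit.unit_spec, Units.val_one] at h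
        rw [← map_pow, h, map_one]
      obtain ⟨i, _, hi⟩ := hω'.eq_pow_of_pow_eq_one h1
      exact ⟨ω ^ i, by rw [map_pow, hi]⟩
    · exact ⟨0, by rw [map_zero, MulChar.map_nonunit _ ha]⟩
  choose g hg using key
  refine ⟨{ toFun := g, map_one' := ?_, map_mul' := fun a b => ?_, map_nonunit' := fun a ha => ?_ }, ?_⟩
  · apply ι.injective; rw [hg, map_one, map_one]
  · apply ι.injective; rw [hg, map_mul, map_mul, hg, hg]
  · apply ι.injective; rw [hg, map_zero, MulChar.map_nonunit _ ha]
  · ext a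
    exact hg a

/-- The value -B_{n,η}/n is a rational expression in the values of η, so one element of ℚ̄ maps to
both the complex and the p-adic value. -/
theorem isLValue_genBernoulli (ιinf : AlgebraicClosure ℚ →+* ℂ)
    (ιp : AlgebraicClosure ℚ →+* PadicAlgCl p) {M : ℕ} [NeZero M]
    (η : DirichletCharacter (PadicAlgCl p) M) {n : ℕ} (hn : 1 ≤ n) (h : M ≠ 1 ∨ n ≠ 1) :
    IsLValue ιinf ιp η (1 - (n : ℤ)) (-(genBernoulli M n (fun a => η (a : ZMod M)) / n)) := by
  obtain ⟨η', rfl⟩ := exists_ringHomComp_eq ιp η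
  refine ⟨η', -((M : AlgebraicClosure ℚ) ^ (n - 1) / n) *
    ∑ j : ZMod M, η' j * (((Polynomial.bernoulli n).eval ((j.val : ℚ) / M) : ℚ) :
      AlgebraicClosure ℚ), rfl, ?_, ?_⟩
  · have := LFunction_one_sub_natCast (η'.ringHomComp ιinf) hn h
    push_cast
    rw [this]
    simp
  · rw [genBernoulli, sum_range_eq_sum_zmod]
    simp only [map_mul, map_neg, map_div₀, map_pow, map_natCast, map_sum, map_ratCast,
      MulChar.ringHomComp_apply, ZMod.natCast_val, ZMod.cast_id', id]
    obtain ⟨l, rfl⟩ := Nat.exists_eq_add_of_le' hn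
    have hM : (M : PadicAlgCl p) ≠ 0 := Nat.cast_ne_zero.2 (NeZero.ne M)
    rw [Nat.add_sub_cancel, pow_succ]
    field_simp

/-! ### The characters of the layers -/

theorem modEq_of_pow_dvd_sub {a b e : ℕ} (h : (p : ℤ_[p]) ^ e ∣ (a : ℤ_[p]) - b) :
    a ≡ b [MOD p ^ e] := by
  have h1 : (p : ℤ_[p]) ^ e ∣ (((b : ℤ) - a : ℤ) : ℤ_[p]) := by
    push_cast; rw [← neg_sub, dvd_neg]; exact h
  rw [PadicInt.pow_p_dvd_int_iff] at h1
  rw [Nat.modEq_iff_dvd]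
  exact_mod_cast h1

theorem conductorQ_mul_pow_cast (p n : ℕ) [Fact p.Prime] :
    (conductorQ p : ℤ_[p]) * (p : ℤ_[p]) ^ n = (p : ℤ_[p]) ^ (n + 1 + delta p) := by
  have := congrArg (Nat.cast : ℕ → ℤ_[p]) (conductorQ_mul_pow p n)
  simpa using this

theorem dvd_angle_sub {a b n : ℕ} (ha : ¬ p ∣ a) (hb : ¬ p ∣ b)
    (h : (p : ℤ_[p]) ^ n ∣ angleLog p a - angleLog p b) :
    (p : ℤ_[p]) ^ (n + 1 + delta p) ∣ angle p a - angle p b := by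
  rw [padicInt_dvd_iff_norm_le] at h ⊢
  rw [← norm_angleLog_sub ha hb, ← conductorQ_mul_pow_cast, norm_mul]
  exact mul_le_mul_of_nonneg_left h (norm_nonneg _)

theorem angleLog_one : angleLog p 1 = 0 := by
  have h1 : ¬ p ∣ 1 := fun h => hp.out.one_lt.ne' (Nat.dvd_one.1 h)
  have := angleLog_mul h1 h1
  rw [mul_one] at this
  exact left_eq_add.1 this

theorem not_dvd_pow {a : ℕ} (ha : ¬ p ∣ a) (i : ℕ) : ¬ p ∣ a ^ i := fun h =>
  ha (hp.out.dvd_of_dvd_pow h)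

theorem angleLog_pow {a : ℕ} (ha : ¬ p ∣ a) (i : ℕ) : angleLog p (a ^ i) = i * angleLog p a := by
  induction i with
  | zero => rw [pow_zero, angleLog_one]; simp
  | succ i ih =>
    rw [pow_succ, angleLog_mul (not_dvd_pow ha i) ha, ih]; push_cast; ring

theorem teich_pow (a i : ℕ) : teich p (a ^ i) = teich p a ^ i := by
  rw [teich, teich, Nat.cast_pow, map_pow]

theorem teich_one_add_conductorQ_pow (i : ℕ) : teich p ((1 + conductorQ p) ^ i) = 1 := by
  rw [teich_pow, teich_eq_one (by simp [Nat.ModEq]), one_pow]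

theorem mem_layerChars {n : ℕ} {ψ : DirichletCharacter (PadicAlgCl p) (p ^ (n + 1 + delta p))} :
    ψ ∈ layerChars p n ↔ ψ.Even ∧ ψ ^ p ^ n = 1 := by
  simp [layerChars]

theorem isUnit_natCast_pow {a e : ℕ} (ha : ¬ p ∣ a) : IsUnit (a : ZMod (p ^ e)) :=
  (ZMod.isUnit_iff_coprime _ _).2
    (Nat.Coprime.pow_right _ ((Nat.Prime.coprime_iff_not_dvd hp.out).2 ha).symm)

/-- Modulo q p^n one has a ≡ ω(a)(1+q)^i, and ψ does not see ω(a). For p = 2, ω(a) = ±1 and ψ is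
even. For odd p, the ratio of the two values of ψ has order dividing both p - 1 and p^n. -/
theorem layerChars_apply {n : ℕ} {ψ : DirichletCharacter (PadicAlgCl p) (p ^ (n + 1 + delta p))}
    (hψ : ψ ∈ layerChars p n) {a i : ℕ} (ha : ¬ p ∣ a)
    (hi : (p : ℤ_[p]) ^ n ∣ angleLog p a - i) :
    ψ (a : ZMod _) = ψ ((1 + conductorQ p : ℕ) : ZMod _) ^ i := by
  obtain ⟨heven, hpow⟩ := mem_layerChars.1 hψ
  set b := (1 + conductorQ p) ^ i
  have hb : ¬ p ∣ b := not_dvd_pow (not_dvd_one_add_conductorQ p) i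
  have hlb : angleLog p b = i := by
    rw [angleLog_pow (not_dvd_one_add_conductorQ p), angleLog_one_add_conductorQ, mul_one]
  have hd := dvd_angle_sub ha hb (by rw [hlb]; exact hi)
  have hbb : angle p b = b := by
    have := teich_mul_angle hb
    rwa [teich_one_add_conductorQ_pow, one_mul] at this
  have hcong : (p : ℤ_[p]) ^ (n + 1 + delta p) ∣ (a : ℤ_[p]) - teich p a * b := by
    rw [← teich_mul_angle ha, ← mul_sub, ← hbb]
    exact hd.mul_left _
  have hψb : ψ ((1 + conductorQ p : ℕ) : ZMod _) ^ i = ψ (b : ZMod _) := by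
    rw [← map_pow, ← Nat.cast_pow]
  rw [hψb]
  have hu := isUnit_natCast_pow (p := p) (e := n + 1 + delta p) hb
  by_cases hp2 : p = 2
  · have htot : (conductorQ p).totient = 2 := by
      subst hp2; simp [conductorQ, delta]; rfl
    have ht := teich_pow_totient ha
    rw [htot] at ht
    rw [sq] at ht
    rcases mul_self_eq_one_iff.1 ht with h1 | h1
    · rw [h1, one_mul] at hcong
      rw [(ZMod.natCast_eq_natCast_iff _ _ _).2 (modEq_of_pow_dvd_sub hcong)]
    · have h2 : (a : ZMod (p ^ (n + 1 + delta p))) = -(b : ZMod _) := by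
        have h3 : (p : ℤ_[p]) ^ (n + 1 + delta p) ∣ ((a + b : ℕ) : ℤ_[p]) - (0 : ℕ) := by
          rw [h1] at hcong
          convert hcong using 1
          push_cast; ring
        have h4 := (ZMod.natCast_eq_natCast_iff _ _ _).2 (modEq_of_pow_dvd_sub h3)
        rw [Nat.cast_add, Nat.cast_zero] at h4
        exact eq_neg_of_add_eq_zero_left h4
      rw [h2]
      exact DirichletCharacter.Even.eval_neg ψ _ heven
  · have htot : (conductorQ p).totient = p - 1 := by
      simp [conductorQ, delta, hp2, Nat.totient_prime hp.out]
    have ht := teich_pow_totient ha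
    rw [htot] at ht
    have h1 : (p : ℤ_[p]) ^ (n + 1 + delta p) ∣ ((a ^ (p - 1) : ℕ) : ℤ_[p]) - (b ^ (p - 1) : ℕ) := by
      have h2 := hcong.trans (sub_dvd_pow_sub_pow _ _ (p - 1))
      rw [mul_pow, ht, one_mul] at h2
      exact_mod_cast h2
    have h2 := congrArg ψ ((ZMod.natCast_eq_natCast_iff _ _ _).2 (modEq_of_pow_dvd_sub h1))
    rw [Nat.cast_pow, Nat.cast_pow, map_pow, map_pow] at h2
    have hb0 : ψ (b : ZMod _) ≠ 0 := (hu.map ψ).ne_zero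
    have hpw : ∀ c : ℕ, ¬ p ∣ c → ψ (c : ZMod _) ^ p ^ n = 1 := by
      intro c hc
      have hc' := isUnit_natCast_pow (p := p) (e := n + 1 + delta p) hc
      rw [← MulChar.pow_apply' ψ (pow_ne_zero _ hp.out.ne_zero), hpow, MulChar.one_apply hc']
    have hx1 : (ψ (a : ZMod _) / ψ (b : ZMod _)) ^ (p - 1) = 1 := by
      rw [div_pow, h2, div_self (pow_ne_zero _ hb0)]
    have hx2 : (ψ (a : ZMod _) / ψ (b : ZMod _)) ^ p ^ n = 1 := by
      rw [div_pow, hpw a ha, hpw b hb, div_one]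
    have hcop : Nat.Coprime (p - 1) (p ^ n) := by
      refine Nat.Coprime.pow_right _ ?_
      have : p = (p - 1) + 1 := (Nat.succ_pred_eq_of_pos hp.out.pos).symm
      rw [this, Nat.add_sub_cancel]
      simp
    have hx := pow_gcd_eq_one.2 ⟨hx1, hx2⟩
    rw [hcop.gcd_eq_one, pow_one, div_eq_one_iff_eq hb0] at hx
    exact hx

end PadicLimit

end

/-! ### Layer characters as p-power roots of unity, and twists by powers of ω. -/

noncomputable section

open Polynomial

namespace PadicLimit

open DirichletCharacter

variable {p : ℕ} [hp : Fact p.Prime]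

theorem pow_dvd_sub_appr (x : ℤ_[p]) (n : ℕ) : (p : ℤ_[p]) ^ n ∣ x - x.appr n :=
  Ideal.mem_span_singleton.1 (PadicInt.appr_spec n x)

/-- If `x ≡ i` modulo `p^n`, then `appr n x ≡ i` modulo `p^n`. -/
theorem appr_modEq {x : ℤ_[p]} {n i : ℕ} (h : (p : ℤ_[p]) ^ n ∣ x - i) :
    x.appr n ≡ i [MOD p ^ n] := by
  apply modEq_of_pow_dvd_sub
  have := dvd_sub h (pow_dvd_sub_appr x n)
  rwa [sub_sub_sub_cancel_left] at this

theorem pow_eq_pow_of_modEq' {K : Type*} [Monoid K] {ζ : K} {n i j : ℕ} (hζ : ζ ^ n = 1)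
    (h : i ≡ j [MOD n]) : ζ ^ i = ζ ^ j := pow_eq_pow_of_modEq h hζ

theorem natCast_val_modEq {N : ℕ} [NeZero N] (a : ℕ) : ((a : ZMod N)).val ≡ a [MOD N] := by
  rw [ZMod.val_natCast]; exact Nat.mod_modEq _ _

theorem isUnit_iff_not_dvd_val {e : ℕ} (he : e ≠ 0) (x : ZMod (p ^ e)) : IsUnit x ↔ ¬ p ∣ x.val := by
  have h := ZMod.isUnit_iff_coprime x.val (p ^ e)
  rw [ZMod.natCast_val, ZMod.cast_id', id] at h
  rw [h, Nat.coprime_pow_right_iff (Nat.pos_of_ne_zero he), Nat.coprime_comm,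
    Nat.Prime.coprime_iff_not_dvd hp.out]

/-- -ω(b) is a root of unity congruent to 1 modulo q, and 1 + q ℤ_p is torsion free. -/
theorem teich_eq_neg_one {b : ℕ} (h : (conductorQ p : ℤ_[p]) ∣ (b : ℤ_[p]) + 1) (hb : ¬ p ∣ b) :
    teich p b = -1 := by
  have h1 : (conductorQ p : ℤ_[p]) ∣ (-teich p b) - 1 := by
    have := dvd_add (dvd_teich_sub hb) h
    rw [← dvd_neg]
    convert this using 1
    ring
  have h2 : (-teich p b) ^ (2 * (conductorQ p).totient) = 1 := by
    rw [pow_mul, neg_sq, ← pow_mul, mul_comm, pow_mul, teich_pow_totient hb, one_pow]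
  have hq : (conductorQ p).totient ≠ 0 :=
    (Nat.totient_pos.2 (Nat.pos_of_ne_zero (NeZero.ne _))).ne'
  have := eq_one_of_pow_eq_one h1 (by positivity) h2
  rw [← this, neg_neg]

/-- Here ω(b) = -1, so ⟨b⟩ = -b is close to 1. This gives the evenness of the character built from a
root of unity. -/
theorem dvd_angleLog_of_modEq_neg_one {b n : ℕ} (hb : ¬ p ∣ b)
    (h : (conductorQ p : ℤ_[p]) * (p : ℤ_[p]) ^ n ∣ (b : ℤ_[p]) + 1) :
    (p : ℤ_[p]) ^ n ∣ angleLog p b := by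
  have h1 : ¬ p ∣ 1 := fun h => hp.out.one_lt.ne' (Nat.dvd_one.1 h)
  have ht := teich_eq_neg_one ((dvd_mul_right _ _).trans h) hb
  have ha1 : angle p 1 = 1 := by
    have := teich_mul_angle h1
    rwa [teich_eq_one (Nat.ModEq.refl 1), one_mul, Nat.cast_one] at this
  have hab := teich_mul_angle hb
  have e : angle p b - angle p 1 = -((b : ℤ_[p]) + 1) := by
    rw [ha1, ← hab, ht]; ring
  have h2 := norm_angleLog_sub hb h1
  rw [angleLog_one, sub_zero, e, norm_neg] at h2
  rw [padicInt_dvd_iff_norm_le] at h ⊢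
  rw [← h2, norm_mul] at h
  exact le_of_mul_le_mul_left h (lt_of_le_of_ne (norm_nonneg _) (norm_conductorQ_ne_zero p).symm)

/-- The character of the `n`-th layer sending `1 + q` to a given root of unity. -/
theorem exists_layerChars_apply_eq {n : ℕ} {ζ : PadicAlgCl p} (hζ : ζ ^ p ^ n = 1) :
    ∃ ψ ∈ layerChars p n, ψ ((1 + conductorQ p : ℕ) : ZMod _) = ζ := by
  classical
  have hp0 := hp.out.ne_zero
  have he : n + 1 + delta p ≠ 0 := by omega
  have hζ0 : ζ ≠ 0 := by
    rintro rfl; rw [zero_pow (pow_ne_zero _ hp0)] at hζ; exact zero_ne_one hζ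
  have hval : ∀ {a : ℕ} {x : ZMod (p ^ (n + 1 + delta p))}, ¬ p ∣ x.val →
      x.val ≡ a [MOD p ^ (n + 1 + delta p)] →
      (p : ℤ_[p]) ^ n ∣ angleLog p x.val - angleLog p a := by
    intro a x hx h
    exact dvd_angleLog_sub hx (by rw [conductorQ_mul_pow]; exact h)
  -- The character is x ↦ ζ^(log⟨x⟩). The exponent matters only modulo p^n, where the logarithm is
  -- well defined on classes modulo q p^n and additive.
  let g : ZMod (p ^ (n + 1 + delta p)) → PadicAlgCl p := fun x =>
    if IsUnit x then ζ ^ (angleLog p x.val).appr n else 0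
  have hg : ∀ {x : ZMod (p ^ (n + 1 + delta p))}, IsUnit x → ∀ {i : ℕ},
      (p : ℤ_[p]) ^ n ∣ angleLog p x.val - i → g x = ζ ^ i := by
    intro x hx i hi
    simp only [g, if_pos hx]
    exact pow_eq_pow_of_modEq' hζ (appr_modEq hi)
  let ψ : DirichletCharacter (PadicAlgCl p) (p ^ (n + 1 + delta p)) :=
    { toFun := g
      map_one' := by
        have h1 : ¬ p ∣ (1 : ZMod (p ^ (n + 1 + delta p))).val :=
          (isUnit_iff_not_dvd_val he _).1 isUnit_one
        rw [hg isUnit_one (i := 0), pow_zero]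
        have h2 := hval (a := 1) h1 (by
          have := natCast_val_modEq (N := p ^ (n + 1 + delta p)) 1
          rwa [Nat.cast_one] at this)
        rw [angleLog_one] at h2
        simpa using h2
      map_mul' := fun x y => by
        by_cases hx : IsUnit x
        · by_cases hy : IsUnit y
          · have hx' := (isUnit_iff_not_dvd_val he _).1 hx
            have hy' := (isUnit_iff_not_dvd_val he _).1 hy
            have hxy := (isUnit_iff_not_dvd_val he _).1 (hx.mul hy)
            have h1 := hval (a := x.val * y.val) hxy (by rw [ZMod.val_mul]; exact Nat.mod_modEq _ _)
            rw [angleLog_mul hx' hy'] at h1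
            have h2 := dvd_add h1 (dvd_add (pow_dvd_sub_appr (angleLog p x.val) n)
              (pow_dvd_sub_appr (angleLog p y.val) n))
            rw [hg (hx.mul hy) (i := (angleLog p x.val).appr n + (angleLog p y.val).appr n),
              pow_add]
            · simp only [g, if_pos hx, if_pos hy]
            · convert h2 using 1
              push_cast; ring
          · simp [g, hy]
        · simp [g, hx]
      map_nonunit' := fun x hx => by simp [g, hx] }
  have hψ : ∀ x, ψ x = g x := fun _ => rfl
  refine ⟨ψ, mem_layerChars.2 ⟨?_, ?_⟩, ?_⟩
  · have hu : IsUnit (-1 : ZMod (p ^ (n + 1 + delta p))) := isUnit_one.neg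
    have h1 := (isUnit_iff_not_dvd_val he _).1 hu
    change ψ (-1) = 1
    rw [hψ, hg hu (i := 0), pow_zero]
    rw [Nat.cast_zero, sub_zero]
    refine dvd_angleLog_of_modEq_neg_one h1 ?_
    rw [conductorQ_mul_pow_cast]
    have h2 : (-1 : ZMod (p ^ (n + 1 + delta p))).val + 1 ≡ 0 [MOD p ^ (n + 1 + delta p)] := by
      rw [← ZMod.natCast_eq_natCast_iff]; simp
    have h3 := natCast_dvd_sub_of_modEq (p := p) h2
    simpa using h3
  · ext x
    rw [MulChar.pow_apply_coe, MulChar.one_apply_coe, hψ]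
    simp only [g, if_pos x.isUnit]
    rw [← pow_mul, mul_comm, pow_mul, hζ, one_pow]
  · have hu := isUnit_natCast_pow (p := p) (e := n + 1 + delta p) (not_dvd_one_add_conductorQ p)
    rw [hψ, hg hu (i := 1), pow_one]
    have h1 := hval ((isUnit_iff_not_dvd_val he _).1 hu) (natCast_val_modEq _)
    rwa [angleLog_one_add_conductorQ] at h1

/-- Evaluation at `1 + q` identifies the characters of the `n`-th layer with the `p^n`-th roots of
unity. -/
theorem prod_layerChars (n : ℕ) (h : PadicAlgCl p → PadicAlgCl p) :
    ∏ ψ ∈ layerChars p n, h (ψ ((1 + conductorQ p : ℕ) : ZMod _)) =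
      ∏ ζ ∈ nthRootsFinset (p ^ n) (1 : PadicAlgCl p), h ζ := by
  have hp0 := hp.out.ne_zero
  refine Finset.prod_bij (fun ψ _ => ψ ((1 + conductorQ p : ℕ) : ZMod _)) ?_ ?_ ?_ ?_
  · intro ψ hψ
    rw [mem_nthRootsFinset_one (pow_ne_zero _ hp0), ← MulChar.pow_apply' ψ (pow_ne_zero _ hp0),
      (mem_layerChars.1 hψ).2, MulChar.one_apply (isUnit_natCast_pow (not_dvd_one_add_conductorQ p))]
  · intro ψ hψ ψ' hψ' h
    ext x
    have hx := (isUnit_iff_not_dvd_val (p := p) (by omega) (x : ZMod (p ^ (n + 1 + delta p)))).1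
      x.isUnit
    have h1 := layerChars_apply hψ hx (pow_dvd_sub_appr _ n)
    have h2 := layerChars_apply hψ' hx (pow_dvd_sub_appr _ n)
    rw [h, ← h2] at h1
    simpa using h1
  · intro ζ hζ
    rw [mem_nthRootsFinset_one (pow_ne_zero _ hp0)] at hζ
    obtain ⟨ψ, hψ, h⟩ := exists_layerChars_apply_eq hζ
    exact ⟨ψ, hψ, h⟩
  · intro ψ _; rfl

/-! ### The twists -/

theorem teichmullerCharAlg_inv_pow_apply (n a : ℕ) (hn : n ≠ 0) :
    ((teichmullerCharAlg p)⁻¹ ^ n) (a : ZMod (conductorQ p)) * (a : PadicAlgCl p) ^ n =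
      algebraMap ℤ_[p] (PadicAlgCl p) (angle p a) ^ n := by
  have h : (teichmullerCharAlg p)⁻¹ = (teichmullerChar p)⁻¹.ringHomComp
      (algebraMap ℤ_[p] (PadicAlgCl p)) := by
    rw [teichmullerCharAlg, MulChar.ringHomComp_inv]
  rw [h, MulChar.pow_apply' _ hn, ← mul_pow, MulChar.ringHomComp_apply, angle, map_mul,
    map_natCast (algebraMap ℤ_[p] (PadicAlgCl p))]

variable {N : ℕ}

theorem conductorQ_dvd_pow (p k : ℕ) : conductorQ p ∣ p ^ (k + 1 + delta p) :=
  Dvd.intro _ (conductorQ_mul_pow p k)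

/-- Grouping ψ and ω⁻ⁿ into one character of p-power modulus allows the description of primitive
products at integers prime to p to be applied once. -/
theorem mul_mul_eq_mul_changeLevel (χ : DirichletCharacter (PadicAlgCl p) N) {k : ℕ}
    (ψ : DirichletCharacter (PadicAlgCl p) (p ^ (k + 1 + delta p))) (n : ℕ) :
    mul (mul χ ψ) ((teichmullerCharAlg p)⁻¹ ^ n) =
      changeLevel ((Nat.dvd_lcm_left N _).trans (Nat.dvd_lcm_left _ _)) χ *
        changeLevel ((Nat.dvd_lcm_right N _).trans (Nat.dvd_lcm_left _ _))
          (ψ * changeLevel (conductorQ_dvd_pow p k) ((teichmullerCharAlg p)⁻¹ ^ n)) := by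
  rw [mul, mul, map_mul, map_mul, ← changeLevel_trans, ← changeLevel_trans, ← changeLevel_trans,
    mul_assoc]

variable [NeZero N]

theorem twist_apply (χ : DirichletCharacter (PadicAlgCl p) N) {k : ℕ}
    (ψ : DirichletCharacter (PadicAlgCl p) (p ^ (k + 1 + delta p))) (n : ℕ) {a : ℕ} (ha : ¬ p ∣ a) :
    twist (mul χ ψ) n (a : ZMod _) = χ.primitiveCharacter (a : ZMod _) * (ψ (a : ZMod _) *
      ((teichmullerCharAlg p)⁻¹ ^ n) (a : ZMod (conductorQ p))) := by
  rw [twist, primitive_mul, mul_mul_eq_mul_changeLevel, primitiveCharacter_mul_changeLevel _ _ _ _ rfl ha,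
    MulChar.mul_apply, changeLevel_natCast]
  exact Nat.Coprime.pow_right _ ((Nat.Prime.coprime_iff_not_dvd hp.out).2 ha).symm

theorem conductor_twist_dvd (χ : DirichletCharacter (PadicAlgCl p) N) {k : ℕ}
    (ψ : DirichletCharacter (PadicAlgCl p) (p ^ (k + 1 + delta p))) (n : ℕ) :
    (mul (mul χ ψ) ((teichmullerCharAlg p)⁻¹ ^ n)).conductor ∣
      Nat.lcm χ.conductor (p ^ (k + 1 + delta p)) := by
  rw [mul_mul_eq_mul_changeLevel]
  exact conductor_mul_changeLevel_dvd _ _ _ _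

end PadicLimit

end

noncomputable section

open Polynomial

namespace PadicLimit

open DirichletCharacter

variable {p : ℕ} [hp : Fact p.Prime]

/-! ### Stickelberger polynomials -/

/-- The modulus `d q p^m`. -/
def stickModulus (p d m : ℕ) : ℕ := d * conductorQ p * p ^ m

/-- Representatives of the classes prime to `p` modulo `d q p^m`; if `p = 2`, only those which are
`1` modulo `4`. -/
def stickIndex (p d m : ℕ) : Finset ℕ :=
  (Finset.range (stickModulus p d m)).filter fun a => ¬ p ∣ a ∧ (p = 2 → a % 4 = 1)

/-- The natural number `i < p^m` with `⟨a⟩ ≡ (1 + q)^i` modulo `q p^m`. -/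
def angleIdx (p : ℕ) [Fact p.Prime] (m a : ℕ) : ℕ := (angleLog p a).appr m

theorem angleIdx_lt (m a : ℕ) : angleIdx p m a < p ^ m := PadicInt.appr_lt _ _

theorem pow_dvd_angleLog_sub_angleIdx (m a : ℕ) :
    (p : ℤ_[p]) ^ m ∣ angleLog p a - angleIdx p m a := pow_dvd_sub_appr _ _

theorem angleIdx_eq_of_modEq {m a i : ℕ} (h : (p : ℤ_[p]) ^ m ∣ angleLog p a - i) :
    angleIdx p m a = i % p ^ m := by
  have := appr_modEq h
  rw [Nat.ModEq] at this
  rw [← this, Nat.mod_eq_of_lt (PadicInt.appr_lt _ _)]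
  rfl

theorem angleIdx_congr {m a b : ℕ} (h : (p : ℤ_[p]) ^ m ∣ angleLog p a - angleLog p b) :
    angleIdx p m a = angleIdx p m b := by
  rw [angleIdx_eq_of_modEq (i := angleIdx p m b), Nat.mod_eq_of_lt (angleIdx_lt _ _)]
  have := dvd_add h (pow_dvd_angleLog_sub_angleIdx m b)
  rwa [sub_add_sub_cancel] at this

theorem conductorQ_mul_pow_dvd_stickModulus (p d m : ℕ) :
    conductorQ p * p ^ m ∣ stickModulus p d m := ⟨d, by rw [stickModulus]; ring⟩

theorem dvd_stickModulus (p d m : ℕ) : p ∣ stickModulus p d m :=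
  ((dvd_conductorQ p).mul_right _).trans (conductorQ_mul_pow_dvd_stickModulus p d m)

theorem four_dvd_stickModulus (h : p = 2) (d m : ℕ) : 4 ∣ stickModulus p d m := by
  have : conductorQ p = 4 := by subst h; simp [conductorQ, delta]
  exact (this ▸ dvd_mul_right (conductorQ p) _ : 4 ∣ conductorQ p * p ^ m).trans
    (conductorQ_mul_pow_dvd_stickModulus p d m)

theorem stickModulus_ne_zero {d : ℕ} (hd : ¬ p ∣ d) (m : ℕ) : stickModulus p d m ≠ 0 := by
  have : d ≠ 0 := fun h => hd (h ▸ dvd_zero p)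
  exact mul_ne_zero (mul_ne_zero this (NeZero.ne _)) (pow_ne_zero _ hp.out.ne_zero)

theorem norm_natCast_eq_one {d : ℕ} (hd : ¬ p ∣ d) : ‖(d : ℤ_[p])‖ = 1 :=
  PadicInt.norm_natCast_eq_one_iff.2 ((Nat.Prime.coprime_iff_not_dvd hp.out).2 hd)

theorem norm_stickModulus {d : ℕ} (hd : ¬ p ∣ d) (m : ℕ) :
    ‖(stickModulus p d m : ℤ_[p])‖ = ‖(conductorQ p : ℤ_[p])‖ * ‖(p : ℤ_[p]) ^ m‖ := by
  rw [stickModulus, Nat.cast_mul, Nat.cast_mul, norm_mul, norm_mul, norm_natCast_eq_one hd, one_mul,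
    Nat.cast_pow]

theorem stickModulus_dvd_angle_sub {d : ℕ} (hd : ¬ p ∣ d) (m : ℕ) {a : ℕ} (ha : ¬ p ∣ a) :
    (stickModulus p d m : ℤ_[p]) ∣ angle p a - qPow p (angleIdx p m a) := by
  have h := pow_dvd_angleLog_sub_angleIdx (p := p) m a
  rw [padicInt_dvd_iff_norm_le] at h ⊢
  rw [norm_stickModulus hd, ← qPow_angleLog ha, norm_qPow_sub]
  exact mul_le_mul_of_nonneg_left h (norm_nonneg _)

theorem exists_stickCoeff (p : ℕ) [Fact p.Prime] (d m a : ℕ) : ∃ r : ℤ_[p], ¬ p ∣ d → ¬ p ∣ a →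
    angle p a = qPow p (angleIdx p m a) + stickModulus p d m * r := by
  by_cases h : ¬ p ∣ d ∧ ¬ p ∣ a
  · obtain ⟨r, hr⟩ := stickModulus_dvd_angle_sub h.1 m h.2
    exact ⟨r, fun _ _ => by rw [← hr]; ring⟩
  · exact ⟨0, fun h1 h2 => absurd ⟨h1, h2⟩ h⟩

/-- The `p`-adic integer `(⟨a⟩ - (1 + q)^i) / (d q p^m)`, where `i = angleIdx p m a`. -/
def stickCoeff (p : ℕ) [Fact p.Prime] (d m a : ℕ) : ℤ_[p] := (exists_stickCoeff p d m a).choose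

theorem angle_eq {d : ℕ} (hd : ¬ p ∣ d) (m : ℕ) {a : ℕ} (ha : ¬ p ∣ a) :
    angle p a = qPow p (angleIdx p m a) + stickModulus p d m * stickCoeff p d m a :=
  (exists_stickCoeff p d m a).choose_spec hd ha

/-- The polynomial approximating the Iwasawa power series attached to `χ`. -/
def stickPoly {d : ℕ} (χ : DirichletCharacter (PadicAlgCl p) (d * conductorQ p)) (m : ℕ) :
    (PadicAlgCl p)[X] :=
  ∑ a ∈ stickIndex p d m, C (χ (a : ZMod _) * algebraMap ℤ_[p] (PadicAlgCl p) (stickCoeff p d m a)) *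
    X ^ angleIdx p m a

theorem mem_stickIndex {p d m a : ℕ} :
    a ∈ stickIndex p d m ↔ a < stickModulus p d m ∧ ¬ p ∣ a ∧ (p = 2 → a % 4 = 1) := by
  simp [stickIndex]

/-- Multiplication by b permutes the classes prime to p; for p = 2 the condition b ≡ 1 mod 4 keeps
the chosen half stable. -/
theorem sum_stickIndex_mul {M : Type*} [AddCommMonoid M] {d : ℕ} (hd : ¬ p ∣ d) (m : ℕ) {b : ℕ}
    (hb : b.Coprime (stickModulus p d m)) (hb4 : p = 2 → b % 4 = 1) {G : ℕ → M}
    (hG : ∀ a, ¬ p ∣ a → G (a + stickModulus p d m) = G a) :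
    ∑ a ∈ stickIndex p d m, G (b * a) = ∑ a ∈ stickIndex p d m, G a := by
  have hpb : ¬ p ∣ b := fun h =>
    hp.out.one_lt.ne' (Nat.dvd_one.1 (hb ▸ Nat.dvd_gcd h (dvd_stickModulus p d m)))
  rw [stickIndex, Finset.sum_filter, Finset.sum_filter]
  rw [← sum_range_mul_of_periodic (stickModulus_ne_zero hd m) hb
    (F := fun a => if ¬ p ∣ a ∧ (p = 2 → a % 4 = 1) then G a else 0)]
  · refine Finset.sum_congr rfl fun a _ => ?_
    have h1 : p ∣ b * a ↔ p ∣ a := by rw [hp.out.dvd_mul]; exact or_iff_right hpb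
    have h2 : p = 2 → (b * a) % 4 = a % 4 := fun h => by
      rw [Nat.mul_mod, hb4 h, one_mul, Nat.mod_mod]
    simp only [h1]
    by_cases hp2 : p = 2
    · rw [h2 hp2]
    · simp [hp2]
  · intro a
    have h1 : p ∣ a + stickModulus p d m ↔ p ∣ a := (Nat.dvd_add_left (dvd_stickModulus p d m))
    have h2 : p = 2 → (a + stickModulus p d m) % 4 = a % 4 := fun h => by
      obtain ⟨k, hk⟩ := four_dvd_stickModulus h d m
      rw [hk, Nat.add_mul_mod_self_left]
    by_cases ha : p ∣ a
    · simp only [h1, ha, not_true_eq_false, false_and, if_false]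
    · rw [hG a ha]
      simp only [h1]
      by_cases hp2 : p = 2
      · rw [h2 hp2]
      · simp [hp2]

theorem angleIdx_add_stickModulus {d m a : ℕ} (ha : ¬ p ∣ a) :
    angleIdx p m (a + stickModulus p d m) = angleIdx p m a := by
  have ha' : ¬ p ∣ a + stickModulus p d m := fun h =>
    ha ((Nat.dvd_add_left (dvd_stickModulus p d m)).1 h)
  refine angleIdx_congr (dvd_angleLog_sub ha' ?_)
  have h : (a + stickModulus p d m) ≡ a [MOD stickModulus p d m] := by simp [Nat.ModEq]
  exact h.of_dvd (conductorQ_mul_pow_dvd_stickModulus p d m)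

theorem apply_add_stickModulus {d : ℕ} (χ : DirichletCharacter (PadicAlgCl p) (d * conductorQ p))
    (m a : ℕ) : χ ((a + stickModulus p d m : ℕ) : ZMod _) = χ (a : ZMod _) := by
  congr 1
  rw [ZMod.natCast_eq_natCast_iff]
  have h : (a + stickModulus p d m) ≡ a [MOD stickModulus p d m] := by simp [Nat.ModEq]
  exact h.of_dvd ⟨p ^ m, rfl⟩

/-- A nontrivial even character takes a nontrivial value at some integer `b` with `⟨b⟩` close to
`1`. -/
theorem exists_apply_ne_one {d : ℕ} (hd : ¬ p ∣ d)
    {χ : DirichletCharacter (PadicAlgCl p) (d * conductorQ p)} (heven : χ.Even) (hχ : χ ≠ 1)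
    (m : ℕ) : ∃ b : ℕ, b.Coprime (stickModulus p d m) ∧ (p = 2 → b % 4 = 1) ∧
      (p : ℤ_[p]) ^ m ∣ angleLog p b ∧ χ (b : ZMod _) ≠ 1 := by
  have hd0 : d ≠ 0 := fun h => hd (h ▸ dvd_zero p)
  have hD : NeZero (d * conductorQ p) := ⟨mul_ne_zero hd0 (NeZero.ne _)⟩
  have hpD : p ∣ d * conductorQ p := (dvd_conductorQ p).mul_left _
  obtain ⟨a, ha, hχa, ha4⟩ : ∃ a : ℕ, a.Coprime (d * conductorQ p) ∧ χ (a : ZMod _) ≠ 1 ∧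
      (p = 2 → a % 4 = 1) := by
    obtain ⟨x, hx⟩ : ∃ x : (ZMod (d * conductorQ p))ˣ, χ x ≠ 1 := by
      by_contra! h
      exact hχ (MulChar.ext fun x => by rw [h x, MulChar.one_apply_coe])
    have key : ∀ y : (ZMod (d * conductorQ p))ˣ, (y : ZMod (d * conductorQ p)).val.Coprime
        (d * conductorQ p) := fun y => ZMod.val_coe_unit_coprime y
    by_cases h4 : p = 2 → (x : ZMod (d * conductorQ p)).val % 4 = 1
    · exact ⟨_, key x, by simpa using hx, h4⟩
    -- For p = 2 a representative ≡ 3 mod 4 is replaced by its negative, which is harmless since χ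
    -- is even.
    · rw [Classical.not_imp] at h4
      obtain ⟨hp2, h4⟩ := h4
      refine ⟨_, key (-x), by
        rw [ZMod.natCast_val, ZMod.cast_id', id, Units.val_neg,
          DirichletCharacter.Even.eval_neg χ _ heven]
        exact hx, fun _ => ?_⟩
      have h4D : 4 ∣ d * conductorQ p := by
        have : conductorQ p = 4 := by subst hp2; simp [conductorQ, delta]
        rw [this]; exact dvd_mul_left _ _
      have h2 : (x : ZMod (d * conductorQ p)).val + ((-x : (ZMod (d * conductorQ p))ˣ) :
          ZMod (d * conductorQ p)).val ≡ 0 [MOD d * conductorQ p] := by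
        rw [← ZMod.natCast_eq_natCast_iff]; simp
      have h3 := h2.of_dvd h4D
      have h5 : ¬ 2 ∣ (x : ZMod (d * conductorQ p)).val := fun h => by
        have := Nat.dvd_gcd h ((hp2 ▸ hpD : 2 ∣ d * conductorQ p))
        rw [key x] at this
        omega
      unfold Nat.ModEq at h3
      omega
  have hpa : ¬ p ∣ a := fun h => hp.out.one_lt.ne' (Nat.dvd_one.1 (ha ▸ Nat.dvd_gcd h hpD))
  have hcop : Nat.Coprime d (conductorQ p * p ^ m) := by
    rw [conductorQ_mul_pow]
    exact Nat.Coprime.pow_right _ ((Nat.Prime.coprime_iff_not_dvd hp.out).2 hd).symm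
  -- By the Chinese remainder theorem b is chosen ≡ a mod d and close to ω(a) at p. Then b ≡ a mod d
  -- q, since ω(a) ≡ a mod q, while ⟨b⟩ ≡ 1 mod q p^m.
  set t := (teich p a).appr (m + 1 + delta p)
  have ht : (p : ℤ_[p]) ^ (m + 1 + delta p) ∣ teich p a - t := pow_dvd_sub_appr _ _
  obtain ⟨b, hbd, hbt⟩ := Nat.chineseRemainder hcop a t
  have hq : (conductorQ p : ℤ_[p]) ∣ (p : ℤ_[p]) ^ (m + 1 + delta p) := by
    rw [← conductorQ_mul_pow_cast]; exact dvd_mul_right _ _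
  have hbt' : (p : ℤ_[p]) ^ (m + 1 + delta p) ∣ (b : ℤ_[p]) - teich p a := by
    have h1 := natCast_dvd_sub_of_modEq (p := p) hbt
    rw [Nat.cast_mul, Nat.cast_pow, conductorQ_mul_pow_cast] at h1
    have := dvd_sub h1 ht
    rwa [sub_sub, add_sub_cancel] at this
  have hba : b ≡ a [MOD conductorQ p] := by
    have h1 := dvd_add (hq.trans hbt') (dvd_teich_sub hpa)
    rw [sub_add_sub_cancel, conductorQ, Nat.cast_pow] at h1
    exact modEq_of_pow_dvd_sub h1
  have hcop' : Nat.Coprime d (conductorQ p) := Nat.Coprime.of_dvd_right (dvd_mul_right _ _) hcop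
  have hbaD : b ≡ a [MOD d * conductorQ p] := (Nat.modEq_and_modEq_iff_modEq_mul hcop').1 ⟨hbd, hba⟩
  have hpb : ¬ p ∣ b := fun h => hpa (((hba.of_dvd (dvd_conductorQ p)).dvd_iff dvd_rfl).1 h)
  refine ⟨b, ?_, fun hp2 => ?_, ?_, ?_⟩
  · rw [stickModulus]
    refine Nat.Coprime.mul_right ?_
      (Nat.Coprime.pow_right _ ((Nat.Prime.coprime_iff_not_dvd hp.out).2 hpb).symm)
    rw [Nat.Coprime, hbaD.gcd_eq]; exact ha
  · have : conductorQ p = 4 := by subst hp2; simp [conductorQ, delta]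
    rw [this] at hba
    rw [← ha4 hp2]; exact hba
  · have hang : (p : ℤ_[p]) ^ (m + 1 + delta p) ∣ angle p b - 1 := by
      have h1 : (b : ℤ_[p]) - teich p a = teich p a * (angle p b - 1) := by
        rw [mul_sub, mul_one, ← teich_congr hba, teich_mul_angle hpb]
      rw [h1] at hbt'
      exact ((isUnit_teich hpa).dvd_mul_left).1 hbt'
    have h1 : ¬ p ∣ 1 := fun h => hp.out.one_lt.ne' (Nat.dvd_one.1 h)
    have ha1 : angle p 1 = 1 := by
      have := teich_mul_angle h1
      rwa [teich_eq_one (Nat.ModEq.refl 1), one_mul, Nat.cast_one] at this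
    have h2 := norm_angleLog_sub hpb h1
    rw [angleLog_one, sub_zero, ha1] at h2
    rw [← conductorQ_mul_pow_cast] at hang
    rw [padicInt_dvd_iff_norm_le] at hang ⊢
    rw [← h2, norm_mul] at hang
    exact le_of_mul_le_mul_left hang
      (lt_of_le_of_ne (norm_nonneg _) (norm_conductorQ_ne_zero p).symm)
  · rwa [(ZMod.natCast_eq_natCast_iff _ _ _).2 hbaD]

/-- Multiplication by such a b leaves the index i_m(a) unchanged and scales the sum by χ(b) ≠ 1.
This is the absence of a pole for nontrivial χ. -/
theorem sum_stickIndex_eq_zero {d : ℕ} (hd : ¬ p ∣ d)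
    {χ : DirichletCharacter (PadicAlgCl p) (d * conductorQ p)} (heven : χ.Even) (hχ : χ ≠ 1)
    (m : ℕ) (h : ℕ → PadicAlgCl p) :
    ∑ a ∈ stickIndex p d m, χ (a : ZMod _) * h (angleIdx p m a) = 0 := by
  obtain ⟨b, hb, hb4, hlog, hχb⟩ := exists_apply_ne_one hd heven hχ m
  have hpb : ¬ p ∣ b := fun h =>
    hp.out.one_lt.ne' (Nat.dvd_one.1 (hb ▸ Nat.dvd_gcd h (dvd_stickModulus p d m)))
  have h1 := sum_stickIndex_mul hd m hb hb4
    (G := fun a => χ (a : ZMod _) * h (angleIdx p m a)) (fun a ha => by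
      rw [apply_add_stickModulus, angleIdx_add_stickModulus ha])
  have h2 : ∑ a ∈ stickIndex p d m, χ ((b * a : ℕ) : ZMod _) * h (angleIdx p m (b * a)) =
      χ (b : ZMod _) * ∑ a ∈ stickIndex p d m, χ (a : ZMod _) * h (angleIdx p m a) := by
    rw [Finset.mul_sum]
    refine Finset.sum_congr rfl fun a ha => ?_
    have hpa := (mem_stickIndex.1 ha).2.1
    have : angleIdx p m (b * a) = angleIdx p m a := by
      refine angleIdx_congr ?_
      rw [angleLog_mul hpb hpa, add_sub_cancel_right]
      exact hlog
    rw [this, Nat.cast_mul, map_mul, mul_assoc]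
  rw [h2] at h1
  have h3 : (χ (b : ZMod _) - 1) *
      ∑ a ∈ stickIndex p d m, χ (a : ZMod _) * h (angleIdx p m a) = 0 := by
    rw [sub_mul, h1, one_mul, sub_self]
  exact (mul_eq_zero.1 h3).resolve_left (sub_ne_zero.2 hχb)

theorem card_stickIndex_one (m : ℕ) : (stickIndex p 1 m).card = (p - 1) * p ^ m := by
  rw [stickIndex, Finset.card_filter, stickModulus, one_mul, Finset.sum_range_mul_eq]
  have hper : ∀ b j : ℕ, (if ¬ p ∣ b + conductorQ p * j ∧ (p = 2 → (b + conductorQ p * j) % 4 = 1)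
      then 1 else 0) = if ¬ p ∣ b ∧ (p = 2 → b % 4 = 1) then 1 else 0 := by
    intro b j
    have h1 : p ∣ b + conductorQ p * j ↔ p ∣ b :=
      Nat.dvd_add_left ((dvd_conductorQ p).mul_right _)
    have h2 : p = 2 → (b + conductorQ p * j) % 4 = b % 4 := fun h => by
      have : conductorQ p = 4 := by subst h; simp [conductorQ, delta]
      rw [this, Nat.add_mul_mod_self_left]
    simp only [h1]
    by_cases hp2 : p = 2
    · rw [h2 hp2]
    · simp [hp2]
  simp only [hper, Finset.sum_const, Finset.card_range, smul_eq_mul]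
  rw [mul_comm]
  congr 1
  by_cases hp2 : p = 2
  · subst hp2; simp [conductorQ, delta]; decide
  · have hq : conductorQ p = p := by simp [conductorQ, delta, hp2]
    rw [hq, ← Nat.totient_prime hp.out, Nat.totient, Finset.card_filter]
    refine Finset.sum_congr rfl fun b _ => ?_
    simp only [Nat.Prime.coprime_iff_not_dvd hp.out, hp2, false_imp_iff, and_true]

/-- Multiplication by (1+q)^i translates the index by i modulo p^m, so all p^m fibres have the same
size; the total count then gives p - 1. -/
theorem angleIdx_fiber_card (m : ℕ) {i : ℕ} (hi : i < p ^ m) :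
    ((stickIndex p 1 m).filter fun a => angleIdx p m a = i).card = p - 1 := by
  have h1 : ¬ p ∣ 1 := fun h => hp.out.one_lt.ne' (Nat.dvd_one.1 h)
  set u := 1 + conductorQ p
  have hu := not_dvd_one_add_conductorQ p
  set c : ℕ → ℕ := fun i => ((stickIndex p 1 m).filter fun a => angleIdx p m a = i).card
  have hc : ∀ i < p ^ m, c i = c 0 := by
    intro i hi
    have hb : (u ^ i).Coprime (stickModulus p 1 m) := by
      rw [stickModulus, one_mul, conductorQ_mul_pow]
      exact Nat.Coprime.pow _ _ ((Nat.Prime.coprime_iff_not_dvd hp.out).2 hu).symm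
    have hb4 : p = 2 → u ^ i % 4 = 1 := fun h => by
      have : conductorQ p = 4 := by subst h; simp [conductorQ, delta]
      simp only [u, this]
      rw [Nat.pow_mod]; simp
    have := sum_stickIndex_mul h1 m hb hb4 (G := fun a => if angleIdx p m a = i then 1 else 0)
      (fun a ha => by rw [angleIdx_add_stickModulus ha])
    simp only [c]
    rw [Finset.card_filter, Finset.card_filter, ← this]
    refine Finset.sum_congr rfl fun a ha => ?_
    have hpa := (mem_stickIndex.1 ha).2.1
    have hidx : angleIdx p m (u ^ i * a) = (i + angleIdx p m a) % p ^ m := by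
      refine angleIdx_eq_of_modEq ?_
      rw [angleLog_mul (not_dvd_pow hu i) hpa, angleLog_pow hu, angleLog_one_add_conductorQ, mul_one,
        Nat.cast_add, add_sub_add_left_eq_sub]
      exact pow_dvd_angleLog_sub_angleIdx m a
    have hlt := angleIdx_lt (p := p) m a
    have : angleIdx p m (u ^ i * a) = i ↔ angleIdx p m a = 0 := by
      rw [hidx]
      constructor
      · intro h
        rcases Nat.lt_or_ge (i + angleIdx p m a) (p ^ m) with h' | h'
        · rw [Nat.mod_eq_of_lt h'] at h; omega
        · rw [Nat.mod_eq_sub_mod h', Nat.mod_eq_of_lt (by omega)] at h; omega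
      · intro h; rw [h, add_zero, Nat.mod_eq_of_lt hi]
    simp only [this]
  have hsum := Finset.card_eq_sum_card_fiberwise (s := stickIndex p 1 m) (t := Finset.range (p ^ m))
    (f := angleIdx p m) (fun a _ => Finset.mem_coe.2 (Finset.mem_range.2 (angleIdx_lt m a)))
  rw [card_stickIndex_one, Finset.sum_congr rfl (g := fun _ => c 0)
    (fun i hi => hc i (Finset.mem_range.1 hi)), Finset.sum_const, Finset.card_range, smul_eq_mul,
    mul_comm] at hsum
  have := Nat.eq_of_mul_eq_mul_left (pow_pos hp.out.pos m) hsum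
  rw [this]
  exact hc i hi

/-- For the trivial character the leading sum does not cancel; its weight p - 1 governs the pole
term. -/
theorem sum_stickIndex_one (m : ℕ) (h : ℕ → PadicAlgCl p) :
    ∑ a ∈ stickIndex p 1 m, (1 : DirichletCharacter (PadicAlgCl p) (1 * conductorQ p)) (a : ZMod _) *
      h (angleIdx p m a) = ((p - 1 : ℕ) : PadicAlgCl p) * ∑ i ∈ Finset.range (p ^ m), h i := by
  rw [Finset.sum_congr rfl (g := fun a => h (angleIdx p m a))]
  · rw [← Finset.sum_fiberwise_of_maps_to (t := Finset.range (p ^ m)) (g := angleIdx p m)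
      (fun a _ => Finset.mem_range.2 (angleIdx_lt m a)), Finset.mul_sum]
    refine Finset.sum_congr rfl fun i hi => ?_
    rw [Finset.sum_congr rfl (g := fun _ => h i) (fun a ha => by rw [(Finset.mem_filter.1 ha).2]),
      Finset.sum_const, angleIdx_fiber_card m (Finset.mem_range.1 hi), nsmul_eq_mul]
  · intro a ha
    have hpa := (mem_stickIndex.1 ha).2.1
    rw [MulChar.one_apply, one_mul]
    rw [one_mul]
    exact isUnit_natCast_conductorQ hpa

end PadicLimit

end

noncomputable section

open Polynomial

namespace PadicLimit

open DirichletCharacter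

variable {p : ℕ} [hp : Fact p.Prime]

/-! ### Moments of periodic functions -/

theorem tendsto_natCast_stickModulus (p d : ℕ) [hp : Fact p.Prime] :
    Tendsto (fun m => (stickModulus p d m : PadicAlgCl p)) atTop (𝓝 0) := by
  have h : Tendsto (fun m => (p : PadicAlgCl p) ^ m) atTop (𝓝 0) := by
    refine tendsto_pow_atTop_nhds_zero_of_norm_lt_one ?_
    rw [norm_p_padicAlgCl]
    exact inv_lt_one_of_one_lt₀ (by exact_mod_cast hp.out.one_lt)
  have h2 := h.const_mul ((d * conductorQ p : ℕ) : PadicAlgCl p)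
  rw [mul_zero] at h2
  refine h2.congr fun m => ?_
  rw [stickModulus]; push_cast; ring

theorem stickModulus_dvd {p d m k : ℕ} (h : k ≤ m) : stickModulus p d k ∣ stickModulus p d m :=
  mul_dvd_mul_left _ (pow_dvd_pow _ h)

theorem tendsto_moment {d f k : ℕ} (hd : ¬ p ∣ d) (hf : f ∣ stickModulus p d k)
    {Φ : ℕ → PadicAlgCl p} (hΦ : ∀ b, Φ (b + f) = Φ b) (n : ℕ) :
    Tendsto (fun m => (∑ a ∈ Finset.range (stickModulus p d m), Φ a * (a : PadicAlgCl p) ^ n) /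
      (stickModulus p d m : PadicAlgCl p)) atTop (𝓝 (genBernoulli f n Φ)) := by
  have hf0 : f ≠ 0 := fun h => stickModulus_ne_zero hd k (Nat.eq_zero_of_zero_dvd (h ▸ hf))
  have hdvd : ∀ m, k ≤ m → f * (stickModulus p d m / f) = stickModulus p d m := fun m hm =>
    Nat.mul_div_cancel' (hf.trans (stickModulus_dvd hm))
  have hlim : Tendsto (fun m => ((stickModulus p d m / f : ℕ) : PadicAlgCl p)) atTop (𝓝 0) := by
    have h := (tendsto_natCast_stickModulus p d).const_mul ((f : PadicAlgCl p)⁻¹)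
    rw [mul_zero] at h
    refine h.congr' ?_
    filter_upwards [eventually_ge_atTop k] with m hm
    rw [← hdvd m hm, Nat.mul_div_cancel_left _ (Nat.pos_of_ne_zero hf0), Nat.cast_mul,
      inv_mul_cancel_left₀ (Nat.cast_ne_zero.2 hf0)]
  refine (tendsto_sum_mul_pow_div n hf0 hΦ ?_ hlim).congr' ?_
  · filter_upwards [eventually_ge_atTop k] with m hm h
    have := hdvd m hm
    rw [h, mul_zero] at this
    exact stickModulus_ne_zero hd m this.symm
  · filter_upwards [eventually_ge_atTop k] with m hm
    rw [hdvd m hm]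

/-- The moment over the integers prime to `p` loses the Euler factor at `p`. -/
theorem tendsto_moment_coprime {d f k : ℕ} (hd : ¬ p ∣ d) (hf : f ∣ stickModulus p d k)
    {Φ : ℕ → PadicAlgCl p} (hΦ : ∀ b, Φ (b + f) = Φ b) (hmul : ∀ b, Φ (p * b) = Φ p * Φ b) {n : ℕ}
    (hn : 1 ≤ n) :
    Tendsto (fun m => (∑ a ∈ (Finset.range (stickModulus p d m)).filter (¬ p ∣ ·),
        Φ a * (a : PadicAlgCl p) ^ n) / (stickModulus p d m : PadicAlgCl p)) atTop
      (𝓝 ((1 - Φ p * (p : PadicAlgCl p) ^ (n - 1)) * genBernoulli f n Φ)) := by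
  have h := tendsto_moment hd hf hΦ n
  rw [← tendsto_add_atTop_iff_nat 1]
  -- The multiples of p below Q_{m+1} are p times the integers below Q_m; removing them costs
  -- Φ(p)pⁿ, of which one power of p is absorbed by Q_{m+1} = p Q_m.
  have h1 := ((tendsto_add_atTop_iff_nat 1).2 h).sub (h.const_mul (Φ p * (p : PadicAlgCl p) ^ (n - 1)))
  rw [sub_mul, one_mul]
  refine h1.congr fun m => ?_
  have hQ : stickModulus p d (m + 1) = p * stickModulus p d m := by
    rw [stickModulus, stickModulus, pow_succ]; ring
  have hsum := Finset.sum_filter_add_sum_filter_not (Finset.range (stickModulus p d (m + 1))) (p ∣ ·)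
    (fun a => Φ a * (a : PadicAlgCl p) ^ n)
  have hdiv : ∑ a ∈ (Finset.range (stickModulus p d (m + 1))).filter (p ∣ ·),
      Φ a * (a : PadicAlgCl p) ^ n = Φ p * (p : PadicAlgCl p) ^ n *
        ∑ a ∈ Finset.range (stickModulus p d m), Φ a * (a : PadicAlgCl p) ^ n := by
    rw [Finset.mul_sum]
    symm
    refine Finset.sum_bij (fun a _ => p * a) ?_ ?_ ?_ ?_
    · intro a ha
      rw [Finset.mem_filter, Finset.mem_range, hQ]
      exact ⟨Nat.mul_lt_mul_of_pos_left (Finset.mem_range.1 ha) hp.out.pos, dvd_mul_right _ _⟩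
    · intro a _ b _ hab; exact Nat.eq_of_mul_eq_mul_left hp.out.pos hab
    · intro b hb
      obtain ⟨h1, c, rfl⟩ := Finset.mem_filter.1 hb
      rw [Finset.mem_range, hQ] at h1
      exact ⟨c, Finset.mem_range.2 (Nat.lt_of_mul_lt_mul_left h1), rfl⟩
    · intro a _
      rw [hmul]; push_cast; ring
  rw [← hsum, hdiv]
  have hp0 : (p : PadicAlgCl p) ≠ 0 := Nat.cast_ne_zero.2 hp.out.ne_zero
  have hQ0 : (stickModulus p d m : PadicAlgCl p) ≠ 0 := Nat.cast_ne_zero.2 (stickModulus_ne_zero hd m)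
  obtain ⟨n, rfl⟩ := Nat.exists_eq_add_of_le' hn
  rw [hQ, Nat.add_sub_cancel, Nat.cast_mul]
  field_simp
  ring

theorem tendsto_mul_of_norm_le_one {a b : ℕ → PadicAlgCl p} (ha : Tendsto a atTop (𝓝 0))
    (hb : ∀ m, ‖b m‖ ≤ 1) : Tendsto (fun m => a m * b m) atTop (𝓝 0) := by
  refine squeeze_zero_norm (fun m => ?_) (tendsto_zero_iff_norm_tendsto_zero.1 ha)
  rw [norm_mul]
  exact mul_le_of_le_one_right (norm_nonneg _) (hb m)

theorem norm_sum_le_one {ι : Type*} {s : Finset ι} {f : ι → PadicAlgCl p}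
    (h : ∀ i ∈ s, ‖f i‖ ≤ 1) : ‖∑ i ∈ s, f i‖ ≤ 1 :=
  IsUltrametricDist.norm_sum_le_of_forall_le_of_nonneg zero_le_one h

theorem norm_mul_le_one {x y : PadicAlgCl p} (hx : ‖x‖ ≤ 1) (hy : ‖y‖ ≤ 1) : ‖x * y‖ ≤ 1 := by
  rw [norm_mul]; exact mul_le_one₀ hx (norm_nonneg _) hy

/-- The part of the moment supported on the classes in `stickIndex`. -/
theorem tendsto_moment_stickIndex {d f k : ℕ} (hd : ¬ p ∣ d) (hf : f ∣ stickModulus p d k)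
    {Φ : ℕ → PadicAlgCl p} (hΦ : ∀ b, Φ (b + f) = Φ b) (hmul : ∀ b, Φ (p * b) = Φ p * Φ b)
    (hnorm : ∀ b, ‖Φ b‖ ≤ 1) {n : ℕ} (hn : 1 ≤ n)
    (hneg : ∀ m b c, k ≤ m → ¬ p ∣ b → b + c = stickModulus p d m → Φ c = (-1) ^ n * Φ b) :
    Tendsto (fun m => (∑ a ∈ stickIndex p d m, Φ a * (a : PadicAlgCl p) ^ n) /
      (stickModulus p d m : PadicAlgCl p)) atTop
      (𝓝 (((2 : PadicAlgCl p) ^ delta p)⁻¹ *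
        ((1 - Φ p * (p : PadicAlgCl p) ^ (n - 1)) * genBernoulli f n Φ))) := by
  have h := tendsto_moment_coprime hd hf hΦ hmul hn
  by_cases hp2 : p = 2
  · have hdelta : delta p = 1 := by simp [delta, hp2]
    have h4 : ∀ m, 4 ∣ stickModulus p d m := four_dvd_stickModulus hp2 d
    have h4' : stickModulus p d k ∣ stickModulus p d k := dvd_rfl
    -- the moment of lower degree
    have hlow : Tendsto (fun m => ∑ a ∈ stickIndex p d m, Φ a * (a : PadicAlgCl p) ^ (n - 1)) atTop
        (𝓝 0) := by
      -- The restriction of Φ to odd classes ≡ 1 mod 4 has period Q_k, so its sums divided by Q_m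
      -- converge, and the sums themselves tend to 0.
      have h1 := (tendsto_natCast_stickModulus p d).mul (tendsto_moment hd h4'
        (Φ := fun a => if ¬ p ∣ a ∧ (p = 2 → a % 4 = 1) then Φ a else 0) (fun b => by
          have e1 : p ∣ b + stickModulus p d k ↔ p ∣ b := Nat.dvd_add_left (dvd_stickModulus p d k)
          have e2 : (b + stickModulus p d k) % 4 = b % 4 := by
            obtain ⟨c, hc⟩ := h4 k
            rw [hc, Nat.add_mul_mod_self_left]
          have e3 : Φ (b + stickModulus p d k) = Φ b := by
            obtain ⟨c, hc⟩ := hf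
            rw [hc]; exact periodic_add_mul hΦ _ _
          simp only [e1, e2, e3]) (n - 1))
      rw [zero_mul] at h1
      refine h1.congr fun m => ?_
      rw [mul_div_cancel₀ _ (Nat.cast_ne_zero.2 (stickModulus_ne_zero hd m)), stickIndex,
        Finset.sum_filter]
      refine Finset.sum_congr rfl fun a _ => ?_
      split_ifs <;> simp
    -- the remainder terms
    choose c hc using fun (m b : ℕ) => (⟨_, (Polynomial.powAddExpansion (b : ℤ_[p])
      (-(stickModulus p d m : ℤ_[p])) n).2⟩ : ∃ c : ℤ_[p], ((b : ℤ_[p]) +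
      (-(stickModulus p d m : ℤ_[p]))) ^ n = (b : ℤ_[p]) ^ n + n * (b : ℤ_[p]) ^ (n - 1) *
      (-(stickModulus p d m : ℤ_[p])) + c * (-(stickModulus p d m : ℤ_[p])) ^ 2)
    have hrem : Tendsto (fun m => (stickModulus p d m : PadicAlgCl p) *
        ∑ b ∈ stickIndex p d m, Φ b * algebraMap ℤ_[p] (PadicAlgCl p) (c m b)) atTop (𝓝 0) := by
      refine tendsto_mul_of_norm_le_one (tendsto_natCast_stickModulus p d) fun m =>
        norm_sum_le_one fun b _ => norm_mul_le_one (hnorm b) ?_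
      rw [norm_algebraMap_padicInt]; exact PadicInt.norm_le_one _
    have h5 := ((h.add (hlow.const_mul (n : PadicAlgCl p))).sub hrem).const_mul
      ((2 : PadicAlgCl p) ^ delta p)⁻¹
    rw [mul_zero, add_zero, sub_zero] at h5
    refine h5.congr' ?_
    filter_upwards [eventually_ge_atTop k] with m hm
    have hQ0 : (stickModulus p d m : PadicAlgCl p) ≠ 0 :=
      Nat.cast_ne_zero.2 (stickModulus_ne_zero hd m)
    -- The classes ≡ 3 mod 4 are Q - a with a in the index set. The sign (-1)^n of Φ turns (Q - a)^n
    -- into (a - Q)^n, so both halves have the same limit, whence the factor 1/2.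
    have hsplit : ∑ a ∈ (Finset.range (stickModulus p d m)).filter (¬ p ∣ ·),
        Φ a * (a : PadicAlgCl p) ^ n = ∑ a ∈ stickIndex p d m, Φ a * (a : PadicAlgCl p) ^ n +
        ∑ a ∈ stickIndex p d m, Φ a * ((a : PadicAlgCl p) - stickModulus p d m) ^ n := by
      rw [← Finset.sum_filter_add_sum_filter_not _ (fun a => a % 4 = 1), Finset.filter_filter,
        Finset.filter_filter]
      congr 1
      · refine Finset.sum_congr ?_ fun _ _ => rfl
        ext a
        simp only [stickIndex, Finset.mem_filter, hp2, true_imp_iff]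
      · refine Finset.sum_bij' (fun a _ => stickModulus p d m - a)
          (fun a _ => stickModulus p d m - a) ?_ ?_ ?_ ?_ ?_
        · intro a ha
          simp only [Finset.mem_filter, Finset.mem_range] at ha
          have h6 := h4 m
          have h7 := ha.2.1
          rw [mem_stickIndex]
          rw [hp2] at h7 ⊢
          rw [hp2] at h6 ha
          omega
        · intro a ha
          rw [mem_stickIndex] at ha
          have h6 := h4 m
          have h7 := ha.2.1
          have h8 := ha.2.2 hp2
          simp only [Finset.mem_filter, Finset.mem_range]
          rw [hp2] at h7 ⊢
          rw [hp2] at h6 ha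
          omega
        · intro a ha
          simp only [Finset.mem_filter, Finset.mem_range] at ha
          omega
        · intro a ha
          rw [mem_stickIndex] at ha
          omega
        · intro a ha
          simp only [Finset.mem_filter, Finset.mem_range] at ha
          rw [hneg m a _ hm ha.2.1 (Nat.add_sub_cancel' ha.1.le), Nat.cast_sub ha.1.le,
            sub_sub_cancel_left, neg_pow (a : PadicAlgCl p)]
          have : ((-1 : PadicAlgCl p) ^ n) * (-1) ^ n = 1 := by
            rw [← mul_pow]; simp
          linear_combination (-(Φ a) * (a : PadicAlgCl p) ^ n) * this
    have hexp : ∑ a ∈ stickIndex p d m, Φ a * ((a : PadicAlgCl p) - stickModulus p d m) ^ n =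
        ∑ a ∈ stickIndex p d m, Φ a * (a : PadicAlgCl p) ^ n -
        n * stickModulus p d m * ∑ a ∈ stickIndex p d m, Φ a * (a : PadicAlgCl p) ^ (n - 1) +
        (stickModulus p d m : PadicAlgCl p) ^ 2 *
          ∑ b ∈ stickIndex p d m, Φ b * algebraMap ℤ_[p] (PadicAlgCl p) (c m b) := by
      rw [Finset.mul_sum, Finset.mul_sum, ← Finset.sum_sub_distrib, ← Finset.sum_add_distrib]
      refine Finset.sum_congr rfl fun a _ => ?_
      have := congrArg (algebraMap ℤ_[p] (PadicAlgCl p)) (hc m a)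
      simp only [map_add, map_mul, map_pow, map_neg, map_natCast] at this
      rw [← sub_eq_add_neg] at this
      rw [this]; ring
    rw [hsplit, hexp, hdelta]
    field_simp
    ring
  · have hdelta : delta p = 0 := by simp [delta, hp2]
    rw [hdelta, pow_zero, inv_one, one_mul]
    refine h.congr fun m => ?_
    congr 1
    refine Finset.sum_congr ?_ fun _ _ => rfl
    ext a
    simp [stickIndex, hp2]

end PadicLimit

end

/-! ### Values of the Stickelberger polynomials at integer points. -/

noncomputable section

open Polynomial

namespace PadicLimit

open DirichletCharacter

variable {p : ℕ} [hp : Fact p.Prime]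

theorem stickPoly_eval {d : ℕ} (χ : DirichletCharacter (PadicAlgCl p) (d * conductorQ p)) (m : ℕ)
    (x : PadicAlgCl p) : (stickPoly χ m).eval x = ∑ a ∈ stickIndex p d m, χ (a : ZMod _) *
      algebraMap ℤ_[p] (PadicAlgCl p) (stickCoeff p d m a) * x ^ angleIdx p m a := by
  simp [stickPoly, eval_finsetSum]

theorem norm_dirichletCharacter_le_one {N : ℕ} [NeZero N] (χ : DirichletCharacter (PadicAlgCl p) N)
    (a : ZMod N) : ‖χ a‖ ≤ 1 := by
  by_cases ha : IsUnit a
  · obtain ⟨x, rfl⟩ := ha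
    have h : (χ (x : ZMod N)) ^ Fintype.card (ZMod N)ˣ = 1 := by
      rw [← map_pow, ← Units.val_pow_eq_pow_val, pow_card_eq_one, Units.val_one, map_one]
    exact (norm_eq_one_of_pow_eq_one' Fintype.card_ne_zero h).le
  · rw [χ.map_nonunit ha, norm_zero]; exact zero_le_one

theorem coeffBound_stickPoly {d : ℕ} (hd : ¬ p ∣ d)
    (χ : DirichletCharacter (PadicAlgCl p) (d * conductorQ p)) (m : ℕ) :
    CoeffBound 1 (stickPoly χ m) := by
  have : NeZero (d * conductorQ p) := ⟨mul_ne_zero (fun h => hd (h ▸ dvd_zero p)) (NeZero.ne _)⟩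
  refine CoeffBound.sum zero_le_one fun a _ i => ?_
  rw [coeff_C_mul, coeff_X_pow]
  refine norm_mul_le_one (norm_mul_le_one (norm_dirichletCharacter_le_one _ _) ?_) ?_
  · rw [norm_algebraMap_padicInt]; exact PadicInt.norm_le_one _
  · split_ifs <;> simp

theorem qPowAlg_eq_one_iff {s : ℤ_[p]} : qPowAlg p s = 1 ↔ s = 0 := by
  constructor
  · intro h
    rw [qPowAlg, ← map_one (algebraMap ℤ_[p] (PadicAlgCl p))] at h
    have h2 : Function.Injective (algebraMap ℤ_[p] (PadicAlgCl p)) := by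
      intro x y hxy
      rw [← sub_eq_zero, ← norm_eq_zero, ← norm_algebraMap_padicInt, map_sub, hxy, sub_self,
        norm_zero]
    have h3 := h2 h
    rw [← AddChar.map_zero_eq_one (qPow p)] at h3
    exact qPow_injective p h3
  · rintro rfl; exact qPowAlg_zero

/-- Raising to the power p^k removes ζ, and (1+q)^t = 1 only for t = 0. The denominators
ζ(1+q)^(1-s) - 1 thus vanish only at ζ = 1, s = 1. -/
theorem mul_qPowAlg_eq_one {ζ : PadicAlgCl p} {k : ℕ} (hζ : ζ ^ p ^ k = 1) {s : ℤ_[p]}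
    (h : ζ * qPowAlg p s = 1) : ζ = 1 ∧ s = 0 := by
  have h1 := congrArg (· ^ p ^ k) h
  simp only [mul_pow, hζ, one_mul, one_pow, ← qPowAlg_nsmul] at h1
  rw [qPowAlg_eq_one_iff, mul_eq_zero] at h1
  have hs : s = 0 := h1.resolve_left (by exact_mod_cast pow_ne_zero _ hp.out.ne_zero)
  rw [hs, qPowAlg_zero, mul_one] at h
  exact ⟨h, hs⟩

theorem qPowAlg_natCast (n : ℕ) : qPowAlg p n = qPowAlg p 1 ^ n := by
  rw [← qPowAlg_nsmul, mul_one]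

theorem qPowAlg_sub_one (s : ℤ_[p]) : qPowAlg p s - 1 = algebraMap ℤ_[p] (PadicAlgCl p) s *
    ((conductorQ p : PadicAlgCl p) * algebraMap ℤ_[p] (PadicAlgCl p) (qPowSlope p s)) := by
  have := congrArg (algebraMap ℤ_[p] (PadicAlgCl p)) (qPow_sub_one s)
  simpa [qPowAlg] using this

theorem tendsto_natCast_mul_pow (n : ℕ) :
    Tendsto (fun m => (n : ℤ_[p]) * (p : ℤ_[p]) ^ m) atTop (𝓝 0) := by
  have h : Tendsto (fun m => (p : ℤ_[p]) ^ m) atTop (𝓝 0) :=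
    tendsto_pow_atTop_nhds_zero_of_norm_lt_one (by rw [PadicInt.norm_p]; exact inv_lt_one_of_one_lt₀ (by exact_mod_cast hp.out.one_lt))
  simpa using h.const_mul (n : ℤ_[p])

/-- The sum of a geometric progression divided by the modulus. -/
theorem tendsto_geom_sum_div {d : ℕ} (hd : ¬ p ∣ d) {ζ : PadicAlgCl p} {k : ℕ} (hζ : ζ ^ p ^ k = 1)
    {n : ℕ} (hn : 1 ≤ n) :
    Tendsto (fun m => (∑ i ∈ Finset.range (p ^ m), (ζ * qPowAlg p n) ^ i) /
      (stickModulus p d m : PadicAlgCl p)) atTop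
      (𝓝 (n * (algebraMap ℤ_[p] (PadicAlgCl p) (qPowSlope p 0) / d /
        (ζ * qPowAlg p n - 1)))) := by
  have hn0 : (n : ℤ_[p]) ≠ 0 := by exact_mod_cast (by omega : n ≠ 0)
  have hw : ζ * qPowAlg p n ≠ 1 := fun h => hn0 (mul_qPowAlg_eq_one hζ h).2
  have hw' := sub_ne_zero.2 hw
  have hd0 : (d : PadicAlgCl p) ≠ 0 := Nat.cast_ne_zero.2 fun h => hd (h ▸ dvd_zero p)
  have hq0 : (conductorQ p : PadicAlgCl p) ≠ 0 := Nat.cast_ne_zero.2 (NeZero.ne _)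
  have hp0 : (p : PadicAlgCl p) ≠ 0 := Nat.cast_ne_zero.2 hp.out.ne_zero
  have h1 : Tendsto (fun m => algebraMap ℤ_[p] (PadicAlgCl p)
      (qPowSlope p ((n : ℤ_[p]) * (p : ℤ_[p]) ^ m))) atTop
      (𝓝 (algebraMap ℤ_[p] (PadicAlgCl p) (qPowSlope p 0))) :=
    (((continuous_algebraMap_padicInt p).comp (continuous_qPowSlope p)).tendsto 0).comp
      (tendsto_natCast_mul_pow n)
  have h2 := ((h1.div_const (d : PadicAlgCl p)).div_const (ζ * qPowAlg p n - 1)).const_mul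
    (n : PadicAlgCl p)
  refine h2.congr' ?_
  filter_upwards [eventually_ge_atTop k] with m hm
  have hζm : ζ ^ p ^ m = 1 := by
    obtain ⟨j, rfl⟩ := Nat.exists_eq_add_of_le hm
    rw [pow_add, pow_mul, hζ, one_pow]
  -- For m ≥ k the power p^m kills ζ, and what remains is n p^m q times a slope at n p^m; dividing
  -- by d q p^m leaves a limit with the slope at 0.
  have h3 : (ζ * qPowAlg p n) ^ p ^ m - 1 = (n : PadicAlgCl p) * (p : PadicAlgCl p) ^ m *
      (conductorQ p * algebraMap ℤ_[p] (PadicAlgCl p)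
        (qPowSlope p ((n : ℤ_[p]) * (p : ℤ_[p]) ^ m))) := by
    rw [mul_pow, hζm, one_mul, ← qPowAlg_nsmul]
    push_cast
    rw [mul_comm, qPowAlg_sub_one]
    simp
  rw [geom_sum_eq hw, h3, stickModulus]
  push_cast
  field_simp

/-- The moment of `χ(a) ψ(a) ω⁻ⁿ(a) aⁿ` in terms of the polynomial `stickPoly`. -/
theorem tendsto_stickPoly_eval_natCast {d : ℕ} (hd : ¬ p ∣ d)
    {χ : DirichletCharacter (PadicAlgCl p) (d * conductorQ p)} {ε : PadicAlgCl p}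
    (hsum : ∀ m (h : ℕ → PadicAlgCl p), ∑ a ∈ stickIndex p d m, χ (a : ZMod _) *
      h (angleIdx p m a) = ε * ∑ i ∈ Finset.range (p ^ m), h i) {k : ℕ}
    {ζ : PadicAlgCl p} (hζ : ζ ^ p ^ k = 1) {n : ℕ} (hn : 1 ≤ n) {Φ : ℕ → PadicAlgCl p}
    (hΦ : ∀ m a, k ≤ m → ¬ p ∣ a → Φ a * (a : PadicAlgCl p) ^ n =
      χ (a : ZMod _) * ζ ^ angleIdx p m a * algebraMap ℤ_[p] (PadicAlgCl p) (angle p a) ^ n)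
    {H : PadicAlgCl p}
    (hH : Tendsto (fun m => (∑ a ∈ stickIndex p d m, Φ a * (a : PadicAlgCl p) ^ n) /
      (stickModulus p d m : PadicAlgCl p)) atTop (𝓝 H)) :
    Tendsto (fun m => (stickPoly χ m).eval (ζ * qPowAlg p ((n : ℤ_[p]) - 1))) atTop
      (𝓝 (H / n - ε * (algebraMap ℤ_[p] (PadicAlgCl p) (qPowSlope p 0) / d /
        (ζ * qPowAlg p n - 1)))) := by
  have : NeZero (d * conductorQ p) := ⟨mul_ne_zero (fun h => hd (h ▸ dvd_zero p)) (NeZero.ne _)⟩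
  have hn0 : (n : PadicAlgCl p) ≠ 0 := Nat.cast_ne_zero.2 (by omega)
  have hζ1 : ‖ζ‖ = 1 := norm_eq_one_of_pow_eq_one' (pow_ne_zero _ hp.out.ne_zero) hζ
  choose c hc using fun (m a : ℕ) => (⟨_, (Polynomial.powAddExpansion (qPow p (angleIdx p m a))
      (stickModulus p d m * stickCoeff p d m a) n).2⟩ : ∃ c : ℤ_[p], (qPow p (angleIdx p m a) +
      stickModulus p d m * stickCoeff p d m a) ^ n = qPow p (angleIdx p m a) ^ n +
      n * qPow p (angleIdx p m a) ^ (n - 1) * (stickModulus p d m * stickCoeff p d m a) +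
      c * (stickModulus p d m * stickCoeff p d m a) ^ 2)
  have hrem : Tendsto (fun m => (stickModulus p d m : PadicAlgCl p) *
      ∑ a ∈ stickIndex p d m, χ (a : ZMod _) * ζ ^ angleIdx p m a *
        algebraMap ℤ_[p] (PadicAlgCl p) (c m a * stickCoeff p d m a ^ 2)) atTop (𝓝 0) := by
    refine tendsto_mul_of_norm_le_one (tendsto_natCast_stickModulus p d) fun m =>
      norm_sum_le_one fun a _ => norm_mul_le_one (norm_mul_le_one
        (norm_dirichletCharacter_le_one _ _) (by rw [norm_pow, hζ1, one_pow])) ?_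
    rw [norm_algebraMap_padicInt]; exact PadicInt.norm_le_one _
  have h1 := ((hH.sub ((tendsto_geom_sum_div hd hζ hn).const_mul ε)).sub hrem).div_const
    (n : PadicAlgCl p)
  have e : (H - ε * (n * (algebraMap ℤ_[p] (PadicAlgCl p) (qPowSlope p 0) / d /
      (ζ * qPowAlg p n - 1))) - 0) / n = H / n - ε * (algebraMap ℤ_[p] (PadicAlgCl p)
      (qPowSlope p 0) / d / (ζ * qPowAlg p n - 1)) := by
    field_simp
    ring
  rw [e] at h1
  refine h1.congr' ?_
  filter_upwards [eventually_ge_atTop k] with m hm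
  have hQ0 : (stickModulus p d m : PadicAlgCl p) ≠ 0 :=
    Nat.cast_ne_zero.2 (stickModulus_ne_zero hd m)
  have hx : qPowAlg p ((n : ℤ_[p]) - 1) = qPowAlg p 1 ^ (n - 1) := by
    rw [← qPowAlg_natCast, Nat.cast_sub hn, Nat.cast_one]
  -- Second order expansion of ((1+q)^i + Q r)^n: the constant terms form the geometric sum, the
  -- linear terms are n Q times the polynomial value, and the rest is divisible by Q².
  have hsplit : ∑ a ∈ stickIndex p d m, Φ a * (a : PadicAlgCl p) ^ n =
      ε * ∑ i ∈ Finset.range (p ^ m), (ζ * qPowAlg p n) ^ i +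
      n * stickModulus p d m * (stickPoly χ m).eval (ζ * qPowAlg p ((n : ℤ_[p]) - 1)) +
      (stickModulus p d m : PadicAlgCl p) ^ 2 *
        ∑ a ∈ stickIndex p d m, χ (a : ZMod _) * ζ ^ angleIdx p m a *
        algebraMap ℤ_[p] (PadicAlgCl p) (c m a * stickCoeff p d m a ^ 2) := by
    rw [← hsum m (fun i => (ζ * qPowAlg p n) ^ i), stickPoly_eval, Finset.mul_sum, Finset.mul_sum,
      ← Finset.sum_add_distrib, ← Finset.sum_add_distrib]
    refine Finset.sum_congr rfl fun a ha => ?_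
    have hpa := (mem_stickIndex.1 ha).2.1
    have := congrArg (algebraMap ℤ_[p] (PadicAlgCl p)) (hc m a)
    simp only [map_add, map_mul, map_pow, map_natCast] at this
    rw [hΦ m a hm hpa, angle_eq hd m hpa]
    simp only [map_add, map_mul, map_pow, map_natCast]
    rw [this, hx]
    change _ * (qPowAlg p _ ^ n + n * qPowAlg p _ ^ (n - 1) * _ + _) = _
    rw [qPowAlg_natCast (angleIdx p m a), qPowAlg_natCast n, mul_pow, mul_pow ζ, mul_pow ζ,
      ← pow_mul, ← pow_mul, ← pow_mul, ← pow_mul, mul_comm (angleIdx p m a) n, mul_comm (angleIdx p m a) (n - 1)]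
    ring
  rw [hsplit]
  field_simp
  ring

end PadicLimit

end

/-! ### The p-adic L-function as a limit of integral polynomials. -/

noncomputable section

open Polynomial

namespace PadicLimit

open DirichletCharacter

variable {p : ℕ} [hp : Fact p.Prime]

/-- A sequence of 1-Lipschitz functions with values in a complete set which converges on a dense
set converges everywhere to a continuous function. -/
theorem exists_tendsto_of_lipschitz_of_dense {X Y : Type*} [PseudoMetricSpace X] [MetricSpace Y]
    {g : ℕ → X → Y} (hg : ∀ m s t, dist (g m s) (g m t) ≤ dist s t) {E : Set Y} (hE : IsComplete E)
    (hgE : ∀ m s, g m s ∈ E) {D : Set X} (hD : Dense D)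
    (h : ∀ s ∈ D, ∃ ℓ, Tendsto (g · s) atTop (𝓝 ℓ)) :
    ∃ F : X → Y, Continuous F ∧ ∀ s, Tendsto (g · s) atTop (𝓝 (F s)) := by
  have key : ∀ s, ∃ ℓ, Tendsto (g · s) atTop (𝓝 ℓ) := by
    intro s
    have hc : CauchySeq (g · s) := by
      rw [Metric.cauchySeq_iff]
      intro ε hε
      obtain ⟨t, ht, hst⟩ := hD.exists_dist_lt s (ε := ε / 3) (by positivity)
      obtain ⟨ℓ, hℓ⟩ := h t ht
      obtain ⟨M, hM⟩ := Metric.cauchySeq_iff.1 hℓ.cauchySeq (ε / 3) (by positivity)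
      refine ⟨M, fun m hm n hn => ?_⟩
      have h1 := dist_triangle4 (g m s) (g m t) (g n t) (g n s)
      have h2 := hg m s t
      have h3 := hg n t s
      rw [dist_comm t s] at h3
      have h4 := hM m hm n hn
      linarith
    obtain ⟨ℓ, -, hℓ⟩ := cauchySeq_tendsto_of_isComplete hE (fun m => hgE m s) hc
    exact ⟨ℓ, hℓ⟩
  choose F hF using key
  refine ⟨F, ?_, hF⟩
  refine (LipschitzWith.of_dist_le_mul (K := 1) fun s t => ?_).continuous
  rw [NNReal.coe_one, one_mul]
  exact le_of_tendsto ((hF s).dist (hF t)) (Eventually.of_forall fun m => hg m s t)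

/-- A character `χ₁` modulo `d q`, with `d` prime to `p`, which agrees with the primitive character
of `χ` at the integers prime to `p`. -/
structure FirstKind {N : ℕ} (χ : DirichletCharacter (PadicAlgCl p) N) {d : ℕ}
    (χ₁ : DirichletCharacter (PadicAlgCl p) (d * conductorQ p)) : Prop where
  not_dvd : ¬ p ∣ d
  even : χ₁.Even
  apply_eq : ∀ a : ℕ, ¬ p ∣ a → χ.primitiveCharacter (a : ZMod _) = χ₁ (a : ZMod _)
  conductor_dvd : χ.conductor ∣ d * conductorQ p

theorem teichmullerCharAlg_inv_pow_neg_one (n : ℕ) :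
    ((teichmullerCharAlg p)⁻¹ ^ n) (-1) = (-1) ^ n := by
  have h3 := three_le_conductorQ p
  have h : teichmullerChar p (-1) = -1 := by
    have h1 : ¬ p ∣ conductorQ p - 1 := fun h => by
      have := Nat.dvd_sub (dvd_conductorQ p) h
      rw [Nat.sub_sub_self (by omega)] at this
      exact hp.out.one_lt.ne' (Nat.dvd_one.1 this)
    have := teich_eq_neg_one (p := p) (b := conductorQ p - 1) (by
      rw [Nat.cast_sub (by omega), Nat.cast_one, sub_add_cancel]) h1
    rw [teich, Nat.cast_sub (by omega), ZMod.natCast_self, Nat.cast_one, zero_sub] at this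
    exact this
  have h' : teichmullerCharAlg p (-1) = -1 := by
    rw [teichmullerCharAlg, MulChar.ringHomComp_apply, h, map_neg, map_one]
  rcases Nat.eq_zero_or_pos n with rfl | hn
  · rw [pow_zero, pow_zero, MulChar.one_apply isUnit_one.neg]
  · rw [MulChar.pow_apply' _ hn.ne', MulChar.inv_apply_eq_inv', h', inv_neg, inv_one]

variable {N : ℕ} {χ : DirichletCharacter (PadicAlgCl p) N} {d : ℕ}
  {χ₁ : DirichletCharacter (PadicAlgCl p) (d * conductorQ p)} {k : ℕ}
  {ψ : DirichletCharacter (PadicAlgCl p) (p ^ (k + 1 + delta p))}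

theorem layerChars_apply_pow (hψ : ψ ∈ layerChars p k) :
    ψ ((1 + conductorQ p : ℕ) : ZMod _) ^ p ^ k = 1 := by
  rw [← MulChar.pow_apply' ψ (pow_ne_zero _ hp.out.ne_zero), (mem_layerChars.1 hψ).2,
    MulChar.one_apply (isUnit_natCast_pow (not_dvd_one_add_conductorQ p))]

theorem lcm_dvd_stickModulus (hd : χ.conductor ∣ d * conductorQ p) {m : ℕ} (hm : k ≤ m) :
    Nat.lcm χ.conductor (p ^ (k + 1 + delta p)) ∣ stickModulus p d m := by
  refine Nat.lcm_dvd (hd.trans ⟨p ^ m, rfl⟩) ?_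
  rw [← conductorQ_mul_pow]
  exact (conductorQ_mul_pow_dvd_stickModulus p d k).trans (stickModulus_dvd hm)

variable {M : ℕ} {η : DirichletCharacter (PadicAlgCl p) M} {n : ℕ}

/-- c ≡ -b for each of the three moduli involved; χ₁ and ψ are even, and ω⁻ⁿ(-1) = (-1)^n. -/
theorem twist_neg_of_apply_eq (heven : χ₁.Even)
    (hη : ∀ a : ℕ, ¬ p ∣ a → η (a : ZMod _) = χ₁ (a : ZMod _) * (ψ (a : ZMod _) *
      ((teichmullerCharAlg p)⁻¹ ^ n) (a : ZMod (conductorQ p))))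
    (hψ : ψ ∈ layerChars p k) {m b c : ℕ} (hm : k ≤ m) (hb : ¬ p ∣ b)
    (hbc : b + c = stickModulus p d m) :
    η (c : ZMod _) = (-1) ^ n * η (b : ZMod _) := by
  have hc : ¬ p ∣ c := fun hc => hb ((Nat.dvd_add_left hc).1 (hbc ▸ dvd_stickModulus p d m))
  have key : ∀ M : ℕ, M ∣ stickModulus p d m → (c : ZMod M) = -1 * (b : ZMod M) := by
    intro M hM
    have h1 : ((b + c : ℕ) : ZMod M) = 0 := by
      rw [hbc]; exact (ZMod.natCast_eq_zero_iff _ _).2 hM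
    push_cast at h1
    linear_combination h1
  rw [hη b hb, hη c hc, key _ ⟨p ^ m, rfl⟩, key (p ^ (k + 1 + delta p)) (by
      rw [← conductorQ_mul_pow]
      exact (conductorQ_mul_pow_dvd_stickModulus p d k).trans (stickModulus_dvd hm)),
    key (conductorQ p) ((dvd_mul_right _ _).trans (conductorQ_mul_pow_dvd_stickModulus p d m)),
    map_mul, map_mul, map_mul, teichmullerCharAlg_inv_pow_neg_one]
  have e1 : χ₁ (-1) = 1 := heven
  have e2 : ψ (-1) = 1 := (mem_layerChars.1 hψ).1
  rw [e1, e2]; ring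

/-- Convergence of `stickPoly` at the points corresponding to the integers `1 - n`. -/
theorem exists_isLValue_tendsto [NeZero M] (ιinf : AlgebraicClosure ℚ →+* ℂ)
    (ιp : AlgebraicClosure ℚ →+* PadicAlgCl p) (hd : ¬ p ∣ d) (heven : χ₁.Even)
    (hη : ∀ a : ℕ, ¬ p ∣ a → η (a : ZMod _) = χ₁ (a : ZMod _) * (ψ (a : ZMod _) *
      ((teichmullerCharAlg p)⁻¹ ^ n) (a : ZMod (conductorQ p))))
    (hM : M ∣ stickModulus p d k) {ε : PadicAlgCl p}
    (hsum : ∀ m (h : ℕ → PadicAlgCl p), ∑ a ∈ stickIndex p d m, χ₁ (a : ZMod _) *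
      h (angleIdx p m a) = ε * ∑ i ∈ Finset.range (p ^ m), h i)
    (hψ : ψ ∈ layerChars p k) (hn : 1 ≤ n) :
    ∃ v, IsLValue ιinf ιp η (1 - (n : ℤ)) v ∧
      Tendsto (fun m => (stickPoly χ₁ m).eval
        (ψ ((1 + conductorQ p : ℕ) : ZMod _) * qPowAlg p ((n : ℤ_[p]) - 1))) atTop
      (𝓝 (-(((2 : PadicAlgCl p) ^ delta p)⁻¹ *
        ((1 - η (p : ZMod _) * (p : PadicAlgCl p) ^ (n - 1)) * v)) -
        ε * (algebraMap ℤ_[p] (PadicAlgCl p) (qPowSlope p 0) / d /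
          (ψ ((1 + conductorQ p : ℕ) : ZMod _) * qPowAlg p n - 1)))) := by
  have hζ := layerChars_apply_pow hψ
  have hn0 : (n : PadicAlgCl p) ≠ 0 := Nat.cast_ne_zero.2 (by omega)
  refine ⟨_, isLValue_genBernoulli ιinf ιp η hn ?_, ?_⟩
  -- The excluded case ζ(0) cannot occur: the character modulo 1 is even, whereas for n = 1 the
  -- twist is odd.
  · by_contra! hcon
    obtain ⟨rfl, rfl⟩ := hcon
    have h1 : ¬ p ∣ 1 := fun h => hp.out.one_lt.ne' (Nat.dvd_one.1 h)
    have h2 : 1 + (stickModulus p d k - 1) = stickModulus p d k :=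
      Nat.add_sub_cancel' (Nat.pos_of_ne_zero (stickModulus_ne_zero hd k))
    have h3 := twist_neg_of_apply_eq heven hη hψ le_rfl h1 h2
    have h4 : ∀ x : ZMod 1, η x = 1 := fun x => by rw [Subsingleton.elim x 1, map_one]
    rw [h4, h4, pow_one, mul_one] at h3
    exact two_ne_zero (by linear_combination h3 : (2 : PadicAlgCl p) = 0)
  · have hH := tendsto_moment_stickIndex hd hM
      (Φ := fun a => η (a : ZMod _)) (fun b => by
        rw [Nat.cast_add, ZMod.natCast_self, add_zero])
      (fun b => by rw [Nat.cast_mul, map_mul]) (fun b => norm_dirichletCharacter_le_one _ _) hn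
      (fun m b c hm hb hbc => twist_neg_of_apply_eq heven hη hψ hm hb hbc)
    have hΦ : ∀ m a, k ≤ m → ¬ p ∣ a → η (a : ZMod _) * (a : PadicAlgCl p) ^ n =
        χ₁ (a : ZMod _) * ψ ((1 + conductorQ p : ℕ) : ZMod _) ^ angleIdx p m a *
          algebraMap ℤ_[p] (PadicAlgCl p) (angle p a) ^ n := by
      intro m a hm ha
      have h6 : (p : ℤ_[p]) ^ k ∣ angleLog p a - angleIdx p m a :=
        (pow_dvd_pow _ hm).trans (pow_dvd_angleLog_sub_angleIdx m a)
      have e : ∀ x y z w : PadicAlgCl p, x * (y * z) * w = x * y * (z * w) :=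
        fun x y z w => by ring
      rewrite [hη a ha, layerChars_apply hψ ha h6,
        ← teichmullerCharAlg_inv_pow_apply n a (by omega)]
      exact e _ _ _ _
    have h5 := tendsto_stickPoly_eval_natCast hd hsum hζ hn (Φ := fun a => η (a : ZMod _)) hΦ
      (by with_reducible exact hH)
    convert h5 using 3
    field_simp

theorem dense_one_sub_natCast (p : ℕ) [Fact p.Prime] :
    Dense {s : ℤ_[p] | ∃ n : ℕ, 1 ≤ n ∧ s = 1 - n} := by
  have hd : DenseRange (fun m : ℕ => -(m : ℤ_[p])) :=
    (Homeomorph.neg ℤ_[p]).surjective.denseRange.comp PadicInt.denseRange_natCast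
      (Homeomorph.neg ℤ_[p]).continuous
  refine Dense.mono ?_ hd
  rintro _ ⟨m, rfl⟩
  exact ⟨m + 1, by omega, by push_cast; ring⟩

/-- Convergence is known at the dense set of points 1 - n; integrality makes the evaluations
1-Lipschitz in s, so it extends to all s with a continuous limit. -/
theorem FirstKind.exists_tendsto_stickPoly [NeZero N] (ιinf : AlgebraicClosure ℚ →+* ℂ)
    (ιp : AlgebraicClosure ℚ →+* PadicAlgCl p) (h : FirstKind χ χ₁) {ε : PadicAlgCl p}
    (hsum : ∀ m (h : ℕ → PadicAlgCl p), ∑ a ∈ stickIndex p d m, χ₁ (a : ZMod _) *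
      h (angleIdx p m a) = ε * ∑ i ∈ Finset.range (p ^ m), h i)
    (hψ : ψ ∈ layerChars p k) :
    ∃ F : ℤ_[p] → PadicAlgCl p, Continuous F ∧
      (∀ s, Tendsto (fun m => (stickPoly χ₁ m).eval
        (ψ ((1 + conductorQ p : ℕ) : ZMod _) * qPowAlg p (-s))) atTop (𝓝 (F s))) ∧
      ∀ n : ℕ, 1 ≤ n → ∃ v, IsLValue ιinf ιp (twist (mul χ ψ) n) (1 - (n : ℤ)) v ∧
        F (1 - n) = -(((2 : PadicAlgCl p) ^ delta p)⁻¹ *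
          ((1 - twist (mul χ ψ) n (p : ZMod _) * (p : PadicAlgCl p) ^ (n - 1)) * v)) -
          ε * (algebraMap ℤ_[p] (PadicAlgCl p) (qPowSlope p 0) / d /
            (ψ ((1 + conductorQ p : ℕ) : ZMod _) * qPowAlg p n - 1)) := by
  have hd := h.not_dvd
  have : NeZero (d * conductorQ p) := ⟨mul_ne_zero (fun h => hd (h ▸ dvd_zero p)) (NeZero.ne _)⟩
  set ζ := ψ ((1 + conductorQ p : ℕ) : ZMod _) with hζdef
  have hζ : ζ ^ p ^ k = 1 := layerChars_apply_pow hψ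
  have hζ1 : ‖ζ‖ = 1 := norm_eq_one_of_pow_eq_one' (pow_ne_zero _ hp.out.ne_zero) hζ
  choose! v hv hlim using fun (n : ℕ) (hn : 1 ≤ n) =>
    exists_isLValue_tendsto ιinf ιp hd h.even (η := twist (mul χ ψ) n)
      (fun a ha => by rw [twist_apply χ ψ n ha, h.apply_eq a ha])
      ((conductor_twist_dvd χ ψ n).trans (lcm_dvd_stickModulus h.conductor_dvd le_rfl)) hsum hψ hn
  -- The algebraic closure of ℚ_p is not complete; all evaluations lie in this finite, hence
  -- complete, extension.
  let E : IntermediateField ℚ_[p] (PadicAlgCl p) :=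
    IntermediateField.adjoin ℚ_[p] (insert ζ (Set.range χ₁))
  have hfin : FiniteDimensional ℚ_[p] E := by
    have : Finite (insert ζ (Set.range χ₁) : Set (PadicAlgCl p)) :=
      ((Set.finite_range χ₁).insert ζ).to_subtype
    exact IntermediateField.finiteDimensional_adjoin
      (fun _ _ => (Algebra.IsAlgebraic.isAlgebraic _).isIntegral)
  have hcomp : IsComplete (E : Set (PadicAlgCl p)) :=
    have : FiniteDimensional ℚ_[p] (Subalgebra.toSubmodule E.toSubalgebra) := hfin
    Submodule.complete_of_finiteDimensional (Subalgebra.toSubmodule E.toSubalgebra)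
  have hZp : ∀ x : ℤ_[p], algebraMap ℤ_[p] (PadicAlgCl p) x ∈ E := fun x => by
    rw [IsScalarTower.algebraMap_apply ℤ_[p] ℚ_[p] (PadicAlgCl p)]
    exact E.algebraMap_mem _
  have hEmem : ∀ m (s : ℤ_[p]), (stickPoly χ₁ m).eval (ζ * qPowAlg p (-s)) ∈ E := by
    intro m s
    rw [stickPoly_eval]
    refine sum_mem fun a _ => mul_mem (mul_mem ?_ (hZp _)) (pow_mem (mul_mem ?_ (hZp _)) _)
    · exact IntermediateField.subset_adjoin _ _ (Set.mem_insert_of_mem _ ⟨_, rfl⟩)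
    · exact IntermediateField.subset_adjoin _ _ (Set.mem_insert _ _)
  obtain ⟨F, hFc, hF⟩ := exists_tendsto_of_lipschitz_of_dense
    (g := fun m (s : ℤ_[p]) => (stickPoly χ₁ m).eval (ζ * qPowAlg p (-s)))
    (fun m s t => by
      rw [dist_eq_norm, dist_eq_norm]
      refine ((coeffBound_stickPoly hd χ₁ m).norm_eval_sub_le ?_ ?_).trans ?_
      · rw [norm_mul, hζ1, norm_qPowAlg, one_mul]
      · rw [norm_mul, hζ1, norm_qPowAlg, one_mul]
      · rw [← mul_sub, norm_mul, hζ1, one_mul]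
        refine (norm_qPowAlg_sub_le _ _).trans ?_
        rw [neg_sub_neg, norm_sub_rev]) hcomp hEmem (dense_one_sub_natCast p) (by
      rintro _ ⟨n, hn, rfl⟩
      have := hlim n hn
      rw [← neg_sub 1 (n : ℤ_[p])] at this
      exact ⟨_, this⟩)
  refine ⟨F, hFc, hF, fun n hn => ⟨v n, hv n hn, ?_⟩⟩
  have := hlim n hn
  rw [← neg_sub 1 (n : ℤ_[p])] at this
  exact tendsto_nhds_unique (hF (1 - n)) this

/-- The `p`-adic `L`-function as a limit of polynomials. -/
theorem FirstKind.tendsto_stickPoly [NeZero N] (ιinf : AlgebraicClosure ℚ →+* ℂ)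
    (ιp : AlgebraicClosure ℚ →+* PadicAlgCl p) (h : FirstKind χ χ₁) {ε : PadicAlgCl p}
    (hsum : ∀ m (h : ℕ → PadicAlgCl p), ∑ a ∈ stickIndex p d m, χ₁ (a : ZMod _) *
      h (angleIdx p m a) = ε * ∑ i ∈ Finset.range (p ^ m), h i)
    (hψ : ψ ∈ layerChars p k)
    (hpole : ε ≠ 0 → ψ ((1 + conductorQ p : ℕ) : ZMod _) = 1 → mul χ ψ = 1) (s : ℤ_[p])
    (hs : mul χ ψ = 1 → s ≠ 1) :
    Tendsto (fun m => (stickPoly χ₁ m).eval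
        (ψ ((1 + conductorQ p : ℕ) : ZMod _) * qPowAlg p (-s))) atTop
      (𝓝 (-(factor ιinf ιp χ ψ s) -
        ε * (algebraMap ℤ_[p] (PadicAlgCl p) (qPowSlope p 0) / d /
          (ψ ((1 + conductorQ p : ℕ) : ZMod _) * qPowAlg p (1 - s) - 1)))) := by
  classical
  set ζ := ψ ((1 + conductorQ p : ℕ) : ZMod _) with hζdef
  have hζ : ζ ^ p ^ k = 1 := layerChars_apply_pow hψ
  obtain ⟨F, hFc, hF, hval⟩ := h.exists_tendsto_stickPoly ιinf ιp hsum hψ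
  rw [← hζdef] at hF hval
  set c := algebraMap ℤ_[p] (PadicAlgCl p) (qPowSlope p 0) / (d : PadicAlgCl p)
  have h2 : ((2 : PadicAlgCl p) ^ delta p) ≠ 0 := pow_ne_zero _ two_ne_zero
  -- The limit formula is solved for the L-function, with the conventional value 0 at the pole. This
  -- function interpolates correctly, so it proves existence, and uniqueness equates it with
  -- `padicL`.
  let L : ℤ_[p] → PadicAlgCl p := fun s => if mul χ ψ = 1 ∧ s = 1 then 0 else
    2 ^ delta p * (-(F s) - ε * (c / (ζ * qPowAlg p (1 - s) - 1)))
  have hL : IsPadicLFunction ιinf ιp (mul χ ψ) L := by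
    refine ⟨?_, ?_, ?_⟩
    · have hcont : ContinuousOn (fun s => (2 : PadicAlgCl p) ^ delta p *
          (-(F s) - ε * (c / (ζ * qPowAlg p (1 - s) - 1)))) {s | mul χ ψ = 1 → s ≠ 1} := by
        refine continuousOn_const.mul (hFc.continuousOn.neg.sub ?_)
        by_cases hε : ε = 0
        · simp only [hε, zero_mul]; exact continuousOn_const
        · refine continuousOn_const.mul (continuousOn_const.div ?_ ?_)
          · have h3 : Continuous fun s : ℤ_[p] => qPowAlg p (1 - s) :=
              (continuous_algebraMap_padicInt p).comp ((continuous_qPow p).comp (by fun_prop))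
            exact ((continuous_const.mul h3).sub continuous_const).continuousOn
          · intro s hs h4
            obtain ⟨h5, h6⟩ := mul_qPowAlg_eq_one hζ (sub_eq_zero.1 h4)
            exact hs (hpole hε h5) (sub_eq_zero.1 h6).symm
      refine hcont.congr fun s hs => ?_
      exact if_neg fun h' => hs h'.1 h'.2
    · intro n hn
      obtain ⟨v, hv, h7⟩ := hval n hn
      refine ⟨v, hv, ?_⟩
      have hn1 : (1 - (n : ℤ_[p])) ≠ 1 := fun h' => by
        have : (n : ℤ_[p]) = 0 := by linear_combination -h'
        have : n = 0 := by exact_mod_cast this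
        omega
      simp only [L, hn1, and_false, if_false]
      rw [h7, sub_sub_cancel]
      field_simp
      ring
    · intro h'
      simp [L, h']
  have hpL : padicL ιinf ιp (mul χ ψ) = L := by
    have hex : ∃ L, IsPadicLFunction ιinf ιp (mul χ ψ) L := ⟨L, hL⟩
    have : padicL ιinf ιp (mul χ ψ) = hex.choose := by
      funext s; simp only [padicL, dif_pos hex]
    rw [this]
    exact hex.choose_spec.unique hL
  convert hF s using 2
  rw [factor, hpL]
  have hs' : ¬ (mul χ ψ = 1 ∧ s = 1) := fun h' => hs h'.1 h'.2
  simp only [L, if_neg hs']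
  field_simp
  ring

end PadicLimit

end

noncomputable section

open Polynomial

/-- The Frobenius congruence in the residue field of a prime `P`. -/
theorem Ideal.pow_card_pow_inertiaDeg_sub_mem {A B : Type*} [CommRing A] [CommRing B] [Algebra A B]
    [Module.Finite A B] (m : Ideal A) [m.IsMaximal] (P : Ideal B) [P.IsPrime] [P.LiesOver m]
    [Finite (A ⧸ m)] (x : B) : x ^ Nat.card (A ⧸ m) ^ P.inertiaDeg A - x ∈ P := by
  have hmax : P.IsMaximal := Ideal.IsMaximal.of_liesOver_isMaximal P m
  let := Ideal.Quotient.field m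
  have : Module.Finite (A ⧸ m) (B ⧸ P) := Module.Finite.of_restrictScalars_finite A _ _
  have hcard : Nat.card (B ⧸ P) = Nat.card (A ⧸ m) ^ P.inertiaDeg A := by
    rw [Ideal.inertiaDeg_eq_of_isMaximal m P, Module.natCard_eq_pow_finrank (K := A ⧸ m)]
  have : Finite (B ⧸ P) := Module.finite_of_finite (A ⧸ m)
  let := Fintype.ofFinite (B ⧸ P)
  let := Ideal.Quotient.field P
  rw [← hcard, Nat.card_eq_fintype_card, ← Ideal.Quotient.eq_zero_iff_mem, map_sub, map_pow,
    sub_eq_zero]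
  exact FiniteField.pow_card _

namespace PadicLimit

open DirichletCharacter

variable {p : ℕ} [hp : Fact p.Prime]

/-! ### The ring generated by the values of a character and the residue degree -/

/-- `inertiaDegIn` selects some prime above p; this makes that prime available. -/
theorem exists_isPrime_inertiaDeg {N : ℕ} (χ : DirichletCharacter (PadicAlgCl p) N) :
    ∃ P : Ideal (integralClosure ℤ_[p] (charField χ)), P.IsPrime ∧
      P.LiesOver (IsLocalRing.maximalIdeal ℤ_[p]) ∧ residueDegree χ = P.inertiaDeg ℤ_[p] := by
  have hinj : Function.Injective (algebraMap ℤ_[p] (integralClosure ℤ_[p] (charField χ))) := by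
    have h1 : Function.Injective (algebraMap ℤ_[p] (charField χ)) := by
      rw [IsScalarTower.algebraMap_eq ℤ_[p] ℚ_[p] (charField χ)]
      exact (algebraMap ℚ_[p] (charField χ)).injective.comp (IsFractionRing.injective ℤ_[p] ℚ_[p])
    exact fun a b hab => h1 (congrArg Subtype.val hab)
  have h : ∃ P : Ideal (integralClosure ℤ_[p] (charField χ)), P.IsPrime ∧
      P.LiesOver (IsLocalRing.maximalIdeal ℤ_[p]) := by
    have : FaithfulSMul ℤ_[p] (integralClosure ℤ_[p] (charField χ)) :=
      (faithfulSMul_iff_algebraMap_injective _ _).2 hinj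
    obtain ⟨P⟩ := (inferInstance : Nonempty ((IsLocalRing.maximalIdeal ℤ_[p]).primesOver
      (integralClosure ℤ_[p] (charField χ))))
    exact ⟨P.1, P.2.1, P.2.2⟩
  refine ⟨h.choose, h.choose_spec.1, h.choose_spec.2, ?_⟩
  rw [residueDegree, Ideal.inertiaDegIn, dif_pos h]

section CharRing

variable {N : ℕ} [NeZero N] (χ : DirichletCharacter (PadicAlgCl p) N)

theorem isIntegral_dirichletCharacter (a : ZMod N) : IsIntegral ℤ_[p] (χ a) := by
  by_cases ha : IsUnit a
  · obtain ⟨x, rfl⟩ := ha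
    refine IsIntegral.of_pow (Fintype.card_pos (α := (ZMod N)ˣ)) ?_
    rw [← map_pow, ← Units.val_pow_eq_pow_val, pow_card_eq_one, Units.val_one, map_one]
    exact isIntegral_one
  · rw [χ.map_nonunit ha]; exact isIntegral_zero

theorem norm_le_one_of_mem_charRing {x : PadicAlgCl p} (hx : x ∈ charRing χ) : ‖x‖ ≤ 1 := by
  induction hx using Algebra.adjoin_induction with
  | mem x hx => obtain ⟨a, rfl⟩ := hx; exact norm_dirichletCharacter_le_one χ a
  | algebraMap r => rw [norm_algebraMap_padicInt]; exact PadicInt.norm_le_one r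
  | add x y _ _ hx hy => exact (IsUltrametricDist.norm_add_le_max _ _).trans (max_le hx hy)
  | mul x y _ _ hx hy => exact norm_mul_le_one hx hy

/-- Character values are integral, so the ring is a finitely generated ℤ_p-module and a continuous
image of ℤ_p^n. -/
theorem isCompact_charRing : IsCompact (charRing χ : Set (PadicAlgCl p)) := by
  have hfg : (Subalgebra.toSubmodule (charRing χ)).FG :=
    fg_adjoin_of_finite (Set.finite_range χ) (by
      rintro _ ⟨a, rfl⟩; exact isIntegral_dirichletCharacter χ a)
  obtain ⟨n, s, hs⟩ := Submodule.fg_iff_exists_fin_generating_family.1 hfg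
  have hset : (charRing χ : Set (PadicAlgCl p)) = Set.range fun c : Fin n → ℤ_[p] =>
      ∑ i, algebraMap ℤ_[p] (PadicAlgCl p) (c i) * s i := by
    ext x
    rw [SetLike.mem_coe, ← Subalgebra.mem_toSubmodule, ← hs, Submodule.mem_span_range_iff_exists_fun]
    simp only [Algebra.smul_def, Set.mem_range]
  rw [hset]
  exact isCompact_range (continuous_finsetSum _ fun i _ =>
    ((continuous_algebraMap_padicInt p).comp (continuous_apply i)).mul continuous_const)

/-- An element of a finite extension of `ℚ_p` of norm at most `1` is integral over `ℤ_p`. -/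
theorem isIntegral_of_norm_le_one {x : PadicAlgCl p} (hx : ‖x‖ ≤ 1) : IsIntegral ℤ_[p] x := by
  have hint : IsIntegral ℚ_[p] x := (Algebra.IsAlgebraic.isAlgebraic x).isIntegral
  have hmon := minpoly.monic hint
  have h1 : spectralValue (minpoly ℚ_[p] x) ≤ 1 := hx
  rw [spectralValue_le_one_iff hmon] at h1
  have hlift : minpoly ℚ_[p] x ∈ Polynomial.lifts (algebraMap ℤ_[p] ℚ_[p]) := by
    rw [Polynomial.lifts_iff_coeff_lifts]
    intro n
    exact ⟨⟨_, h1 n⟩, rfl⟩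
  obtain ⟨g, hg, -, hgm⟩ := Polynomial.lifts_and_natDegree_eq_and_monic hlift hmon
  refine ⟨g, hgm, ?_⟩
  rw [IsScalarTower.algebraMap_eq ℤ_[p] ℚ_[p] (PadicAlgCl p), ← Polynomial.eval₂_map, hg]
  exact minpoly.aeval ℚ_[p] x

theorem natCard_quotient_maximalIdeal :
    Nat.card (ℤ_[p] ⧸ IsLocalRing.maximalIdeal ℤ_[p]) = p := by
  exact (Nat.card_congr (PadicInt.residueField (p := p)).toEquiv).trans (Nat.card_zmod p)

/-- The residue field at P has p^d elements, so x^(p^d) - x lies in P. Elements of P have norm below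
1. -/
theorem residueDegree_ne_zero_and_pow_sub_mem :
    residueDegree χ ≠ 0 ∧ ∀ x ∈ charRing χ, ‖x ^ p ^ residueDegree χ - x‖ < 1 := by
  obtain ⟨P, hP, hPo, hdeg⟩ := exists_isPrime_inertiaDeg χ
  have hfin : Module.Finite ℤ_[p] (integralClosure ℤ_[p] (charField χ)) :=
    IsIntegralClosure.finite ℤ_[p] ℚ_[p] (charField χ) _
  refine ⟨by rw [hdeg]; exact (P.inertiaDeg_pos ℤ_[p]).ne', fun x hx => ?_⟩
  have hxF : x ∈ charField χ := by
    have : charRing χ ≤ (charField χ).toSubalgebra.restrictScalars ℤ_[p] :=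
      Algebra.adjoin_le (IntermediateField.subset_adjoin _ _)
    exact this hx
  have hO : ∀ y : charField χ, ‖(y : PadicAlgCl p)‖ ≤ 1 →
      y ∈ integralClosure ℤ_[p] (charField χ) := fun y hy => by
    have := isIntegral_of_norm_le_one hy
    rw [mem_integralClosure_iff]
    exact (isIntegral_algHom_iff ((charField χ).val.restrictScalars ℤ_[p])
      (charField χ).val.injective).1 this
  have hfinite : Finite (ℤ_[p] ⧸ IsLocalRing.maximalIdeal ℤ_[p]) :=
    Nat.finite_of_card_ne_zero (by rw [natCard_quotient_maximalIdeal]; exact hp.out.ne_zero)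
  let x' : integralClosure ℤ_[p] (charField χ) := ⟨⟨x, hxF⟩, hO _ (norm_le_one_of_mem_charRing χ hx)⟩
  have hmem := Ideal.pow_card_pow_inertiaDeg_sub_mem (IsLocalRing.maximalIdeal ℤ_[p]) P x'
  rw [natCard_quotient_maximalIdeal, ← hdeg] at hmem
  have hyR : x ^ p ^ residueDegree χ - x ∈ charRing χ := sub_mem (pow_mem hx _) hx
  refine lt_of_le_of_ne (norm_le_one_of_mem_charRing χ hyR) fun hy => ?_
  set y := x' ^ p ^ residueDegree χ - x'
  have hyy : ((y : charField χ) : PadicAlgCl p) = x ^ p ^ residueDegree χ - x := rfl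
  have hy0 : (y : charField χ) ≠ 0 := fun h => by
    rw [← hyy, h] at hy
    simp at hy
  -- If y had norm 1, its inverse would also be integral, and P would contain a unit.
  let z : integralClosure ℤ_[p] (charField χ) := ⟨(y : charField χ)⁻¹, hO _ (by
    have : (((y : charField χ)⁻¹ : charField χ) : PadicAlgCl p) =
      (((y : charField χ)) : PadicAlgCl p)⁻¹ := rfl
    rw [this, norm_inv, hyy, hy, inv_one])⟩
  have h1 : z * y = 1 := Subtype.ext (inv_mul_cancel₀ hy0)
  exact hP.ne_top ((Ideal.eq_top_iff_one P).2 (h1 ▸ P.mul_mem_left z hmem))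

end CharRing

end PadicLimit

end

/-! ### Conjugates of primitive characters, and reduction to modulus d q. -/

noncomputable section

open Polynomial

namespace DirichletCharacter

variable {R S : Type*} [CommRing R] [CommRing S] {N : ℕ}

theorem changeLevel_ringHomComp {M : ℕ} (h : N ∣ M) (χ : DirichletCharacter R N) (τ : R →+* S) :
    changeLevel h (χ.ringHomComp τ) = (changeLevel h χ).ringHomComp τ := by
  ext x
  rw [changeLevel_eq_cast_of_dvd, MulChar.ringHomComp_apply, MulChar.ringHomComp_apply,
    changeLevel_eq_cast_of_dvd]

theorem conductor_ringHomComp_dvd (χ : DirichletCharacter R N) (τ : R →+* S) [NeZero N] :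
    DirichletCharacter.conductor (χ.ringHomComp τ) ∣ χ.conductor := by
  have h : χ.ringHomComp τ = changeLevel χ.conductor_dvd_level (χ.primitiveCharacter.ringHomComp τ) := by
    rw [changeLevel_ringHomComp, changeLevel_primitiveCharacter]
  rw [h, conductor_changeLevel]
  exact conductor_dvd_level _

theorem conductor_ringHomComp_equiv (χ : DirichletCharacter R N) (τ : R ≃+* S) [NeZero N] :
    DirichletCharacter.conductor (χ.ringHomComp (τ : R →+* S)) = χ.conductor := by
  refine Nat.dvd_antisymm (conductor_ringHomComp_dvd χ _) ?_
  have h : χ = (χ.ringHomComp (τ : R →+* S)).ringHomComp (τ.symm : S →+* R) := by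
    ext x; simp [MulChar.ringHomComp_apply]
  conv_lhs => rw [h]
  exact conductor_ringHomComp_dvd _ _

theorem primitiveCharacter_natCast_of_isPrimitive [Nontrivial R] [NoZeroDivisors R] [NeZero N]
    {χ : DirichletCharacter R N} (hχ : χ.conductor = N) (a : ℕ) :
    χ.primitiveCharacter (a : ZMod _) = χ (a : ZMod _) := by
  by_cases ha : a.Coprime N
  · exact primitiveCharacter_natCast χ ha
  · rw [(apply_natCast_eq_zero_iff χ a).2 ha, (apply_natCast_eq_zero_iff _ a).2 (by rwa [hχ])]

theorem primitiveCharacter_ringHomComp_natCast {R S : Type*} [Field R] [Field S]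
    (χ : DirichletCharacter R N) (τ : R ≃+* S) [NeZero N] (a : ℕ) :
    DirichletCharacter.primitiveCharacter (χ.ringHomComp (τ : R →+* S)) (a : ZMod _) =
      τ (χ.primitiveCharacter (a : ZMod _)) := by
  have h : χ.ringHomComp (τ : R →+* S) = changeLevel χ.conductor_dvd_level
      (χ.primitiveCharacter.ringHomComp (τ : R →+* S)) := by
    rw [changeLevel_ringHomComp, changeLevel_primitiveCharacter]
  have hc : NeZero χ.conductor := ⟨χ.conductor_ne_zero⟩
  have h2 := primitiveCharacter_changeLevel_natCast χ.conductor_dvd_level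
      (χ.primitiveCharacter.ringHomComp (τ : R →+* S)) a
  rw [← h] at h2
  rw [h2, primitiveCharacter_natCast_of_isPrimitive]
  · rfl
  · rw [conductor_ringHomComp_equiv]
    exact χ.primitiveCharacter_isPrimitive

end DirichletCharacter

namespace PadicLimit

open DirichletCharacter

variable {p : ℕ} [hp : Fact p.Prime]

theorem natCast_coprime_iff {d a : ℕ} (ha : ¬ p ∣ a) :
    a.Coprime (d * conductorQ p) ↔ a.Coprime d := by
  rw [Nat.coprime_mul_iff_right, and_iff_left (coprime_conductorQ ha)]

/-- There is b with ⟨b⟩ so close to 1 that ψ(b) = 1, but with χ₁(b) ≠ 1. Hence no layer twist of χ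
has a pole. -/
theorem mul_ne_one_of_firstKind {N : ℕ} [NeZero N] {χ : DirichletCharacter (PadicAlgCl p) N}
    {d : ℕ} {χ₁ : DirichletCharacter (PadicAlgCl p) (d * conductorQ p)} (h : FirstKind χ χ₁)
    (h1 : χ₁ ≠ 1) {k : ℕ} {ψ : DirichletCharacter (PadicAlgCl p) (p ^ (k + 1 + delta p))}
    (hψ : ψ ∈ layerChars p k) : mul χ ψ ≠ 1 := by
  intro hcon
  obtain ⟨b, hb, -, hlog, hχb⟩ := exists_apply_ne_one h.not_dvd h.even h1 k
  have hpb : ¬ p ∣ b := fun h =>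
    hp.out.one_lt.ne' (Nat.dvd_one.1 (hb ▸ Nat.dvd_gcd h (dvd_stickModulus p d k)))
  have h2 : ψ (b : ZMod _) = 1 := by
    rw [layerChars_apply hψ (i := 0) hpb (by simpa using hlog), pow_zero]
  have h3 := primitiveCharacter_mul_changeLevel χ ψ (Nat.dvd_lcm_left N (p ^ (k + 1 + delta p)))
    (Nat.dvd_lcm_right N (p ^ (k + 1 + delta p))) rfl hpb
  rw [mul] at hcon
  rw [hcon, h2, mul_one, h.apply_eq b hpb] at h3
  apply hχb
  rw [← h3]
  have : Subsingleton (ZMod (1 : DirichletCharacter (PadicAlgCl p)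
      (Nat.lcm N (p ^ (k + 1 + delta p)))).conductor) := by
    rw [conductor_one]; infer_instance
  rw [Subsingleton.elim ((b : ℕ) : ZMod (1 : DirichletCharacter (PadicAlgCl p)
      (Nat.lcm N (p ^ (k + 1 + delta p)))).conductor) 1, map_one]

/-- d is the prime-to-p part of the conductor. The hypothesis bounds the p-part by q, so the
primitive character can be lifted to modulus d q. -/
theorem exists_firstKind {N : ℕ} [NeZero N] {χ : DirichletCharacter (PadicAlgCl p) N}
    (heven : χ.Even) (hcond : ¬ ((if p = 2 then 8 else p ^ 2) ∣ χ.conductor)) (hχ : χ ≠ 1) :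
    ∃ (d : ℕ) (χ₁ : DirichletCharacter (PadicAlgCl p) (d * conductorQ p)),
      FirstKind χ χ₁ ∧ χ₁ ≠ 1 ∧ ∀ a, χ₁ a ∈ charRing χ := by
  have hc0 := χ.conductor_ne_zero
  set v := χ.conductor.factorization p with hv
  set d := χ.conductor / p ^ v with hd
  have hpd : ¬ p ∣ d := Nat.not_dvd_ordCompl hp.out hc0
  have hdc : d ∣ χ.conductor := Nat.ordCompl_dvd _ _
  have hprod : p ^ v * d = χ.conductor := Nat.ordProj_mul_ordCompl_eq_self _ _
  have hvle : v ≤ 1 + delta p := by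
    by_contra! hlt
    apply hcond
    have h2 : (if p = 2 then 8 else p ^ 2) = p ^ (2 + delta p) := by
      split_ifs with h
      · simp [delta, h]
      · simp [delta, h]
    rw [h2]
    exact (pow_dvd_pow p (by omega)).trans (Nat.ordProj_dvd χ.conductor p)
  have hcd : χ.conductor ∣ d * conductorQ p := by
    rw [← hprod, mul_comm, conductorQ]
    exact mul_dvd_mul_left _ (pow_dvd_pow _ hvle)
  have hd0 : d ≠ 0 := fun h => hpd (h ▸ dvd_zero p)
  have hne : NeZero (d * conductorQ p) := ⟨mul_ne_zero hd0 (NeZero.ne _)⟩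
  refine ⟨d, changeLevel hcd χ.primitiveCharacter, ⟨hpd, ?_, fun a ha => ?_, hcd⟩, ?_, fun a => ?_⟩
  · have h1 := changeLevel_eq_cast_of_dvd' χ.primitiveCharacter hcd (a := -1)
      (isCoprime_one_left.neg_left)
    have h2 := χ.primitiveCharacter_apply_of_isCoprime (a := -1) (isCoprime_one_left.neg_left)
    rw [h2] at h1
    push_cast at h1
    exact h1.trans heven
  · by_cases hac : a.Coprime d
    · rw [changeLevel_natCast _ _ ((natCast_coprime_iff ha).2 hac)]
    · rw [(apply_natCast_eq_zero_iff _ a).2 fun h => hac ((natCast_coprime_iff ha).1 h),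
        (apply_natCast_eq_zero_iff _ a).2 fun h => hac (h.of_dvd_right hdc)]
  · rw [Ne, changeLevel_eq_one_iff]
    intro h1
    apply hχ
    rw [← χ.changeLevel_primitiveCharacter, h1, map_one]
  · by_cases ha : IsUnit a
    · obtain ⟨x, rfl⟩ := ha
      rw [changeLevel_eq_cast_of_dvd]
      -- A unit modulo the conductor lifts to a unit modulo N, so each value of χ₁ at a unit is a
      -- value of χ itself.
      obtain ⟨y, hy⟩ := ZMod.unitsMap_surjective χ.conductor_dvd_level (ZMod.unitsMap hcd x)
      have h3 := changeLevel_eq_cast_of_dvd χ.primitiveCharacter χ.conductor_dvd_level y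
      rw [χ.changeLevel_primitiveCharacter] at h3
      have h4 : (((y : ZMod N)).cast : ZMod χ.conductor) = ((x : ZMod (d * conductorQ p))).cast := by
        have := congrArg Units.val hy
        rwa [ZMod.unitsMap_val, ZMod.unitsMap_val] at this
      rw [← h4, ← h3]
      exact Algebra.subset_adjoin ⟨_, rfl⟩
    · rw [MulChar.map_nonunit _ ha]
      exact zero_mem _

/-- The limit theorem in terms of the characters of the layers. -/
theorem exists_tendsto_prod_layerChars (R : Subring (PadicAlgCl p))
    (hR : IsCompact (R : Set (PadicAlgCl p))) (hR1 : ∀ x ∈ R, ‖x‖ ≤ 1) {d : ℕ} (hd0 : d ≠ 0)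
    (hd : ∀ x ∈ R, ‖x ^ p ^ d - x‖ < 1) {f : ℕ → (PadicAlgCl p)[X]}
    (hf : ∀ m i, (f m).coeff i ∈ R)
    (hlim : ∀ k, ∀ ψ ∈ layerChars p k, ∀ s, ∃ ℓ, Tendsto (fun m => (f m).eval
        (ψ ((1 + conductorQ p : ℕ) : ZMod _) * qPowAlg p (-s))) atTop (𝓝 ℓ)) :
    ∃ F : PadicAlgCl p → ℤ_[p] → PadicAlgCl p,
      (∀ k, ∀ ψ ∈ layerChars p k, ∀ s, Tendsto (fun m => (f m).eval
        (ψ ((1 + conductorQ p : ℕ) : ZMod _) * qPowAlg p (-s))) atTop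
        (𝓝 (F (ψ ((1 + conductorQ p : ℕ) : ZMod _)) s))) ∧
      ∃ ℓ ∈ R, ∀ s, Tendsto (fun n => ∏ ψ ∈ layerChars p (n * d),
        F (ψ ((1 + conductorQ p : ℕ) : ZMod _)) s) atTop (𝓝 ℓ) := by
  have h1 : ∀ ζ : PadicAlgCl p, ∀ s, ∃ ℓ, (∃ n, ζ ^ p ^ n = 1) →
      Tendsto (fun m => (f m).eval (ζ * qPowAlg p s)) atTop (𝓝 ℓ) := by
    intro ζ s
    by_cases h : ∃ n, ζ ^ p ^ n = 1
    · obtain ⟨n, hn⟩ := h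
      obtain ⟨ψ, hψ, rfl⟩ := exists_layerChars_apply_eq hn
      obtain ⟨ℓ, hℓ⟩ := hlim n ψ hψ (-s)
      rw [neg_neg] at hℓ
      exact ⟨ℓ, fun _ => hℓ⟩
    · exact ⟨0, fun h' => absurd h' h⟩
  choose F hF using h1
  obtain ⟨ℓ, hℓ, hlimℓ⟩ := exists_tendsto_prod_nthRootsFinset R hR hR1 hd0 hd hf (F := F)
    (fun n ζ s h => hF ζ s ⟨n, h⟩)
  refine ⟨fun ζ s => F ζ (-s), fun k ψ hψ s => hF _ _ ⟨k, layerChars_apply_pow hψ⟩, ℓ, hℓ,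
    fun s => (hlimℓ (-s)).congr fun n => ?_⟩
  exact (prod_layerChars (n * d) fun ζ => F ζ (-s)).symm

end PadicLimit

end

/-! ### Nontrivial characters. -/

noncomputable section

open Polynomial

namespace PadicLimit

open DirichletCharacter

variable {p : ℕ} [hp : Fact p.Prime]

theorem stickPoly_coeff_mem (R : Subring (PadicAlgCl p))
    (hR : ∀ x : ℤ_[p], algebraMap ℤ_[p] (PadicAlgCl p) x ∈ R) {d : ℕ}
    {χ₁ : DirichletCharacter (PadicAlgCl p) (d * conductorQ p)} (hχ₁ : ∀ a, χ₁ a ∈ R) (m i : ℕ) :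
    (stickPoly χ₁ m).coeff i ∈ R := by
  rw [stickPoly, finsetSum_coeff]
  refine sum_mem fun a _ => ?_
  rw [coeff_C_mul, coeff_X_pow]
  refine mul_mem (mul_mem (hχ₁ _) (hR _)) ?_
  split_ifs
  · exact one_mem _
  · exact zero_mem _

section Nontrivial

variable (ιinf : AlgebraicClosure ℚ →+* ℂ) (ιp : AlgebraicClosure ℚ →+* PadicAlgCl p)
  {N : ℕ} [NeZero N] {χ : DirichletCharacter (PadicAlgCl p) N}

/-- The leading sums cancel, so the pole term drops out with ε = 0. -/
theorem FirstKind.tendsto_neg_stickPoly {d : ℕ}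
    {χ₁ : DirichletCharacter (PadicAlgCl p) (d * conductorQ p)} (h : FirstKind χ χ₁) (h1 : χ₁ ≠ 1)
    {k : ℕ} {ψ : DirichletCharacter (PadicAlgCl p) (p ^ (k + 1 + delta p))}
    (hψ : ψ ∈ layerChars p k) (s : ℤ_[p]) :
    Tendsto (fun m => (-stickPoly χ₁ m).eval
      (ψ ((1 + conductorQ p : ℕ) : ZMod _) * qPowAlg p (-s))) atTop (𝓝 (factor ιinf ιp χ ψ s)) := by
  have h2 := h.tendsto_stickPoly ιinf ιp (ε := 0) (fun m g => by
    rw [sum_stickIndex_eq_zero h.not_dvd h.even h1, zero_mul]) hψ (fun h' => absurd rfl h') s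
    (fun h' => absurd h' (mul_ne_one_of_firstKind h h1 hψ))
  rw [zero_mul, sub_zero] at h2
  have h3 := h2.neg
  rw [neg_neg] at h3
  exact h3.congr fun m => by rw [eval_neg]

theorem exists_tendsto_layerProduct (heven : χ.Even)
    (hcond : ¬ ((if p = 2 then 8 else p ^ 2) ∣ χ.conductor)) (hχ : χ ≠ 1) :
    ∃ ℓ ∈ charRing χ, ∀ s, Tendsto
      (fun n => layerProduct ιinf ιp χ (n * residueDegree χ) s) atTop (𝓝 ℓ) := by
  obtain ⟨d, χ₁, h, h1, hmem⟩ := exists_firstKind heven hcond hχ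
  obtain ⟨hd0, hd⟩ := residueDegree_ne_zero_and_pow_sub_mem χ
  obtain ⟨F, hF, ℓ, hℓ, hlim⟩ := exists_tendsto_prod_layerChars (charRing χ).toSubring
    (isCompact_charRing χ) (fun x hx => norm_le_one_of_mem_charRing χ hx) hd0 hd
    (f := fun m => -stickPoly χ₁ m)
    (fun m i => by
      rw [coeff_neg]
      exact neg_mem (stickPoly_coeff_mem (charRing χ).toSubring
        (fun x => (charRing χ).algebraMap_mem x) hmem m i))
    (fun k ψ hψ s => ⟨_, h.tendsto_neg_stickPoly ιinf ιp h1 hψ s⟩)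
  refine ⟨ℓ, hℓ, fun s => (hlim s).congr fun n => Finset.prod_congr rfl fun ψ hψ => ?_⟩
  exact tendsto_nhds_unique (hF _ ψ hψ s) (h.tendsto_neg_stickPoly ιinf ιp h1 hψ s)

end Nontrivial

/-! ### Conjugate characters -/

section Conj

instance normal_padicAlgCl : Normal ℚ_[p] (PadicAlgCl p) :=
  inferInstanceAs (Normal ℚ_[p] (AlgebraicClosure ℚ_[p]))

/-- An extension of `σ` to the algebraic closure of `ℚ_p`. -/
def liftGal {N : ℕ} (χ : DirichletCharacter (PadicAlgCl p) N)
    (σ : charField χ ≃ₐ[ℚ_[p]] charField χ) : PadicAlgCl p ≃+* PadicAlgCl p :=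
  (σ.liftNormal (PadicAlgCl p)).toRingEquiv

theorem liftGal_apply {N : ℕ} (χ : DirichletCharacter (PadicAlgCl p) N)
    (σ : charField χ ≃ₐ[ℚ_[p]] charField χ) (x : charField χ) :
    liftGal χ σ (x : PadicAlgCl p) = (σ x : PadicAlgCl p) :=
  σ.liftNormal_commutes (PadicAlgCl p) x

theorem liftGal_algebraMap {N : ℕ} (χ : DirichletCharacter (PadicAlgCl p) N)
    (σ : charField χ ≃ₐ[ℚ_[p]] charField χ) (x : ℤ_[p]) :
    liftGal χ σ (algebraMap ℤ_[p] (PadicAlgCl p) x) = algebraMap ℤ_[p] (PadicAlgCl p) x := by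
  rw [IsScalarTower.algebraMap_apply ℤ_[p] ℚ_[p] (PadicAlgCl p)]
  exact (σ.liftNormal (PadicAlgCl p)).commutes _

theorem conj_eq_ringHomComp {N : ℕ} (χ : DirichletCharacter (PadicAlgCl p) N)
    (σ : charField χ ≃ₐ[ℚ_[p]] charField χ) :
    conj χ σ = χ.ringHomComp (liftGal χ σ : PadicAlgCl p →+* PadicAlgCl p) := by
  ext x
  exact (liftGal_apply χ σ (charVal χ x)).symm

variable {N : ℕ} [NeZero N] (χ : DirichletCharacter (PadicAlgCl p) N)

/-- Any automorphism sends a root of unity to a power of itself. -/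
instance isGalois_charField : IsGalois ℚ_[p] (charField χ) := by
  have : Normal ℚ_[p] (charField χ) := by
    rw [IntermediateField.normal_iff_forall_map_le]
    intro σ
    rw [charField, IntermediateField.adjoin_map, IntermediateField.adjoin_le_iff]
    rintro _ ⟨_, ⟨a, rfl⟩, rfl⟩
    by_cases ha : IsUnit a
    · obtain ⟨x, rfl⟩ := ha
      have hpow : (χ (x : ZMod N)) ^ Fintype.card (ZMod N)ˣ = 1 := by
        rw [← map_pow, ← Units.val_pow_eq_pow_val, pow_card_eq_one, Units.val_one, map_one]
      have hpos : 0 < orderOf (χ (x : ZMod N)) :=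
        (isOfFinOrder_iff_pow_eq_one.2 ⟨_, Fintype.card_pos, hpow⟩).orderOf_pos
      have : NeZero (orderOf (χ (x : ZMod N))) := ⟨hpos.ne'⟩
      obtain ⟨i, -, hi⟩ := (IsPrimitiveRoot.orderOf (χ (x : ZMod N))).eq_pow_of_pow_eq_one
        (ξ := σ (χ (x : ZMod N))) (by rw [← map_pow, pow_orderOf_eq_one, map_one])
      change σ (χ (x : ZMod N)) ∈ charField χ
      rw [← hi]
      exact pow_mem (charVal χ (x : ZMod N)).2 i
    · rw [χ.map_nonunit ha]
      change σ 0 ∈ charField χ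
      rw [map_zero]
      exact zero_mem _
  exact ⟨⟩

variable {χ}

theorem even_conj {N : ℕ} {χ : DirichletCharacter (PadicAlgCl p) N} (h : χ.Even) (σ : charField χ ≃ₐ[ℚ_[p]] charField χ) : (conj χ σ).Even := by
  have h' : χ (-1) = 1 := h
  rw [conj_eq_ringHomComp]
  change liftGal χ σ (χ (-1)) = 1
  rw [h', map_one]

theorem conductor_conj (σ : charField χ ≃ₐ[ℚ_[p]] charField χ) :
    (conj χ σ).conductor = χ.conductor := by
  rw [conj_eq_ringHomComp, conductor_ringHomComp_equiv]

theorem ringHomComp_equiv_ne_one {M : ℕ} {χ : DirichletCharacter (PadicAlgCl p) M} (h : χ ≠ 1)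
    (τ : PadicAlgCl p ≃+* PadicAlgCl p) :
    χ.ringHomComp (τ : PadicAlgCl p →+* PadicAlgCl p) ≠ 1 := by
  intro h1
  apply h
  ext x
  apply τ.injective
  have := congrArg (fun η : DirichletCharacter (PadicAlgCl p) M => η x) h1
  simpa using this

theorem conj_ne_one {N : ℕ} {χ : DirichletCharacter (PadicAlgCl p) N} (h : χ ≠ 1) (σ : charField χ ≃ₐ[ℚ_[p]] charField χ) : conj χ σ ≠ 1 := by
  rw [conj_eq_ringHomComp]
  exact ringHomComp_equiv_ne_one h _

theorem FirstKind.conj {d : ℕ} {χ₁ : DirichletCharacter (PadicAlgCl p) (d * conductorQ p)}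
    (h : FirstKind χ χ₁) (σ : charField χ ≃ₐ[ℚ_[p]] charField χ) :
    FirstKind (conj χ σ)
      (χ₁.ringHomComp (liftGal χ σ : PadicAlgCl p →+* PadicAlgCl p)) := by
  refine ⟨h.not_dvd, ?_, fun a ha => ?_, (conductor_conj σ).symm ▸ h.conductor_dvd⟩
  · have h' : χ₁ (-1) = 1 := h.even
    change liftGal χ σ (χ₁ (-1)) = 1
    rw [h', map_one]
  · rw [conj_eq_ringHomComp, primitiveCharacter_ringHomComp_natCast, h.apply_eq a ha]
    rfl

theorem stickPoly_ringHomComp {d : ℕ}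
    (χ₁ : DirichletCharacter (PadicAlgCl p) (d * conductorQ p))
    (σ : charField χ ≃ₐ[ℚ_[p]] charField χ) (m : ℕ) :
    stickPoly (χ₁.ringHomComp (liftGal χ σ : PadicAlgCl p →+* PadicAlgCl p)) m =
      (stickPoly χ₁ m).map (liftGal χ σ : PadicAlgCl p →+* PadicAlgCl p) := by
  rw [stickPoly, stickPoly, Polynomial.map_sum]
  refine Finset.sum_congr rfl fun a _ => ?_
  have e : (liftGal χ σ : PadicAlgCl p →+* PadicAlgCl p)
      (χ₁ (a : ZMod _) * algebraMap ℤ_[p] (PadicAlgCl p) (stickCoeff p d m a)) =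
      (liftGal χ σ : PadicAlgCl p →+* PadicAlgCl p) (χ₁ (a : ZMod _)) *
        algebraMap ℤ_[p] (PadicAlgCl p) (stickCoeff p d m a) := by
    rw [RingHom.map_mul]
    congr 1
    exact liftGal_algebraMap χ σ _
  rw [Polynomial.map_mul, Polynomial.map_pow, map_X, map_C, MulChar.ringHomComp_apply, e]

/-- The product of the conjugates of an integral polynomial over `ℚ_p(χ)` has coefficients in
`ℤ_p`. -/
theorem prod_map_liftGal_coeff_mem {g : (PadicAlgCl p)[X]} (hg : ∀ i, g.coeff i ∈ charRing χ)
    (i : ℕ) : (∏ σ : charField χ ≃ₐ[ℚ_[p]] charField χ,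
      g.map (liftGal χ σ : PadicAlgCl p →+* PadicAlgCl p)).coeff i ∈
        (algebraMap ℤ_[p] (PadicAlgCl p)).range := by
  have hle : charRing χ ≤ (charField χ).toSubalgebra.restrictScalars ℤ_[p] :=
    Algebra.adjoin_le (IntermediateField.subset_adjoin _ _)
  obtain ⟨G, hG⟩ : ∃ G : (charField χ)[X], G.map (algebraMap (charField χ) (PadicAlgCl p)) = g := by
    have : g ∈ Polynomial.lifts (algebraMap (charField χ) (PadicAlgCl p)) := by
      rw [Polynomial.lifts_iff_coeff_lifts]
      exact fun n => ⟨⟨_, hle (hg n)⟩, rfl⟩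
    exact (Polynomial.mem_lifts _).1 this
  have hmap : ∀ σ : charField χ ≃ₐ[ℚ_[p]] charField χ,
      g.map (liftGal χ σ : PadicAlgCl p →+* PadicAlgCl p) =
        (G.map (σ : charField χ →+* charField χ)).map (algebraMap (charField χ) (PadicAlgCl p)) := by
    intro σ
    rw [← hG, Polynomial.map_map, Polynomial.map_map]
    congr 1
    ext x
    exact liftGal_apply χ σ x
  have hprod : ∏ σ : charField χ ≃ₐ[ℚ_[p]] charField χ,
      g.map (liftGal χ σ : PadicAlgCl p →+* PadicAlgCl p) =
      (∏ σ : charField χ ≃ₐ[ℚ_[p]] charField χ, G.map (σ : charField χ →+* charField χ)).map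
        (algebraMap (charField χ) (PadicAlgCl p)) := by
    rw [Polynomial.map_prod]
    exact Finset.prod_congr rfl fun σ _ => hmap σ
  set P := ∏ σ : charField χ ≃ₐ[ℚ_[p]] charField χ, G.map (σ : charField χ →+* charField χ)
  have hfix : P.coeff i ∈ Set.range (algebraMap ℚ_[p] (charField χ)) := by
    rw [IsGalois.mem_range_algebraMap_iff_fixed]
    intro τ
    -- Applying τ permutes the factors, by left translation on the Galois group.
    have h1 : P.map (τ : charField χ →+* charField χ) = P := by
      simp only [P]
      rw [Polynomial.map_prod]
      refine Fintype.prod_equiv (Equiv.mulLeft τ) _ _ fun σ => ?_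
      rw [Polynomial.map_map]
      rfl
    conv_rhs => rw [← h1]
    rw [coeff_map]
    rfl
  obtain ⟨y, hy⟩ := hfix
  have hval : (∏ σ : charField χ ≃ₐ[ℚ_[p]] charField χ,
      g.map (liftGal χ σ : PadicAlgCl p →+* PadicAlgCl p)).coeff i =
        algebraMap ℚ_[p] (PadicAlgCl p) y := by
    rw [hprod, coeff_map, ← hy]
    rfl
  -- Galois conjugation preserves the norm, so integrality survives and the coefficient, already in
  -- ℚ_p, lies in ℤ_p.
  have hnorm : ‖(∏ σ : charField χ ≃ₐ[ℚ_[p]] charField χ,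
      g.map (liftGal χ σ : PadicAlgCl p →+* PadicAlgCl p)).coeff i‖ ≤ 1 := by
    refine CoeffBound.prod (fun σ _ j => ?_) i
    rw [coeff_map]
    refine le_trans (le_of_eq ?_) (norm_le_one_of_mem_charRing χ (hg j))
    exact (spectralNorm_eq_of_equiv (σ.liftNormal (PadicAlgCl p)) (g.coeff j)).symm
  rw [hval, PadicAlgCl.norm_extends] at hnorm
  rw [hval]
  exact ⟨⟨y, hnorm⟩, rfl⟩

theorem norm_pow_sub_self_lt_one {x : PadicAlgCl p}
    (hx : x ∈ (algebraMap ℤ_[p] (PadicAlgCl p)).range) : ‖x ^ p ^ 1 - x‖ < 1 := by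
  obtain ⟨y, rfl⟩ := hx
  rw [← map_pow, ← map_sub, norm_algebraMap_padicInt, pow_one, ← PadicInt.mem_nonunits,
    ← IsLocalRing.mem_maximalIdeal, ← PadicInt.ker_toZMod, RingHom.mem_ker, map_sub, map_pow,
    ZMod.pow_card, sub_self]

theorem isCompact_range_algebraMap (p : ℕ) [Fact p.Prime] :
    IsCompact ((algebraMap ℤ_[p] (PadicAlgCl p)).range : Set (PadicAlgCl p)) := by
  rw [RingHom.coe_range]
  exact isCompact_range (continuous_algebraMap_padicInt p)

theorem norm_le_one_of_mem_range {x : PadicAlgCl p}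
    (hx : x ∈ (algebraMap ℤ_[p] (PadicAlgCl p)).range) : ‖x‖ ≤ 1 := by
  obtain ⟨y, rfl⟩ := hx
  rw [norm_algebraMap_padicInt]; exact PadicInt.norm_le_one y

/-- The product of the conjugate polynomials has coefficients in ℤ_p, where x^p ≡ x already. The
limit theorem applies with d = 1, along all layers. -/
theorem exists_tendsto_prod_conj (ιinf : AlgebraicClosure ℚ →+* ℂ)
    (ιp : AlgebraicClosure ℚ →+* PadicAlgCl p) (heven : χ.Even)
    (hcond : ¬ ((if p = 2 then 8 else p ^ 2) ∣ χ.conductor)) (hχ : χ ≠ 1) :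
    ∃ c : ℤ_[p], ∀ s, Tendsto (fun n => ∏ ψ ∈ layerChars p n,
      ∏ σ : charField χ ≃ₐ[ℚ_[p]] charField χ, factor ιinf ιp (conj χ σ) ψ s) atTop
      (𝓝 (algebraMap ℤ_[p] (PadicAlgCl p) c)) := by
  obtain ⟨d, χ₁, h, h1, hmem⟩ := exists_firstKind heven hcond hχ
  have key : ∀ k, ∀ ψ ∈ layerChars p k, ∀ s, Tendsto (fun m =>
      (∏ σ : charField χ ≃ₐ[ℚ_[p]] charField χ,
        (-stickPoly χ₁ m).map (liftGal χ σ : PadicAlgCl p →+* PadicAlgCl p)).eval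
        (ψ ((1 + conductorQ p : ℕ) : ZMod _) * qPowAlg p (-s))) atTop
      (𝓝 (∏ σ : charField χ ≃ₐ[ℚ_[p]] charField χ, factor ιinf ιp (conj χ σ) ψ s)) := by
    intro k ψ hψ s
    simp only [eval_prod]
    refine tendsto_finsetProd _ fun σ _ => ?_
    refine ((h.conj σ).tendsto_neg_stickPoly ιinf ιp (ringHomComp_equiv_ne_one h1 _) hψ s).congr
      fun m => ?_
    rw [stickPoly_ringHomComp, Polynomial.map_neg]
  obtain ⟨F, hF, ℓ, ⟨c, rfl⟩, hlim⟩ := exists_tendsto_prod_layerChars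
    (algebraMap ℤ_[p] (PadicAlgCl p)).range (isCompact_range_algebraMap p)
    (fun x hx => norm_le_one_of_mem_range hx) one_ne_zero (fun x hx => norm_pow_sub_self_lt_one hx)
    (fun m i => prod_map_liftGal_coeff_mem (χ := χ) (g := -stickPoly χ₁ m) (fun j => by
      rw [coeff_neg]
      exact neg_mem (stickPoly_coeff_mem (charRing χ).toSubring
        (fun x => (charRing χ).algebraMap_mem x) hmem m j)) i)
    (fun k ψ hψ s => ⟨_, key k ψ hψ s⟩)
  refine ⟨c, fun s => (hlim s).congr fun n => ?_⟩
  rw [mul_one]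
  exact Finset.prod_congr rfl fun ψ hψ => tendsto_nhds_unique (hF _ ψ hψ s) (key _ ψ hψ s)

end Conj

end PadicLimit

end

noncomputable section

open Polynomial

theorem norm_sub_le_max_norm {E : Type*} [SeminormedAddCommGroup E] [IsUltrametricDist E] (x y : E) :
    ‖x - y‖ ≤ max ‖x‖ ‖y‖ := by
  rw [sub_eq_add_neg, ← norm_neg y]
  exact IsUltrametricDist.norm_add_le_max _ _

/-- Modulo p, (x - 1)^p is congruent to x^p - 1. -/
theorem norm_sub_one_lt_of_norm_pow_sub_one_lt {K : Type*} [NormedField K] [IsUltrametricDist K]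
    {p : ℕ} [hp : Fact p.Prime] (hp1 : ‖(p : K)‖ < 1) {x : K} (hx : ‖x‖ ≤ 1)
    (h : ‖x ^ p - 1‖ < 1) : ‖x - 1‖ < 1 := by
  have h1 : CoeffBound 1 (C (x - 1)) := fun i => by
    rw [coeff_C]
    split_ifs
    · exact (norm_sub_le_max_norm _ _).trans (max_le hx norm_one.le)
    · simp
  have h2 := CoeffBound.add_pow_sub (p := p) h1 CoeffBound.one 0
  have e : ((C (x - 1) + 1 : K[X]) ^ p - (C (x - 1) ^ p + 1 ^ p)).coeff 0 =
      (x ^ p - 1) - (x - 1) ^ p := by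
    rw [coeff_zero_eq_eval_zero]
    simp
    ring
  rw [e] at h2
  have h3 : ‖(x - 1) ^ p‖ < 1 := by
    have h4 : (x - 1) ^ p = (x ^ p - 1) - ((x ^ p - 1) - (x - 1) ^ p) := by ring
    rw [h4]
    exact (norm_sub_le_max_norm _ _).trans_lt (max_lt h (h2.trans_lt hp1))
  rw [norm_pow] at h3
  exact (pow_lt_one_iff_of_nonneg (norm_nonneg _) hp.out.ne_zero).1 h3

theorem norm_sub_one_lt_of_pow_prime_pow_eq_one {K : Type*} [NormedField K] [IsUltrametricDist K]
    {p : ℕ} [hp : Fact p.Prime] (hp1 : ‖(p : K)‖ < 1) (n : ℕ) {x : K} (hx : x ^ p ^ n = 1) :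
    ‖x - 1‖ < 1 := by
  induction n generalizing x with
  | zero => rw [pow_zero, pow_one] at hx; simp [hx]
  | succ n ih =>
    refine norm_sub_one_lt_of_norm_pow_sub_one_lt hp1
      (norm_eq_one_of_pow_eq_one' (pow_ne_zero _ hp.out.ne_zero) hx).le (ih ?_)
    rw [← pow_mul, ← pow_succ', hx]

namespace PadicLimit

open DirichletCharacter

variable {p : ℕ} [hp : Fact p.Prime]

/-! ### The trivial character -/

theorem firstKind_one (p : ℕ) [hp : Fact p.Prime] :
    FirstKind (1 : DirichletCharacter (PadicAlgCl p) 1)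
      (1 : DirichletCharacter (PadicAlgCl p) (1 * conductorQ p)) := by
  refine ⟨fun h => hp.out.one_lt.ne' (Nat.dvd_one.1 h), ?_, fun a ha => ?_, ?_⟩
  · exact MulChar.one_apply isUnit_one.neg
  · have : Subsingleton (ZMod (1 : DirichletCharacter (PadicAlgCl p) 1).conductor) := by
      rw [conductor_one]; infer_instance
    rw [Subsingleton.elim ((a : ℕ) : ZMod (1 : DirichletCharacter (PadicAlgCl p) 1).conductor) 1,
      map_one, MulChar.one_apply]
    rw [one_mul]
    exact isUnit_natCast_conductorQ ha
  · rw [conductor_one]; exact one_dvd _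

theorem layerChars_eq_one {k : ℕ} {ψ : DirichletCharacter (PadicAlgCl p) (p ^ (k + 1 + delta p))}
    (hψ : ψ ∈ layerChars p k) (h : ψ ((1 + conductorQ p : ℕ) : ZMod _) = 1) : ψ = 1 := by
  refine MulChar.ext fun x => ?_
  have hx : ¬ p ∣ (x : ZMod (p ^ (k + 1 + delta p))).val :=
    (isUnit_iff_not_dvd_val (by omega) _).1 x.isUnit
  have h1 := layerChars_apply hψ hx (pow_dvd_sub_appr _ _)
  rw [h, one_pow, ZMod.natCast_val, ZMod.cast_id', id] at h1
  rw [h1, MulChar.one_apply_coe]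

theorem mul_one_eq_one {k : ℕ} {ψ : DirichletCharacter (PadicAlgCl p) (p ^ (k + 1 + delta p))}
    (hψ : ψ ∈ layerChars p k) (h : ψ ((1 + conductorQ p : ℕ) : ZMod _) = 1) :
    mul (1 : DirichletCharacter (PadicAlgCl p) 1) ψ = 1 := by
  rw [layerChars_eq_one hψ h, mul, map_one, map_one, one_mul]

theorem norm_p_lt_one (p : ℕ) [hp : Fact p.Prime] : ‖(p : PadicAlgCl p)‖ < 1 := by
  rw [norm_p_padicAlgCl]
  exact inv_lt_one_of_one_lt₀ (by exact_mod_cast hp.out.one_lt)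

/-- The numerators of the polynomials approximating `L_p(s, ψ)`. -/
def trivialPoly (p : ℕ) [Fact p.Prime] (m : ℕ) : (PadicAlgCl p)[X] :=
  C (((p - 1 : ℕ) : PadicAlgCl p) * algebraMap ℤ_[p] (PadicAlgCl p) (qPowSlope p 0)) +
    (C (qPowAlg p 1) * X - 1) *
      stickPoly (1 : DirichletCharacter (PadicAlgCl p) (1 * conductorQ p)) m

theorem eval_trivialPoly (m : ℕ) (ζ : PadicAlgCl p) (s : ℤ_[p]) :
    (trivialPoly p m).eval (ζ * qPowAlg p (-s)) =
      ((p - 1 : ℕ) : PadicAlgCl p) * algebraMap ℤ_[p] (PadicAlgCl p) (qPowSlope p 0) +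
      (ζ * qPowAlg p (1 - s) - 1) *
        (stickPoly (1 : DirichletCharacter (PadicAlgCl p) (1 * conductorQ p)) m).eval
          (ζ * qPowAlg p (-s)) := by
  rw [trivialPoly, eval_add, eval_mul, eval_sub, eval_mul, eval_C, eval_C, eval_X, eval_one,
    sub_eq_add_neg (1 : ℤ_[p]), qPowAlg_add]
  ring

/-- The term (p - 1) times the slope at 0 is a unit, while ζ(1+q)^(1-s) - 1 lies in the maximal
ideal. This is the source of the unit c_p. -/
theorem norm_eval_trivialPoly (m : ℕ) {ζ : PadicAlgCl p} {k : ℕ} (hζ : ζ ^ p ^ k = 1) (s : ℤ_[p]) :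
    ‖(trivialPoly p m).eval (ζ * qPowAlg p (-s))‖ = 1 := by
  have hζ1 : ‖ζ‖ = 1 := norm_eq_one_of_pow_eq_one' (pow_ne_zero _ hp.out.ne_zero) hζ
  have hp1 : ¬ p ∣ p - 1 := fun h => by
    have := Nat.dvd_sub dvd_rfl h
    rw [Nat.sub_sub_self hp.out.one_lt.le] at this
    exact hp.out.one_lt.ne' (Nat.dvd_one.1 this)
  rw [eval_trivialPoly]
  set A := ((p - 1 : ℕ) : PadicAlgCl p) * algebraMap ℤ_[p] (PadicAlgCl p) (qPowSlope p 0)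
  have hA : ‖A‖ = 1 := by
    rw [norm_mul, norm_natCast_padicAlgCl, norm_natCast_eq_one hp1, norm_algebraMap_padicInt,
      norm_qPowSlope, one_mul]
  have hw : ‖ζ * qPowAlg p (1 - s) - 1‖ < 1 := by
    have e : ζ * qPowAlg p (1 - s) - 1 = ζ * (qPowAlg p (1 - s) - 1) + (ζ - 1) := by ring
    rw [e]
    refine (IsUltrametricDist.norm_add_le_max _ _).trans_lt (max_lt ?_
      (norm_sub_one_lt_of_pow_prime_pow_eq_one (norm_p_lt_one p) k hζ))
    rw [norm_mul, hζ1, one_mul, ← qPowAlg_zero, qPowAlg, qPowAlg, ← map_sub,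
      norm_algebraMap_padicInt, norm_qPow_sub]
    exact (mul_le_of_le_one_right (norm_nonneg _) (PadicInt.norm_le_one _)).trans_lt
      (norm_conductorQ_lt_one p)
  have hB : ‖(ζ * qPowAlg p (1 - s) - 1) *
        (stickPoly (1 : DirichletCharacter (PadicAlgCl p) (1 * conductorQ p)) m).eval
          (ζ * qPowAlg p (-s))‖ < 1 := by
    rw [norm_mul]
    refine (mul_le_of_le_one_right (norm_nonneg _) ?_).trans_lt hw
    exact (coeffBound_stickPoly (firstKind_one p).not_dvd _ m).norm_eval_le zero_le_one
      (by rw [norm_mul, hζ1, norm_qPowAlg, one_mul])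
  rw [IsUltrametricDist.norm_add_eq_max_of_norm_ne_norm (by rw [hA]; exact hB.ne'), hA,
    max_eq_left hB.le]

theorem trivialPoly_coeff_mem (m i : ℕ) :
    (trivialPoly p m).coeff i ∈ (algebraMap ℤ_[p] (PadicAlgCl p)).range := by
  have hS : stickPoly (1 : DirichletCharacter (PadicAlgCl p) (1 * conductorQ p)) m ∈
      Polynomial.lifts (algebraMap ℤ_[p] (PadicAlgCl p)) := by
    rw [Polynomial.lifts_iff_coeff_lifts]
    intro j
    refine stickPoly_coeff_mem (algebraMap ℤ_[p] (PadicAlgCl p)).range (fun x => ⟨x, rfl⟩)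
      (fun a => ?_) m j
    by_cases ha : IsUnit a
    · rw [MulChar.one_apply ha]; exact one_mem _
    · rw [MulChar.map_nonunit _ ha]; exact zero_mem _
  have hT : trivialPoly p m ∈ Polynomial.lifts (algebraMap ℤ_[p] (PadicAlgCl p)) := by
    rw [trivialPoly, ← map_natCast (algebraMap ℤ_[p] (PadicAlgCl p)), ← map_mul]
    refine add_mem (Polynomial.C_mem_lifts _ _) (mul_mem
      ((Polynomial.mem_lifts _).2 ⟨C (qPow p 1) * X - 1, by simp [qPowAlg]⟩) hS)
  rw [Polynomial.lifts_iff_coeff_lifts] at hT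
  exact hT i

/-- Multiplying each factor by 1 - ζ(1+q)^(1-s) gives values of integral polynomials, whose products
converge to a unit ℓ. Dividing by the product of the removed factors yields c_p = ℓ divided by the
slope at 0. -/
theorem exists_tendsto_layerProduct_one (ιinf : AlgebraicClosure ℚ →+* ℂ)
    (ιp : AlgebraicClosure ℚ →+* PadicAlgCl p) :
    ∃ c : ℤ_[p]ˣ, ∀ s : ℤ_[p], s ≠ 1 → Tendsto
      (fun n : ℕ => (p : PadicAlgCl p) ^ (n + 1 + delta p) *
        layerProduct ιinf ιp (1 : DirichletCharacter (PadicAlgCl p) 1) n s)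
      atTop (𝓝 (algebraMap ℤ_[p] (PadicAlgCl p) c / (algebraMap ℤ_[p] (PadicAlgCl p) s - 1))) := by
  have h := firstKind_one p
  have hsum := sum_stickIndex_one (p := p)
  -- The limit theorem asks for convergence at every s, including s = 1; only the identification
  -- with the L-function excludes that point.
  have hex : ∀ k, ∀ ψ ∈ layerChars p k, ∀ s, ∃ ℓ, Tendsto (fun m => (trivialPoly p m).eval
      (ψ ((1 + conductorQ p : ℕ) : ZMod _) * qPowAlg p (-s))) atTop (𝓝 ℓ) := by
    intro k ψ hψ s
    obtain ⟨F, -, hF, -⟩ := h.exists_tendsto_stickPoly ιinf ιp hsum hψ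
    exact ⟨_, (((hF s).const_mul _).const_add _).congr fun m => (eval_trivialPoly m _ s).symm⟩
  have hval : ∀ k, ∀ ψ ∈ layerChars p k, ∀ s, s ≠ 1 → Tendsto (fun m => (trivialPoly p m).eval
      (ψ ((1 + conductorQ p : ℕ) : ZMod _) * qPowAlg p (-s))) atTop
      (𝓝 ((1 - ψ ((1 + conductorQ p : ℕ) : ZMod _) * qPowAlg p (1 - s)) *
        factor ιinf ιp (1 : DirichletCharacter (PadicAlgCl p) 1) ψ s)) := by
    intro k ψ hψ s hs
    have h1 := h.tendsto_stickPoly ιinf ιp hsum hψ (fun _ h' => mul_one_eq_one hψ h') s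
      (fun _ => hs)
    have hw : ψ ((1 + conductorQ p : ℕ) : ZMod _) * qPowAlg p (1 - s) - 1 ≠ 0 := fun h' =>
      hs (sub_eq_zero.1 (mul_qPowAlg_eq_one (layerChars_apply_pow hψ) (sub_eq_zero.1 h')).2).symm
    have h2 := ((h1.const_mul (ψ ((1 + conductorQ p : ℕ) : ZMod _) * qPowAlg p (1 - s) - 1)).const_add
      (((p - 1 : ℕ) : PadicAlgCl p) * algebraMap ℤ_[p] (PadicAlgCl p) (qPowSlope p 0))).congr
      fun m => (eval_trivialPoly m _ s).symm
    convert h2 using 2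
    rw [Nat.cast_one, div_one]
    field_simp
    ring
  obtain ⟨F, hF, ℓ, ⟨ℓ₀, rfl⟩, hlim⟩ := exists_tendsto_prod_layerChars
    (algebraMap ℤ_[p] (PadicAlgCl p)).range (isCompact_range_algebraMap p)
    (fun x hx => norm_le_one_of_mem_range hx) one_ne_zero (fun x hx => norm_pow_sub_self_lt_one hx)
    trivialPoly_coeff_mem hex
  replace hlim : ∀ s, Tendsto (fun n => ∏ ψ ∈ layerChars p n,
      F (ψ ((1 + conductorQ p : ℕ) : ZMod _)) s) atTop
      (𝓝 (algebraMap ℤ_[p] (PadicAlgCl p) ℓ₀)) := fun s => (hlim s).congr fun n => by rw [mul_one]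
  have hnorm : ‖ℓ₀‖ = 1 := by
    rw [← norm_algebraMap_padicInt]
    refine tendsto_nhds_unique (hlim 0).norm ?_
    refine tendsto_const_nhds.congr fun n => ?_
    rw [norm_prod, Finset.prod_eq_one]
    intro ψ hψ
    refine tendsto_nhds_unique (hF n ψ hψ 0).norm ?_
    exact tendsto_const_nhds.congr fun m =>
      (norm_eval_trivialPoly m (layerChars_apply_pow hψ) 0).symm
  obtain ⟨uℓ, huℓ⟩ := PadicInt.isUnit_iff.2 hnorm
  obtain ⟨uM, huM⟩ := PadicInt.isUnit_iff.2 (norm_qPowSlope (0 : ℤ_[p]))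
  refine ⟨uℓ * uM⁻¹, fun s hs => ?_⟩
  have hM : ∀ t : ℤ_[p], algebraMap ℤ_[p] (PadicAlgCl p) (qPowSlope p t) ≠ 0 := fun t => by
    rw [← norm_ne_zero_iff, norm_algebraMap_padicInt, norm_qPowSlope]; exact one_ne_zero
  have hs1 : algebraMap ℤ_[p] (PadicAlgCl p) s - 1 ≠ 0 := by
    rw [← map_one (algebraMap ℤ_[p] (PadicAlgCl p)), ← map_sub, ← norm_ne_zero_iff,
      norm_algebraMap_padicInt, norm_ne_zero_iff]
    exact sub_ne_zero.2 hs
  have hc : algebraMap ℤ_[p] (PadicAlgCl p) ((uℓ * uM⁻¹ : ℤ_[p]ˣ) : ℤ_[p]) =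
      algebraMap ℤ_[p] (PadicAlgCl p) ℓ₀ / algebraMap ℤ_[p] (PadicAlgCl p) (qPowSlope p 0) := by
    rw [eq_div_iff (hM 0), ← map_mul, ← huM, ← huℓ, ← Units.val_mul, inv_mul_cancel_right]
  rw [hc]
  have hMlim : Tendsto (fun n : ℕ => algebraMap ℤ_[p] (PadicAlgCl p)
      (qPowSlope p (((p ^ n : ℕ) : ℤ_[p]) * (1 - s)))) atTop
      (𝓝 (algebraMap ℤ_[p] (PadicAlgCl p) (qPowSlope p 0))) := by
    refine (((continuous_algebraMap_padicInt p).comp (continuous_qPowSlope p)).tendsto 0).comp ?_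
    have h1 := (tendsto_natCast_mul_pow (p := p) 1).mul_const (1 - s)
    rw [zero_mul] at h1
    refine h1.congr fun n => ?_
    push_cast; ring
  have hfin := ((hlim s).div hMlim (hM 0)).div_const (algebraMap ℤ_[p] (PadicAlgCl p) s - 1)
  refine hfin.congr fun n => ?_
  have hFval : ∏ ψ ∈ layerChars p n, F (ψ ((1 + conductorQ p : ℕ) : ZMod _)) s =
      (∏ ψ ∈ layerChars p n, (1 - ψ ((1 + conductorQ p : ℕ) : ZMod _) * qPowAlg p (1 - s))) *
        layerProduct ιinf ιp (1 : DirichletCharacter (PadicAlgCl p) 1) n s := by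
    rw [layerProduct, ← Finset.prod_mul_distrib]
    exact Finset.prod_congr rfl fun ψ hψ => tendsto_nhds_unique (hF n ψ hψ s) (hval n ψ hψ s hs)
  have hpn : 0 < p ^ n := pow_pos hp.out.pos n
  have : NeZero (p ^ n : ℕ) := ⟨hpn.ne'⟩
  obtain ⟨ω, hω⟩ := HasEnoughRootsOfUnity.exists_primitiveRoot (PadicAlgCl p) (p ^ n)
  -- By the factorization of 1 - y^(p^n), the product is 1 - (1+q)^(p^n(1-s)), and the slope
  -- identity extracts s - 1 and p^(n+1+δ).
  have hprod : ∏ ψ ∈ layerChars p n, (1 - ψ ((1 + conductorQ p : ℕ) : ZMod _) * qPowAlg p (1 - s)) =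
      (algebraMap ℤ_[p] (PadicAlgCl p) s - 1) * ((p : PadicAlgCl p) ^ (n + 1 + delta p) *
        algebraMap ℤ_[p] (PadicAlgCl p) (qPowSlope p (((p ^ n : ℕ) : ℤ_[p]) * (1 - s)))) := by
    rw [prod_layerChars n fun ζ => 1 - ζ * qPowAlg p (1 - s),
      ← hω.pow_sub_pow_eq_prod_sub_mul 1 (qPowAlg p (1 - s)) hpn, one_pow, ← qPowAlg_nsmul, ← neg_sub,
      qPowAlg_sub_one]
    have e := congrArg (Nat.cast : ℕ → PadicAlgCl p) (conductorQ_mul_pow p n)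
    push_cast at e
    rw [← e]
    simp only [map_mul, map_natCast, map_sub, map_one, Nat.cast_pow, map_pow]
    ring
  rw [Pi.div_apply, hFval, hprod]
  have hp0 : (p : PadicAlgCl p) ≠ 0 := Nat.cast_ne_zero.2 hp.out.ne_zero
  have := hM (((p ^ n : ℕ) : ℤ_[p]) * (1 - s))
  field_simp

end PadicLimit

end

/-! ### The limit attached to a character and the product over its conjugates. -/

noncomputable section

namespace PadicLimit

variable {p : ℕ} [hp : Fact p.Prime]

open Classical in
/-- The limit `𝓛(χ)` of the products of `p`-adic `L`-functions (`0` if there is no limit). -/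
def limitL (ιinf : AlgebraicClosure ℚ →+* ℂ) (ιp : AlgebraicClosure ℚ →+* PadicAlgCl p) (N : ℕ)
    (χ : DirichletCharacter (PadicAlgCl p) N) : PadicAlgCl p :=
  if h : ∃ (_ : NeZero N) (ℓ : PadicAlgCl p), ℓ ∈ charRing χ ∧ ∀ s, Tendsto
    (fun n => layerProduct ιinf ιp χ (n * residueDegree χ) s) atTop (𝓝 ℓ) then h.choose_spec.choose
  else 0

theorem limitL_spec (ιinf : AlgebraicClosure ℚ →+* ℂ) (ιp : AlgebraicClosure ℚ →+* PadicAlgCl p)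
    {N : ℕ} [NeZero N] {χ : DirichletCharacter (PadicAlgCl p) N} (heven : χ.Even)
    (hcond : ¬ ((if p = 2 then 8 else p ^ 2) ∣ χ.conductor)) (hχ : χ ≠ 1) :
    limitL ιinf ιp N χ ∈ charRing χ ∧ ∀ s, Tendsto
      (fun n => layerProduct ιinf ιp χ (n * residueDegree χ) s) atTop (𝓝 (limitL ιinf ιp N χ)) := by
  have h : ∃ (_ : NeZero N) (ℓ : PadicAlgCl p), ℓ ∈ charRing χ ∧ ∀ s, Tendsto
      (fun n => layerProduct ιinf ιp χ (n * residueDegree χ) s) atTop (𝓝 ℓ) := by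
    obtain ⟨ℓ, h1, h2⟩ := exists_tendsto_layerProduct ιinf ιp heven hcond hχ
    exact ⟨inferInstance, ℓ, h1, h2⟩
  rw [limitL, dif_pos h]
  exact h.choose_spec.choose_spec

/-- The product of the limits attached to the conjugates of `χ`. -/
theorem prod_limitL_conj_eq (ιinf : AlgebraicClosure ℚ →+* ℂ)
    (ιp : AlgebraicClosure ℚ →+* PadicAlgCl p) {N : ℕ} [NeZero N]
    {χ : DirichletCharacter (PadicAlgCl p) N} (heven : χ.Even)
    (hcond : ¬ ((if p = 2 then 8 else p ^ 2) ∣ χ.conductor)) (hχ : χ ≠ 1) {c : PadicAlgCl p}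
    {s : ℤ_[p]} (hc : Tendsto (fun n => ∏ ψ ∈ layerChars p n,
      ∏ σ : charField χ ≃ₐ[ℚ_[p]] charField χ, factor ιinf ιp (conj χ σ) ψ s) atTop (𝓝 c)) :
    c = ∏ σ : charField χ ≃ₐ[ℚ_[p]] charField χ, limitL ιinf ιp N (conj χ σ) := by
  have hspec : ∀ σ, _ := fun σ : charField χ ≃ₐ[ℚ_[p]] charField χ =>
    (limitL_spec ιinf ιp (even_conj heven σ) (by rwa [conductor_conj]) (conj_ne_one hχ σ)).2
  -- Along multiples of D every individual product converges, since D is a nonzero multiple of each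
  -- residue degree; the equality of these degrees is not needed.
  set D := ∏ σ : charField χ ≃ₐ[ℚ_[p]] charField χ, residueDegree (conj χ σ)
  have hD : D ≠ 0 := Finset.prod_ne_zero_iff.2 fun σ _ =>
    (residueDegree_ne_zero_and_pow_sub_mem (conj χ σ)).1
  have hmul : Tendsto (fun n : ℕ => n * D) atTop atTop :=
    tendsto_id.atTop_mul_const' (Nat.pos_of_ne_zero hD)
  refine tendsto_nhds_unique (hc.comp hmul) ?_
  refine (tendsto_finsetProd Finset.univ fun σ _ => ?_).congr fun n => Finset.prod_comm
  obtain ⟨e, he⟩ : residueDegree (conj χ σ) ∣ D := Finset.dvd_prod_of_mem _ (Finset.mem_univ σ)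
  have he0 : e ≠ 0 := fun h => hD (by rw [he, h, mul_zero])
  have h1 : Tendsto (fun n : ℕ => n * e) atTop atTop :=
    tendsto_id.atTop_mul_const' (Nat.pos_of_ne_zero he0)
  refine ((hspec σ s).comp h1).congr fun n => ?_
  rw [Function.comp_apply, mul_assoc, mul_comm e, ← he]
  rfl

end PadicLimit

end
theorem theorem5 (p : ℕ) [Fact p.Prime]
    (ιinf : AlgebraicClosure ℚ →+* ℂ) (ιp : AlgebraicClosure ℚ →+* PadicAlgCl p) :
    -- nontrivial characters
    (∃ 𝓛 : ∀ N : ℕ, DirichletCharacter (PadicAlgCl p) N → PadicAlgCl p,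
      ∀ (N : ℕ) [NeZero N] (χ : DirichletCharacter (PadicAlgCl p) N),
        χ.Even → ¬ ((if p = 2 then 8 else p ^ 2) ∣ χ.conductor) → χ ≠ 1 →
        (∀ s : ℤ_[p], Tendsto
          (fun n : ℕ => PadicLimit.layerProduct ιinf ιp χ (n * PadicLimit.residueDegree χ) s)
          atTop (𝓝 (𝓛 N χ))) ∧
        𝓛 N χ ∈ PadicLimit.charRing χ ∧
        (∀ s : ℤ_[p], Tendsto
          (fun n : ℕ => ∏ ψ ∈ PadicLimit.layerChars p n,
            ∏ σ : PadicLimit.charField χ ≃ₐ[ℚ_[p]] PadicLimit.charField χ,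
              PadicLimit.factor ιinf ιp (PadicLimit.conj χ σ) ψ s)
          atTop (𝓝 (∏ σ : PadicLimit.charField χ ≃ₐ[ℚ_[p]] PadicLimit.charField χ,
            𝓛 N (PadicLimit.conj χ σ)))) ∧
        ∃ c : ℤ_[p], algebraMap ℤ_[p] (PadicAlgCl p) c =
          ∏ σ : PadicLimit.charField χ ≃ₐ[ℚ_[p]] PadicLimit.charField χ,
            𝓛 N (PadicLimit.conj χ σ)) ∧
    -- the trivial character
    (∃ c : ℤ_[p]ˣ, ∀ s : ℤ_[p], s ≠ 1 → Tendsto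
      (fun n : ℕ => (p : PadicAlgCl p) ^ (n + 1 + PadicLimit.delta p) *
        PadicLimit.layerProduct ιinf ιp (1 : DirichletCharacter (PadicAlgCl p) 1) n s)
      atTop (𝓝 (algebraMap ℤ_[p] (PadicAlgCl p) c / (algebraMap ℤ_[p] (PadicAlgCl p) s - 1)))) := by

  refine ⟨⟨PadicLimit.limitL ιinf ιp, fun N _ χ heven hcond hχ => ?_⟩,
    PadicLimit.exists_tendsto_layerProduct_one ιinf ιp⟩
  obtain ⟨hmem, hlim⟩ := PadicLimit.limitL_spec ιinf ιp heven hcond hχ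
  obtain ⟨c, hc⟩ := PadicLimit.exists_tendsto_prod_conj ιinf ιp heven hcond hχ
  -- c is the same for all s, so identifying it at s = 0 is enough.
  have hprod := PadicLimit.prod_limitL_conj_eq ιinf ιp heven hcond hχ (hc 0)
  refine ⟨hlim, hmem, fun s => ?_, c, hprod⟩
  rw [← hprod]
  exact hc s
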